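/- Let $d=2$. For linear maps $\Lambda,\Gamma$ on $2\times2$ complex matrices put $F(\Lambda,\Gamma)=\int\operatorname{tr}\big(\Lambda(\psi)^\dagger\Gamma(\psi)\big)\,d\psi$, the integral being uniform over all pure states $\psi$. Let $\mathbb G=\{\mathcal G\}$ be a finite family of single-qubit unitary channels forming a unitary 2-design, and let $\tilde{\mathbb G}=\{\tilde{\mathcal G}\}$ be a noisy implementation: to each $\mathcal G$ is assigned an arbitrary (gate-dependent) completely positive trace-preserving map $\tilde{\mathcal G}$. Write $\mathcal G_{m:1}=\mathcal G_m\cdots\mathcal G_1$ and $\tilde{\mathcal G}_{m:1}=\tilde{\mathcal G}_m\cdots\tilde{\mathcal G}_1$, let $\mathbb E$ be the average over independent, uniformly chosen gates, and put $$\mathcal F(\tilde{\mathbb G},\mathbb G,m)=\mathbb E\,F(\tilde{\mathcal G}_{m:1},\mathcal G_{m:1}),\qquad \mathcal E_R^{(4)}=\mathbb E\big[\mathcal G_{4:1}^\dagger\tilde{\mathcal G}_{4:1}\big].$$ Let $\Pi_{\rm tr}(\rho)=\rho-\tfrac12\operatorname{tr}(\rho)\,\mathbb I$. In the Liouville (Pauli-basis)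 representation let $\boldsymbol{\mathcal T}=\mathbb E[\boldsymbol{\mathcal G}\boldsymbol\Pi_{\rm tr}\otimes\tilde{\boldsymbol{\mathcal G}}]$. Write $B(\Lambda)$ for the $3\times3$ block of the Liouville matrix of $\Lambda$ acting on Bloch vectors. There are absolute constants $C,\varepsilon>0$ such that, whenever $\mathcal F(\tilde{\mathbb G},\mathbb G,1)\ge1-\varepsilon$, the following hold. 1. The maximum of $F(\mathcal E_R^{(4)}\mathcal V,\mathcal I)$ over all unitary channels $\mathcal V$ is attained at exactly one unitary channel $$\mathcal U=\operatorname*{arg\,max}_{\mathcal V}F\big(\mathcal E_R^{(4)}\mathcal V,\mathcal I\big).$$ 2. $\boldsymbol{\mathcal T}$ has a highest eigenvalue $p$ (a real eigenvalue such that every complex eigenvalue $\lambda$ satisfies $|\lambda|\le p$), and for this $\mathcal U$ and every $m\ge0$ $$\Big|\mathcal F(\tilde{\mathbb G},\mathcal U\mathbb G\mathcal U^\dagger,m)-\Big(\tfrac12+\tfrac12\,p^m\Big)\Big|\le C(1-p)^2 .$$ 3. $\mathcal U$ cancels the unitary part of the 4th-order right error: for $\mathcal D=\mathcal E_R^{(4)}\mathcal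 U$ the block $B(\mathcal D)$ is symmetric positive definite, $B(\mathcal E_R^{(4)})=B(\mathcal D)\,B(\mathcal U)^{T}$, and $\mathcal D$ is incoherent, that is, $$\Big|\frac{\langle\boldsymbol\Pi_{\rm tr},\boldsymbol{\mathcal D}\rangle}{\|\boldsymbol\Pi_{\rm tr}\|_F^2}-\frac{\|\boldsymbol{\mathcal D}\boldsymbol\Pi_{\rm tr}\|_F}{\|\boldsymbol\Pi_{\rm tr}\|_F}\Big|\le C\,\big(1-F(\mathcal D,\mathcal I)\big)^2 .$$ 4. $\mathcal U$ is obtained from the polar decomposition of the Bloch block: whenever $B(\mathcal E_R^{(4)})=DV$ with $D$ symmetric positive semidefinite and $V$ orthogonal, $V^{T}$ is the Bloch block of a unitary channel, and that channel is the maximizer $\mathcal U$. -/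

import Mathlib

open MeasureTheory Matrix
open scoped BigOperators Kronecker ComplexOrder

noncomputable section

/-! ### Superoperators and channels -/

/-- Linear maps on `d × d` complex matrices; the product is composition. -/
abbrev Superop (d : ℕ) : Type := Module.End ℂ (Matrix (Fin d) (Fin d) ℂ)

/-- The unitary channel `ρ ↦ u ρ u†` ("physical unitary"). -/
def unitaryChannel {d : ℕ} (u : unitaryGroup (Fin d) ℂ) : Superop d where
  toFun ρ := (u : Matrix (Fin d) (Fin d) ℂ) * ρ * (u : Matrix (Fin d) (Fin d) ℂ)ᴴ
  map_add' x y := by rw [mul_add, add_mul]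
  map_smul' c x := by simp

/-- The ampliation `id_k ⊗ Λ`: the map `Λ` is applied to each of the `k × k` blocks of size
`d × d` of the matrix `M`. -/
def ampliation {d : ℕ} (Λ : Superop d) (k : ℕ)
    (M : Matrix (Fin k × Fin d) (Fin k × Fin d) ℂ) :
    Matrix (Fin k × Fin d) (Fin k × Fin d) ℂ :=
  Matrix.of fun x y => Λ (Matrix.of fun a b => M (x.1, a) (y.1, b)) x.2 y.2

/-- Quantum channels: completely positive and trace preserving (that is, leakage-free) maps. -/
structure IsChannel {d : ℕ} (Λ : Superop d) : Prop where
  completelyPositive : ∀ (k : ℕ) (M : Matrix (Fin k × Fin d) (Fin k × Fin d) ℂ),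
    M.PosSemidef → (ampliation Λ k M).PosSemidef
  tracePreserving : ∀ ρ : Matrix (Fin d) (Fin d) ℂ, (Λ ρ).trace = ρ.trace

/-! ### Average fidelity -/

/-- The rank one projector `|ψ⟩⟨ψ|` on a vector `ψ`. -/
def pureState {d : ℕ} (ψ : EuclideanSpace ℂ (Fin d)) : Matrix (Fin d) (Fin d) ℂ :=
  vecMulVec (fun i => ψ i) (fun i => star (ψ i))

/-- The average fidelity `F(Λ, Γ) = ∫ ⟨Λ(ψ), Γ(ψ)⟩ dψ`, where `⟨A, B⟩ = tr (A† B)` and `ψ` is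
uniform over all pure states, i.e. distributed as the normalized surface measure of the unit
sphere of `ℂ^d`. (The integrand is real when `Λ` and `Γ` preserve hermiticity.) -/
def avgFidelity {d : ℕ} (Λ Γ : Superop d) : ℝ :=
  ⨍ ψ : Metric.sphere (0 : EuclideanSpace ℂ (Fin d)) 1,
    (((Λ (pureState ψ.1))ᴴ * Γ (pureState ψ.1)).trace).re
      ∂((volume : Measure (EuclideanSpace ℂ (Fin d))).toSphere)

/-! ### Circuits -/

/-- The circuit `g_{m:1} = g (s m) ⋯ g (s 2) g (s 1)` built from a gate-set `g` indexed by `ι`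
along the sequence `s` of `m` labels. -/
def circuit {ι M : Type*} [Monoid M] (g : ι → M) : (m : ℕ) → (Fin m → ι) → M
  | 0, _ => 1
  | m + 1, s => g (s (Fin.last m)) * circuit g m (Fin.init s)

/-- The gate-set circuit fidelity `𝓕(𝔾', 𝔾, m)`: the expectation, over `m` independent uniformly
random labels, of the average fidelity of the circuit over `𝔾'` to the circuit over `𝔾`. -/
def gateSetFidelity {d : ℕ} {ι : Type*} [Fintype ι] (N G : ι → Superop d) (m : ℕ) : ℝ :=
  𝔼 s : Fin m → ι, avgFidelity (circuit N m s) (circuit G m s)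

/-- The `m`-th order right error `E[(𝒢_{m:1})† 𝒢'_{m:1}]` of a noisy implementation `N` of the
gates `U`. The Hilbert–Schmidt adjoint of the unitary channel of `u` is the channel of `u†`. -/
def rightError {d : ℕ} {ι : Type*} [Fintype ι] (U : ι → unitaryGroup (Fin d) ℂ)
    (N : ι → Superop d) (m : ℕ) : Superop d :=
  𝔼 s : Fin m → ι, unitaryChannel (star (circuit U m s)) * circuit N m s

/-- `W` attains `max_V F(Λ ∘ 𝒱, ℐ)` over all unitary channels `𝒱`. -/
def IsOptimalCorrection {d : ℕ} (Λ : Superop d) (W : unitaryGroup (Fin d) ℂ) : Prop :=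
  ∀ V : unitaryGroup (Fin d) ℂ,
    avgFidelity (Λ * unitaryChannel V) 1 ≤ avgFidelity (Λ * unitaryChannel W) 1

/-- A finite family of unitaries is a unitary 2-design: averaging `(U ⊗ U) A (U ⊗ U)†` over the
family gives, for every `A`, the same as averaging it over the Haar probability measure of the
unitary group. (The Haar probability measure is the unique left invariant Borel probability
measure.) -/
def IsUnitaryTwoDesign {d : ℕ} {ι : Type*} [Fintype ι]
    (U : ι → unitaryGroup (Fin d) ℂ) : Prop :=
  ∃ μ : @Measure (unitaryGroup (Fin d) ℂ) (borel _),
    @IsProbabilityMeasure _ (borel _) μ ∧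
    (∀ g : unitaryGroup (Fin d) ℂ,
      @Measure.map _ _ (borel _) (borel _) (fun v => g * v) μ = μ) ∧
    ∀ (A : Matrix (Fin d × Fin d) (Fin d × Fin d) ℂ) (x y : Fin d × Fin d),
      (𝔼 i, (((U i).1 ⊗ₖ (U i).1) * A * ((U i).1 ⊗ₖ (U i).1)ᴴ) x y) =
        @integral _ _ _ _ (borel _) μ
          (fun v : unitaryGroup (Fin d) ℂ => ((v.1 ⊗ₖ v.1) * A * (v.1 ⊗ₖ v.1)ᴴ) x y)

/-! ### The Liouville representation of a qubit -/

/-- The identity and the Pauli matrices `σ_x, σ_y, σ_z`. -/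
def pauli : Fin 4 → Matrix (Fin 2) (Fin 2) ℂ :=
  ![!![1, 0; 0, 1], !![0, 1; 1, 0], !![0, -Complex.I; Complex.I, 0], !![1, 0; 0, -1]]

/-- The Liouville (process) matrix of a hermiticity preserving qubit map, in the orthonormal basis
`σ_j / √2`. -/
def liouville (Λ : Superop 2) : Matrix (Fin 4) (Fin 4) ℝ :=
  Matrix.of fun j k => ((pauli j * Λ (pauli k)).trace).re / 2

/-- The `3 × 3` block of the Liouville matrix that acts on Bloch vectors. -/
def blochBlock (Λ : Superop 2) : Matrix (Fin 3) (Fin 3) ℝ :=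
  (liouville Λ).submatrix Fin.succ Fin.succ

/-- The projector `ρ ↦ ρ - (tr ρ / d) 1` onto the traceless matrices, for `d = 2`. -/
def tracelessProj : Superop 2 where
  toFun ρ := ρ - (ρ.trace / 2) • (1 : Matrix (Fin 2) (Fin 2) ℂ)
  map_add' x y := by rw [trace_add, add_div, add_smul]; abel
  map_smul' c x := by
    simp only [trace_smul, smul_eq_mul, RingHom.id_apply, smul_sub, smul_smul, mul_div_assoc]

/-- The Hilbert–Schmidt inner product of real matrices. -/
def hsInner {n : Type*} [Fintype n] (A B : Matrix n n ℝ) : ℝ := (Aᵀ * B).trace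

/-- The Frobenius norm of a real matrix. -/
def frobNorm {n : Type*} [Fintype n] (A : Matrix n n ℝ) : ℝ := √(hsInner A A)

/-- The amount by which a map `Λ` fails the equality
`⟨Π, Λ⟩ / ‖Π‖_F² = ‖Λ Π‖_F / ‖Π‖_F`, where `Π` is the projector onto traceless matrices. A channel
is incoherent when this is of the order of the square of its infidelity. -/
def coherenceDefect (Λ : Superop 2) : ℝ :=
  |hsInner (liouville tracelessProj) (liouville Λ) / frobNorm (liouville tracelessProj) ^ 2 -
    frobNorm (liouville Λ * liouville tracelessProj) / frobNorm (liouville tracelessProj)|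

/-- The twirling superchannel `𝒯 = E[𝒢_tr ⊗ 𝒢']` with `𝒢_tr = 𝒢 Π_tr`, where `𝒢` are the ideal
gates and `𝒢'` the noisy ones. -/
def twirl {ι : Type*} [Fintype ι] (U : ι → unitaryGroup (Fin 2) ℂ) (N : ι → Superop 2) :
    Matrix (Fin 4 × Fin 4) (Fin 4 × Fin 4) ℝ :=
  𝔼 i, liouville (unitaryChannel (U i) * tracelessProj) ⊗ₖ liouville (N i)

/-- The real number `p` is the highest eigenvalue of the real matrix `A`: it is an eigenvalue, and
no complex eigenvalue of `A` exceeds it in modulus. -/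
def IsHighestEigenvalue {n : Type*} [Fintype n] [DecidableEq n] (A : Matrix n n ℝ) (p : ℝ) :
    Prop :=
  (p : ℂ) ∈ spectrum ℂ (A.map (fun x : ℝ => (x : ℂ))) ∧
    ∀ μ ∈ spectrum ℂ (A.map (fun x : ℝ => (x : ℂ))), ‖μ‖ ≤ p

end

noncomputable section

/-! ### The Frobenius inner product -/

/-! Everything is read off from one linear map on real `3 × 3` matrices, the noisy twirl `L X = E[Rᵀ
X B]`, where `R` and `B` are the Bloch blocks of the ideal and the noisy gates. Averaging a circuit
one gate at a time gives `L ^ m` (`expect_circuit`), so the Bloch block of the `m`-th order right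
error is `L ^ m 1` and the circuit fidelity is `1/2 + tr (L ^ m 1) / 6`. On the matrix entries that
can carry a nonzero eigenvalue, the twirling superchannel acts as the adjoint of `L`.

Let `κ = E[tr (1 - Rᵀ B)]`, six times the average infidelity of one gate, and `η = √(2κ)`. The
2-design property makes `X ↦ E[Rᵀ X R]` the orthogonal projection onto multiples of `1`, and `L` is
within `η` of it. Hence `L` has right and left eigenvectors `X`, `Y` near `1` with a common
eigenvalue `p` near `1` (`IsNoisyDesign.exists_dominantPair`), and has norm at most `8η` on the
annihilator of `Y`. The expansion `L ^ m 1 = c p ^ m X + L ^ m Z`, with `Z` annihilated by `Y`, then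
gives an exponential decay, but in general with errors too large for a bound of order `κ²`.

The gain comes from separating symmetric and antisymmetric parts. Bloch blocks are contractions, so
`1 - Rᵀ B` has a positive semidefinite symmetric part, whose norm is at most its trace; therefore
the symmetric part of `X - 1` is `O(κ)`. The antisymmetric part is only known to be `O(√κ)`, and it
depends on the gauge. Conjugating the ideal gates by a rotation `O` turns `L` into `X ↦ O L(Oᵀ X)`.
If `L⁴(1) O` is symmetric, the fourth power of the new twirl sends `O` to a symmetric matrix. That
matrix is a multiple of the new `X` plus a remainder of size `(8η)⁴ = O(κ²)`, so the antisymmetric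
part of `X - 1` is `O(κ²)` (`DominantPair.norm_asymPart_right_le`); this is what order four is for.
Then `3(1 - p) = κ + O(κ²)`, `c = 1 + O(κ²)` and `Z = O(κ)`, and `DominantPair.decay` follows.

The rotation is supplied by the optimal unitary. The fidelity of `Λ 𝒱` to the identity is an affine
increasing function of `tr (B(Λ) B(𝒱))`. Comparing a maximizer with rotations about the axes shows
that `B(Λ) B(𝒱)` is symmetric, and closeness to `1` makes it positive definite. Positive
definiteness gives uniqueness and the agreement with every polar decomposition; symmetry and
contractivity give incoherence. Finally, `p` does not depend on the gauge
(`DominantPair.eq_of_conj`). -/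

open scoped MatrixOrder Matrix.Norms.L2Operator in
theorem _root_.Matrix.PosSemidef.exists_eq_transpose_mul {n : Type*} [Fintype n] [DecidableEq n]
    {S : Matrix n n ℝ} (h : S.PosSemidef) : ∃ B : Matrix n n ℝ, S = Bᵀ * B := by
  obtain ⟨B, rfl⟩ := CStarAlgebra.nonneg_iff_eq_star_mul_self.mp h.nonneg
  exact ⟨B, by rw [Matrix.star_eq_conjTranspose, Matrix.conjTranspose_eq_transpose_of_trivial]⟩

attribute [local instance] Matrix.frobeniusNormedAddCommGroup Matrix.frobeniusNormedSpace

/-- Real `3 × 3` matrices. -/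
abbrev Mat3 : Type := Matrix (Fin 3) (Fin 3) ℝ

theorem frobenius_norm_sq (A : Mat3) : ‖A‖ ^ 2 = (Aᵀ * A).trace := by
  rw [frobenius_norm_def, ← Real.sqrt_eq_rpow, Real.sq_sqrt (by positivity)]
  simp only [Matrix.trace, Matrix.diag, Matrix.mul_apply, Matrix.transpose_apply]
  rw [Finset.sum_comm]
  refine Finset.sum_congr rfl fun i _ => Finset.sum_congr rfl fun j _ => ?_
  simp [sq]

/-- The inner product `⟨A, B⟩ = tr (Aᵀ B)`. -/
@[reducible] def frobeniusInner : InnerProductSpace ℝ Mat3 where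
  inner A B := (Aᵀ * B).trace
  norm_sq_eq_re_inner A := by simpa using frobenius_norm_sq A
  conj_inner_symm A B := by
    simp only [conj_trivial]
    rw [← Matrix.trace_transpose, Matrix.transpose_mul, Matrix.transpose_transpose]
  add_left A B C := by simp [Matrix.add_mul]
  smul_left A B r := by simp

attribute [local instance] frobeniusInner

theorem inner_mat_def (A B : Mat3) : inner ℝ A B = (Aᵀ * B).trace := rfl

theorem norm_one_mat : ‖(1 : Mat3)‖ = √3 := by
  rw [← Real.sqrt_sq (norm_nonneg _), frobenius_norm_sq]; simp

theorem norm_transpose_mat (A : Mat3) : ‖Aᵀ‖ = ‖A‖ := frobenius_norm_transpose A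

theorem inner_transpose_transpose (A B : Mat3) : inner ℝ Aᵀ Bᵀ = inner ℝ A B := by
  rw [inner_mat_def, inner_mat_def, ← Matrix.trace_transpose, ← Matrix.transpose_mul,
    Matrix.transpose_transpose, Matrix.trace_mul_comm]

theorem norm_orth_mul {R : Mat3} (h : Rᵀ * R = 1) (X : Mat3) : ‖R * X‖ = ‖X‖ := by
  rw [← Real.sqrt_sq (norm_nonneg _), ← Real.sqrt_sq (norm_nonneg X), frobenius_norm_sq,
    frobenius_norm_sq, Matrix.transpose_mul, Matrix.mul_assoc, ← Matrix.mul_assoc Rᵀ, h,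
    Matrix.one_mul]

/-- For `S = Bᵀ B`, submultiplicativity gives `‖S‖ ≤ ‖B‖²`, which is the trace. This turns
positivity into bounds linear in the defect, where Cauchy–Schwarz would give only its square root.
-/
theorem PosSemidef.norm_le_trace {S : Mat3} (h : S.PosSemidef) : ‖S‖ ≤ S.trace := by
  obtain ⟨B, rfl⟩ := h.exists_eq_transpose_mul
  refine (frobenius_norm_mul _ _).trans ?_
  rw [norm_transpose_mat, ← sq, frobenius_norm_sq]

/-! ### Symmetric and antisymmetric parts -/

/-- The symmetric part. -/
def symPart : Mat3 →ₗ[ℝ] Mat3 where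
  toFun A := (1 / 2 : ℝ) • (A + Aᵀ)
  map_add' A B := by simp only [Matrix.transpose_add]; module
  map_smul' c A := by simp only [Matrix.transpose_smul, RingHom.id_apply]; module

/-- The antisymmetric part. -/
def asymPart : Mat3 →ₗ[ℝ] Mat3 where
  toFun A := (1 / 2 : ℝ) • (A - Aᵀ)
  map_add' A B := by simp only [Matrix.transpose_add]; module
  map_smul' c A := by simp only [Matrix.transpose_smul, RingHom.id_apply]; module

theorem symPart_apply (A : Mat3) : symPart A = (1 / 2 : ℝ) • (A + Aᵀ) := rfl
theorem asymPart_apply (A : Mat3) : asymPart A = (1 / 2 : ℝ) • (A - Aᵀ) := rfl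

theorem symPart_add_asymPart (A : Mat3) : symPart A + asymPart A = A := by
  rw [symPart_apply, asymPart_apply]; module

theorem inner_symPart_asymPart (A B : Mat3) :
    inner ℝ A B = inner ℝ (symPart A) (symPart B) + inner ℝ (asymPart A) (asymPart B) := by
  have h := inner_transpose_transpose A B
  simp only [symPart_apply, asymPart_apply, inner_smul_left, inner_smul_right, inner_add_left,
    inner_add_right, inner_sub_left, inner_sub_right, h, conj_trivial]
  ring

theorem norm_symPart_le (A : Mat3) : ‖symPart A‖ ≤ ‖A‖ := by
  rw [symPart_apply, norm_smul]
  have := norm_add_le A Aᵀ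
  rw [norm_transpose_mat] at this
  norm_num; linarith

theorem norm_asymPart_le (A : Mat3) : ‖asymPart A‖ ≤ ‖A‖ := by
  rw [asymPart_apply, norm_smul]
  have := norm_sub_le A Aᵀ
  rw [norm_transpose_mat] at this
  norm_num; linarith

/-- The two parts are orthogonal, so they can be estimated separately: an antisymmetric part of size
`√κ` on one side is harmless when the one on the other side is `O(κ²)`. -/
theorem abs_inner_le_sym_asym (A B : Mat3) :
    |inner ℝ A B| ≤ ‖symPart A‖ * ‖symPart B‖ + ‖asymPart A‖ * ‖asymPart B‖ := by
  rw [inner_symPart_asymPart]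
  exact (abs_add_le _ _).trans (add_le_add (abs_real_inner_le_norm _ _) (abs_real_inner_le_norm _ _))

/-! ### Perturbation of a rank one projection -/

section perturbation

variable {H : Type*} [NormedAddCommGroup H] [InnerProductSpace ℝ H] [CompleteSpace H]

/-- A linear map that is close to the orthogonal projection onto a unit vector `e` has an
eigenvector close to `e`. -/
theorem exists_eigenvector_near {e : H} (he : ‖e‖ = 1) (L : H →ₗ[ℝ] H) {η : ℝ}
    (hη : η ≤ 1 / 20) (hL : ∀ x, ‖L x - (inner ℝ e x : ℝ) • e‖ ≤ η * ‖x‖) :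
    ∃ (p : ℝ) (x : H), L x = p • x ∧ inner ℝ e x = 1 ∧ |p - 1| ≤ 2 * η ∧ ‖x - e‖ ≤ 6 * η := by
  have hη0 : 0 ≤ η := by
    have := (norm_nonneg _).trans (hL e)
    rwa [he, mul_one] at this
  set E : H → H := fun x => L x - (inner ℝ e x : ℝ) • e with hE
  have hEsub : ∀ x y, E x - E y = E (x - y) := fun x y => by
    simp only [hE, map_sub, inner_sub_right, sub_smul]; abel
  have hin : ∀ z, |(inner ℝ e z : ℝ)| ≤ ‖z‖ := fun z => by
    simpa [he] using abs_real_inner_le_norm e z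
  have hEn : ∀ z, ‖z‖ ≤ 2 → ‖E z‖ ≤ 2 * η := fun z hz => (hL z).trans (by nlinarith)
  -- On the slice `⟨e, x⟩ = 1` one has `L x = e + E x`, so a fixed point of `Ψ` satisfies `L x = (1
  -- + ⟨e, E x⟩) x`. The subtracted term keeps `Ψ` inside the slice, and smallness of `E` makes it a
  -- contraction on the part of norm at most `2`.
  set Ψ : H → H := fun x => e + E x - (inner ℝ e (E x) : ℝ) • x with hΨ
  set s : Set H := {x | inner ℝ e x = 1} ∩ Metric.closedBall 0 2 with hs
  have hsc : IsComplete s := by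
    refine IsClosed.isComplete (IsClosed.inter ?_ Metric.isClosed_closedBall)
    exact isClosed_eq (by fun_prop) continuous_const
  have hee : inner ℝ e e = (1 : ℝ) := by rw [real_inner_self_eq_norm_sq, he]; norm_num
  have hmap : Set.MapsTo Ψ s s := by
    rintro x ⟨hx1, hx2⟩
    simp only [Set.mem_ofPred_eq] at hx1
    rw [mem_closedBall_zero_iff] at hx2
    refine ⟨?_, ?_⟩
    · simp only [Set.mem_ofPred_eq, hΨ, inner_sub_right, inner_add_right, inner_smul_right, hee, hx1]
      ring
    · rw [mem_closedBall_zero_iff]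
      have h1 := hEn x hx2
      have h2 := (hin (E x)).trans h1
      calc ‖Ψ x‖ ≤ ‖e‖ + ‖E x‖ + |(inner ℝ e (E x) : ℝ)| * ‖x‖ := by
            refine (norm_sub_le _ _).trans (add_le_add (norm_add_le _ _) ?_)
            rw [norm_smul, Real.norm_eq_abs]
        _ ≤ 1 + 2 * η + 2 * η * 2 := by
            rw [he]
            gcongr
        _ ≤ 2 := by linarith
  have hlip : ∀ x ∈ s, ∀ y ∈ s, ‖Ψ x - Ψ y‖ ≤ (1 / 2) * ‖x - y‖ := by
    rintro x ⟨-, hx2⟩ y ⟨-, hy2⟩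
    rw [mem_closedBall_zero_iff] at hx2 hy2
    have : Ψ x - Ψ y = E (x - y) - (inner ℝ e (E x) : ℝ) • (x - y)
        - (inner ℝ e (E (x - y)) : ℝ) • y := by
      simp only [hΨ, ← hEsub, inner_sub_right, sub_smul, smul_sub]; abel
    rw [this]
    have h1 := (hin (E x)).trans (hEn x hx2)
    have h2 := (hin (E (x - y))).trans (hL (x - y))
    have h3 := hL (x - y)
    calc _ ≤ ‖E (x - y)‖ + |(inner ℝ e (E x) : ℝ)| * ‖x - y‖
          + |(inner ℝ e (E (x - y)) : ℝ)| * ‖y‖ := by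
          refine (norm_sub_le _ _).trans (add_le_add ((norm_sub_le _ _).trans ?_) ?_)
          · rw [norm_smul, Real.norm_eq_abs]
          · rw [norm_smul, Real.norm_eq_abs]
      _ ≤ η * ‖x - y‖ + 2 * η * ‖x - y‖ + η * ‖x - y‖ * 2 := by
          gcongr
      _ ≤ (1 / 2) * ‖x - y‖ := by nlinarith [norm_nonneg (x - y)]
  have hcon : ContractingWith (1 / 2 : NNReal) (hmap.restrict Ψ s s) := by
    refine ⟨by norm_num [← NNReal.coe_lt_coe], LipschitzWith.of_dist_le_mul ?_⟩
    rintro ⟨x, hx⟩ ⟨y, hy⟩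
    simpa [Subtype.dist_eq, dist_eq_norm] using hlip x hx y hy
  obtain ⟨x, hxs, hfix, -⟩ := ContractingWith.exists_fixedPoint' hsc hmap hcon
    (x := e) ⟨hee, by simp [he]⟩ (edist_ne_top _ _)
  have hx1 : inner ℝ e x = (1 : ℝ) := hxs.1
  have hx2 : ‖x‖ ≤ 2 := by simpa using hxs.2
  have hfx : e + E x - (inner ℝ e (E x) : ℝ) • x = x := hfix
  have h1 := hEn x hx2
  have h2 := (hin (E x)).trans h1
  refine ⟨1 + inner ℝ e (E x), x, ?_, hx1, by simpa using h2, ?_⟩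
  · have : L x = e + E x := by simp [hE, hx1]
    rw [this, add_smul, one_smul]
    nth_rewrite 2 [← hfx]
    abel
  · have : x - e = E x - (inner ℝ e (E x) : ℝ) • x := by
      nth_rewrite 1 [← hfx]; abel
    rw [this]
    refine (norm_sub_le _ _).trans ?_
    rw [norm_smul, Real.norm_eq_abs]
    nlinarith [norm_nonneg x, abs_nonneg (inner ℝ e (E x) : ℝ)]

end perturbation

/-! ### Averages -/

theorem expect_eq_inv_smul_sum {ι M : Type*} [Fintype ι] [AddCommGroup M] [Module ℚ≥0 M]
    [Module ℝ M] (f : ι → M) :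
    𝔼 i, f i = (Fintype.card ι : ℝ)⁻¹ • ∑ i, f i := by
  rw [Finset.expect, Finset.card_univ, ← NNRat.cast_smul_eq_nnqsmul ℝ]
  simp

/-! ### The noisy twirl as a perturbation of the projection onto multiples of the identity -/

section twirl

variable {ι : Type*} [Fintype ι] {R B : ι → Mat3}

/-- The map `X ↦ E[Rᵀ X B]`. -/
def noisyTwirl {ι : Type*} [Fintype ι] (R B : ι → Mat3) : Mat3 →ₗ[ℝ] Mat3 where
  toFun X := 𝔼 i, (R i)ᵀ * X * B i
  map_add' X Y := by simp [Matrix.mul_add, Matrix.add_mul, Finset.expect_add_distrib]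
  map_smul' c X := by simp [Finset.smul_expect]

theorem noisyTwirl_apply (X : Mat3) : noisyTwirl R B X = 𝔼 i, (R i)ᵀ * X * B i := rfl

/-- The average infidelity `E[tr (1 - Rᵀ B)]`. -/
def twirlDefect {ι : Type*} [Fintype ι] (R B : ι → Mat3) : ℝ :=
  𝔼 i, (1 - (R i)ᵀ * B i).trace

/-- `R` is a family of orthogonal matrices whose second moments are those of the Haar measure,
and `B` is a family of contractions. -/
structure IsNoisyDesign {ι : Type*} [Fintype ι] (R B : ι → Mat3) : Prop where
  orth : ∀ i, (R i)ᵀ * R i = 1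
  contract_left : ∀ i X, ‖B i * X‖ ≤ ‖X‖
  contract_right : ∀ i X, ‖X * B i‖ ≤ ‖X‖
  design : ∀ X : Mat3, 𝔼 i, (R i)ᵀ * X * R i = (X.trace / 3) • (1 : Mat3)
  design_transpose : ∀ X : Mat3, 𝔼 i, R i * X * (R i)ᵀ = (X.trace / 3) • (1 : Mat3)

/-- The hypotheses are self-dual, so each fact about right eigenvectors also holds for left ones. -/
theorem IsNoisyDesign.transpose (h : IsNoisyDesign R B) :
    IsNoisyDesign (fun i => (R i)ᵀ) (fun i => (B i)ᵀ) where
  orth i := by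
    rw [Matrix.transpose_transpose]
    exact mul_eq_one_comm.1 (h.orth i)
  contract_left i X := by
    have := h.contract_right i Xᵀ
    rwa [← norm_transpose_mat, Matrix.transpose_mul, Matrix.transpose_transpose,
      norm_transpose_mat] at this
  contract_right i X := by
    have := h.contract_left i Xᵀ
    rwa [← norm_transpose_mat, Matrix.transpose_mul, Matrix.transpose_transpose,
      norm_transpose_mat] at this
  design X := by simpa using h.design_transpose X
  design_transpose X := by simpa using h.design X

theorem twirlDefect_transpose :
    twirlDefect (fun i => (R i)ᵀ) (fun i => (B i)ᵀ) = twirlDefect R B := by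
  unfold twirlDefect
  refine Finset.expect_congr rfl fun i _ => ?_
  rw [Matrix.trace_sub, Matrix.trace_sub, ← Matrix.trace_transpose ((R i)ᵀᵀ * _),
    Matrix.transpose_mul, Matrix.trace_mul_comm]
  simp

theorem map_expect_real {M M' : Type*} [AddCommGroup M] [Module ℚ≥0 M]
    [Module ℝ M] [AddCommGroup M'] [Module ℚ≥0 M'] [Module ℝ M'] (g : M →ₗ[ℝ] M') (f : ι → M) :
    g (𝔼 i, f i) = 𝔼 i, g (f i) := by
  rw [expect_eq_inv_smul_sum, expect_eq_inv_smul_sum, map_smul, map_sum]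

theorem trace_expect (f : ι → Mat3) : (𝔼 i, f i).trace = 𝔼 i, (f i).trace :=
  map_expect_real (Matrix.traceLinearMap (Fin 3) ℝ ℝ) f

theorem trace_noisyTwirl_one [Nonempty ι] : (noisyTwirl R B 1).trace = 3 - twirlDefect R B := by
  rw [noisyTwirl_apply, twirlDefect, trace_expect]
  simp only [Matrix.trace_sub, Finset.expect_sub_distrib, Matrix.mul_one]
  rw [Fintype.expect_const]
  simp

/-- The adjoint of a noisy twirl is the noisy twirl of the transposed families, by cyclicity of the
trace. -/
theorem inner_noisyTwirl (X Y : Mat3) : inner ℝ Y (noisyTwirl R B X) =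
    inner ℝ (noisyTwirl (fun i => (R i)ᵀ) (fun i => (B i)ᵀ) Y) X := by
  rw [real_inner_comm X]
  have h1 := map_expect_real (innerₛₗ ℝ Y) (fun i => (R i)ᵀ * X * B i)
  have h2 := map_expect_real (innerₛₗ ℝ X) (fun i => (R i)ᵀᵀ * Y * (B i)ᵀ)
  rw [innerₛₗ_apply_apply] at h1 h2
  rw [noisyTwirl_apply, noisyTwirl_apply, h1, h2]
  refine Finset.expect_congr rfl fun i _ => ?_
  rw [innerₛₗ_apply_apply, innerₛₗ_apply_apply, inner_mat_def, real_inner_comm, inner_mat_def]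
  rw [Matrix.transpose_mul, Matrix.transpose_mul, Matrix.transpose_transpose,
    Matrix.transpose_transpose, Matrix.mul_assoc (B i), Matrix.trace_mul_comm (B i)]
  simp only [Matrix.mul_assoc]

theorem norm_expect_le_real (f : ι → Mat3) : ‖𝔼 i, f i‖ ≤ 𝔼 i, ‖f i‖ := by
  rw [expect_eq_inv_smul_sum, expect_eq_inv_smul_sum, norm_smul, smul_eq_mul]
  simp only [norm_inv, Real.norm_natCast]
  gcongr
  exact norm_sum_le _ _

theorem norm_mul_orth {Q : Mat3} (h : Qᵀ * Q = 1) (X : Mat3) : ‖X * Q‖ = ‖X‖ := by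
  rw [← norm_transpose_mat, Matrix.transpose_mul, norm_orth_mul, norm_transpose_mat]
  rw [Matrix.transpose_transpose]
  exact mul_eq_one_comm.1 h

/-- Expand the square with `‖R‖² = 3` and, by contractivity, `‖B‖² ≤ 3`. -/
theorem IsNoisyDesign.norm_sub_sq_le (h : IsNoisyDesign R B) (i : ι) :
    ‖B i - R i‖ ^ 2 ≤ 2 * (1 - (R i)ᵀ * B i).trace := by
  rw [@norm_sub_sq_real]
  have h1 : ‖R i‖ = √3 := by
    rw [← norm_one_mat, ← norm_orth_mul (h.orth i) 1, Matrix.mul_one]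
  have h2 : ‖B i‖ ≤ √3 := by
    have := h.contract_left i 1
    rwa [Matrix.mul_one, norm_one_mat] at this
  have h3 : √3 ^ 2 = (3 : ℝ) := Real.sq_sqrt (by norm_num)
  have h4 : ‖B i‖ ^ 2 ≤ 3 := by rw [← h3]; gcongr
  rw [h1, h3, real_inner_comm, inner_mat_def, Matrix.trace_sub, Matrix.trace_one]
  simp only [Fintype.card_fin, Nat.cast_ofNat]
  linarith

theorem IsNoisyDesign.defect_nonneg (h : IsNoisyDesign R B) : 0 ≤ twirlDefect R B := by
  refine Finset.expect_nonneg fun i _ => ?_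
  have := h.norm_sub_sq_le i
  nlinarith [sq_nonneg ‖B i - R i‖]

theorem IsNoisyDesign.expect_norm_sub_le [Nonempty ι] (h : IsNoisyDesign R B) :
    𝔼 i, ‖B i - R i‖ ≤ √(2 * twirlDefect R B) := by
  refine Real.le_sqrt_of_sq_le ?_
  have hc : (0 : ℝ) < Fintype.card ι := by exact_mod_cast Fintype.card_pos
  have h1 : ∑ i, ‖B i - R i‖ ^ 2 ≤ ∑ i, 2 * (1 - (R i)ᵀ * B i).trace :=
    Finset.sum_le_sum fun i _ => h.norm_sub_sq_le i
  have h2 := sq_sum_le_card_mul_sum_sq (s := Finset.univ) (f := fun i => ‖B i - R i‖)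
  rw [Finset.card_univ] at h2
  rw [twirlDefect, expect_eq_inv_smul_sum, expect_eq_inv_smul_sum, smul_eq_mul, smul_eq_mul,
    mul_pow, mul_left_comm, Finset.mul_sum, inv_pow, sq (Fintype.card ι : ℝ), mul_inv, mul_assoc]
  gcongr
  rw [inv_mul_le_iff₀ hc]
  exact h2.trans (by gcongr)

/-- The subtracted term is the noiseless twirl of `X`, so the difference is `E[Rᵀ X (B - R)]`, and
the mean of `‖B - R‖` is controlled by Cauchy–Schwarz. -/
theorem IsNoisyDesign.norm_noisyTwirl_sub_le [Nonempty ι] (h : IsNoisyDesign R B) (X : Mat3) :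
    ‖noisyTwirl R B X - (X.trace / 3) • (1 : Mat3)‖ ≤ √(2 * twirlDefect R B) * ‖X‖ := by
  rw [← h.design X, noisyTwirl_apply, ← Finset.expect_sub_distrib]
  refine (norm_expect_le_real _).trans ?_
  refine le_trans ?_ (mul_le_mul_of_nonneg_right h.expect_norm_sub_le (norm_nonneg _))
  rw [Finset.expect_mul]
  refine Finset.expect_le_expect fun i _ => ?_
  rw [← Matrix.mul_sub, Matrix.mul_assoc, norm_orth_mul (h.transpose.orth i), mul_comm]
  exact frobenius_norm_mul _ _

theorem IsNoisyDesign.norm_noisyTwirl_le [Nonempty ι] (h : IsNoisyDesign R B) (X : Mat3) :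
    ‖noisyTwirl R B X‖ ≤ ‖X‖ := by
  rw [noisyTwirl_apply]
  refine (norm_expect_le_real _).trans (Finset.expect_le Finset.univ_nonempty fun i _ => ?_)
  exact (h.contract_right i _).trans (norm_orth_mul (h.transpose.orth i) X).le

/-- `1 - Q` has positive semidefinite symmetric part when `Q` is a contraction. -/
theorem norm_symPart_one_sub_le {Q : Mat3} (hQ : ∀ X, ‖Q * X‖ ≤ ‖X‖) :
    ‖symPart (1 - Q)‖ ≤ (1 - Q).trace := by
  have hps : (symPart (1 - Q)).PosSemidef := by
    refine Matrix.PosSemidef.of_dotProduct_mulVec_nonneg ?_ fun x => ?_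
    · ext i j
      simp [symPart_apply, Matrix.one_apply, eq_comm]
      ring
    -- The vector is placed in one column so that the contraction hypothesis, which concerns
    -- matrices, applies to it.
    · set X : Mat3 := Matrix.vecMulVec x ![1, 0, 0] with hX
      have hq : x ⬝ᵥ (symPart (1 - Q) *ᵥ x) = inner ℝ X X - inner ℝ X (Q * X) := by
        simp only [inner_mat_def, hX, symPart_apply, Matrix.trace, Matrix.mul_apply,
          Matrix.vecMulVec_apply, dotProduct, Matrix.mulVec, Fin.sum_univ_three, Matrix.one_apply,
          Matrix.smul_apply, Matrix.add_apply, Matrix.sub_apply, Matrix.transpose_apply,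
          Matrix.diag_apply]
        simp
        ring
      have h1 : inner ℝ X (Q * X) ≤ ‖X‖ * ‖X‖ :=
        (real_inner_le_norm _ _).trans (by gcongr; exact hQ X)
      rw [star_trivial, hq, real_inner_self_eq_norm_mul_norm]
      linarith
  refine (PosSemidef.norm_le_trace hps).trans (le_of_eq ?_)
  rw [symPart_apply, Matrix.trace_smul, Matrix.trace_add, Matrix.trace_transpose, smul_eq_mul]
  ring

/-- Each `Rᵀ B` is a contraction, so the bound by the trace can be averaged. It is linear in the
defect; for the full matrix `1 - L 1` only the square root bound is used. -/
theorem IsNoisyDesign.norm_symPart_one_sub_noisyTwirl_one_le [Nonempty ι] (h : IsNoisyDesign R B) :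
    ‖symPart (1 - noisyTwirl R B 1)‖ ≤ twirlDefect R B := by
  have h1 : (1 : Mat3) - noisyTwirl R B 1 = 𝔼 i, (1 - (R i)ᵀ * B i) := by
    rw [Finset.expect_sub_distrib, Fintype.expect_const, noisyTwirl_apply]
    simp
  rw [h1, map_expect_real, twirlDefect]
  refine (norm_expect_le_real _).trans (Finset.expect_le_expect fun i _ => ?_)
  refine norm_symPart_one_sub_le fun X => ?_
  rw [Matrix.mul_assoc, norm_orth_mul (h.transpose.orth i)]
  exact h.contract_left i X

end twirl

/-! ### The dominant eigenvalue and its eigenvectors -/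

section spectral

variable {ι : Type*} [Fintype ι] {R B : ι → Mat3}

theorem inner_one_mat (A : Mat3) : inner ℝ 1 A = A.trace := by
  rw [inner_mat_def, Matrix.transpose_one, Matrix.one_mul]

theorem sqrt_three_bounds : (17 / 10 : ℝ) ≤ √3 ∧ √3 ≤ (9 / 5 : ℝ) :=
  ⟨Real.le_sqrt_of_sq_le (by norm_num), Real.sqrt_le_iff.2 (by norm_num)⟩

theorem abs_trace_le (A : Mat3) : |A.trace| ≤ 9 / 5 * ‖A‖ := by
  rw [← inner_one_mat]
  refine (abs_real_inner_le_norm _ _).trans ?_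
  rw [norm_one_mat]
  exact mul_le_mul_of_nonneg_right sqrt_three_bounds.2 (norm_nonneg _)

/-- A noisy design with small defect `κ` has an eigenvector within `11 √(2κ)` of the identity. -/
theorem IsNoisyDesign.exists_eigenvector [Nonempty ι] (h : IsNoisyDesign R B)
    (hη : √(2 * twirlDefect R B) ≤ 1 / 20) :
    ∃ (p : ℝ) (X : Mat3), noisyTwirl R B X = p • X ∧ X.trace = 3 ∧
      |p - 1| ≤ 2 * √(2 * twirlDefect R B) ∧ ‖X - 1‖ ≤ 11 * √(2 * twirlDefect R B) := by
  obtain ⟨h17, h18⟩ := sqrt_three_bounds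
  have h3 : √3 * √3 = (3 : ℝ) := Real.mul_self_sqrt (by norm_num)
  have hpos : 0 < √(3 : ℝ) := by positivity
  set e : Mat3 := (√3)⁻¹ • 1 with he
  have hn : ‖e‖ = 1 := by
    rw [he, norm_smul, norm_one_mat, norm_inv, Real.norm_of_nonneg hpos.le,
      inv_mul_cancel₀ hpos.ne']
  have hin : ∀ A : Mat3, inner ℝ e A = (√3)⁻¹ * A.trace := fun A => by
    rw [he, inner_smul_left, inner_one_mat]; simp
  obtain ⟨p, x, hx, hx1, hp, hxe⟩ := exists_eigenvector_near hn (noisyTwirl R B) hη fun X => by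
    rw [hin, he, smul_smul]
    convert h.norm_noisyTwirl_sub_le X using 4
    field_simp
    rw [sq, h3, mul_comm]
  refine ⟨p, √3 • x, ?_, ?_, hp, ?_⟩
  · rw [map_smul, hx, smul_comm]
  · rw [hin] at hx1
    rw [Matrix.trace_smul, smul_eq_mul]
    field_simp at hx1
    rw [hx1, h3]
  · have : √3 • x - 1 = √3 • (x - e) := by
      rw [smul_sub, he, smul_smul, mul_inv_cancel₀ hpos.ne', one_smul]
    rw [this, norm_smul, Real.norm_of_nonneg hpos.le]
    nlinarith [norm_nonneg (x - e), Real.sqrt_nonneg (2 * twirlDefect R B)]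

theorem IsNoisyDesign.norm_noisyTwirl_le_of_trace_eq_zero [Nonempty ι]
    (h : IsNoisyDesign R B) {Z : Mat3}
    (hZ : Z.trace = 0) : ‖noisyTwirl R B Z‖ ≤ √(2 * twirlDefect R B) * ‖Z‖ := by
  simpa [hZ] using h.norm_noisyTwirl_sub_le Z

theorem IsNoisyDesign.norm_one_sub_noisyTwirl_one_le [Nonempty ι] (h : IsNoisyDesign R B) :
    ‖1 - noisyTwirl R B 1‖ ≤ 2 * √(2 * twirlDefect R B) := by
  have := h.norm_noisyTwirl_sub_le 1
  have h1 : (1 : Mat3).trace / 3 = 1 := by simp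
  rw [h1, one_smul, norm_one_mat, norm_sub_rev] at this
  refine this.trans ?_
  rw [mul_comm]
  gcongr
  linarith [sqrt_three_bounds.2]

/-- The eigenvalue equation tested against the identity. -/
theorem eigenvalue_eq [Nonempty ι] {p : ℝ} {X : Mat3} (hX : noisyTwirl R B X = p • X)
    (ht : X.trace = 3) :
    3 * (1 - p) = twirlDefect R B +
      inner ℝ (1 - noisyTwirl (fun i => (R i)ᵀ) (fun i => (B i)ᵀ) 1) (X - 1) := by
  have h1 := inner_noisyTwirl (R := R) (B := B) X 1
  rw [hX, inner_smul_right, inner_one_mat, ht] at h1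
  have h2 : (noisyTwirl (fun i => (R i)ᵀ) (fun i => (B i)ᵀ) 1).trace = 3 - twirlDefect R B := by
    rw [trace_noisyTwirl_one, twirlDefect_transpose]
  have h3 : inner ℝ (1 - noisyTwirl (fun i => (R i)ᵀ) (fun i => (B i)ᵀ) 1) (1 : Mat3) =
      twirlDefect R B := by
    rw [real_inner_comm, inner_one_mat, Matrix.trace_sub, h2, Matrix.trace_one]
    simp
  rw [inner_sub_right, h3, inner_sub_left, inner_one_mat, ht, ← h1]
  ring

/-- The eigenvector near the identity is symmetric up to first order in the defect. -/
theorem IsNoisyDesign.eigenvector_bounds [Nonempty ι] (h : IsNoisyDesign R B)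
    (hη : √(2 * twirlDefect R B) ≤ 1 / 20) {p : ℝ} {X : Mat3} (hX : noisyTwirl R B X = p • X)
    (ht : X.trace = 3) (hp : |p - 1| ≤ 2 * √(2 * twirlDefect R B))
    (hX1 : ‖X - 1‖ ≤ 11 * √(2 * twirlDefect R B)) :
    |p - 1| ≤ 15 * twirlDefect R B ∧ ‖symPart (X - 1)‖ ≤ 100 * twirlDefect R B := by
  have hκ := h.defect_nonneg
  set κ := twirlDefect R B with hκdef
  set η := √(2 * κ) with hηdef
  have hηn : 0 ≤ η := Real.sqrt_nonneg _
  have hηsq : η * η = 2 * κ := Real.mul_self_sqrt (by positivity)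
  have htz : (X - 1).trace = 0 := by rw [Matrix.trace_sub, ht]; simp
  -- In the eigenvalue equation the inner product is at most `2η · 11η = 44κ`, whence `3 |1 - p| ≤
  -- 45κ`.
  have h2 : |p - 1| ≤ 15 * κ := by
    have e1 := eigenvalue_eq hX ht
    have e2 := h.transpose.norm_one_sub_noisyTwirl_one_le
    rw [twirlDefect_transpose, ← hκdef, ← hηdef] at e2
    have e3 := abs_real_inner_le_norm
      (1 - noisyTwirl (fun i => (R i)ᵀ) (fun i => (B i)ᵀ) 1) (X - 1)
    have e4 : ‖1 - noisyTwirl (fun i => (R i)ᵀ) (fun i => (B i)ᵀ) 1‖ * ‖X - 1‖ ≤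
        (2 * η) * (11 * η) := by gcongr
    have e5 := abs_le.1 (e3.trans e4)
    rw [← hκdef] at e1
    rw [abs_le]
    constructor <;> nlinarith
  refine ⟨h2, ?_⟩
  -- The first two terms are `O(κ)`. The third is `O(η²)`, since `X - 1` has trace zero and size
  -- `O(η)` and `L` contributes another factor `η` on traceless matrices.
  have e1 : p • symPart (X - 1) =
      (1 - p) • (1 : Mat3) - symPart (1 - noisyTwirl R B 1) + symPart (noisyTwirl R B (X - 1)) := by
    have s1 : symPart (1 : Mat3) = 1 := by
      rw [symPart_apply, Matrix.transpose_one]; module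
    have : p • (X - 1) =
        (1 - p) • (1 : Mat3) - (1 - noisyTwirl R B 1) + noisyTwirl R B (X - 1) := by
      rw [map_sub, hX]; module
    rw [← map_smul, this, map_add, map_sub, map_smul, s1]
  have e2 : ‖p • symPart (X - 1)‖ ≤ 15 * κ * (9 / 5) + κ + η * (11 * η) := by
    rw [e1]
    refine (norm_add_le _ _).trans (add_le_add ((norm_sub_le _ _).trans (add_le_add ?_ ?_)) ?_)
    · rw [norm_smul, norm_one_mat, Real.norm_eq_abs, abs_sub_comm]
      gcongr
      exact sqrt_three_bounds.2
    · exact h.norm_symPart_one_sub_noisyTwirl_one_le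
    · refine (norm_symPart_le _).trans ((h.norm_noisyTwirl_le_of_trace_eq_zero htz).trans ?_)
      gcongr
  rw [norm_smul, Real.norm_eq_abs] at e2
  have e3 : (9 / 10 : ℝ) ≤ |p| := le_trans (by linarith [(abs_le.1 hp).1]) (le_abs_self p)
  nlinarith [norm_nonneg (symPart (X - 1))]

/-- Dominant eigenvalue and left and right eigenvectors of the twirl of a noisy design. -/
structure DominantPair {ι : Type*} [Fintype ι] (R B : ι → Mat3) (p : ℝ) (X Y : Mat3) : Prop where
  right : noisyTwirl R B X = p • X
  left : noisyTwirl (fun i => (R i)ᵀ) (fun i => (B i)ᵀ) Y = p • Y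
  trace_right : X.trace = 3
  trace_left : Y.trace = 3
  eigenvalue : |p - 1| ≤ 15 * twirlDefect R B
  norm_right : ‖X - 1‖ ≤ 11 * √(2 * twirlDefect R B)
  norm_left : ‖Y - 1‖ ≤ 11 * √(2 * twirlDefect R B)
  sym_right : ‖symPart (X - 1)‖ ≤ 100 * twirlDefect R B
  sym_left : ‖symPart (Y - 1)‖ ≤ 100 * twirlDefect R B

theorem inner_eq_three_add {X Y : Mat3} (hX : X.trace = 3) (hY : Y.trace = 3) :
    inner ℝ Y X = 3 + inner ℝ (Y - 1) (X - 1) := by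
  rw [inner_sub_left, inner_sub_right, inner_sub_right, inner_one_mat, inner_one_mat,
    real_inner_comm 1 Y, inner_one_mat, hX, hY, Matrix.trace_one]
  simp

/-- The perturbation argument is applied to the twirl and to its adjoint. The two eigenvalues agree
because `⟨Y, L X⟩` can be evaluated on either side and `⟨Y, X⟩`, close to `3`, is nonzero. -/
theorem IsNoisyDesign.exists_dominantPair [Nonempty ι] (h : IsNoisyDesign R B)
    (hη : √(2 * twirlDefect R B) ≤ 1 / 20) : ∃ p X Y, DominantPair R B p X Y := by
  obtain ⟨p, X, hX, htX, hp, hX1⟩ := h.exists_eigenvector hη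
  obtain ⟨q, Y, hY, htY, hq, hY1⟩ := h.transpose.exists_eigenvector
    (by rwa [twirlDefect_transpose])
  obtain ⟨h1, h2⟩ := h.eigenvector_bounds hη hX htX hp hX1
  obtain ⟨h3, h4⟩ := h.transpose.eigenvector_bounds (by rwa [twirlDefect_transpose]) hY htY hq hY1
  rw [twirlDefect_transpose] at hq hY1 h3 h4
  have hpq : p = q := by
    have e1 := inner_noisyTwirl (R := R) (B := B) X Y
    rw [hX, hY, inner_smul_right, real_inner_smul_left, inner_eq_three_add htX htY] at e1
    have e2 := abs_real_inner_le_norm (Y - 1) (X - 1)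
    have e3 : ‖Y - 1‖ * ‖X - 1‖ ≤ (11 / 20) * (11 / 20) := by gcongr <;> linarith
    have e4 := (abs_le.1 (e2.trans e3)).1
    have : (0 : ℝ) < 3 + inner ℝ (Y - 1) (X - 1) := by linarith
    exact mul_right_cancel₀ this.ne' e1
  subst hpq
  exact ⟨p, X, Y, hX, hY, htX, htY, h1, hX1, hY1, h2, h4⟩

theorem DominantPair.transpose {p : ℝ} {X Y : Mat3} (h : DominantPair R B p X Y) :
    DominantPair (fun i => (R i)ᵀ) (fun i => (B i)ᵀ) p Y X where
  right := h.left
  left := by simpa using h.right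
  trace_right := h.trace_left
  trace_left := h.trace_right
  eigenvalue := by rw [twirlDefect_transpose]; exact h.eigenvalue
  norm_right := by rw [twirlDefect_transpose]; exact h.norm_left
  norm_left := by rw [twirlDefect_transpose]; exact h.norm_right
  sym_right := by rw [twirlDefect_transpose]; exact h.sym_left
  sym_left := by rw [twirlDefect_transpose]; exact h.sym_right

/-- On the annihilator of the left eigenvector the twirl is small. -/
theorem DominantPair.norm_noisyTwirl_le [Nonempty ι] {p : ℝ} {X Y : Mat3}
    (hd : DominantPair R B p X Y)
    (h : IsNoisyDesign R B) {Z : Mat3} (hZ : inner ℝ Y Z = 0) :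
    ‖noisyTwirl R B Z‖ ≤ 8 * √(2 * twirlDefect R B) * ‖Z‖ := by
  have h1 := h.norm_noisyTwirl_sub_le Z
  have h2 : Z.trace = - inner ℝ (Y - 1) Z := by
    rw [inner_sub_left, hZ, inner_one_mat]; ring
  have h3 : |Z.trace| ≤ 11 * √(2 * twirlDefect R B) * ‖Z‖ := by
    rw [h2, abs_neg]
    exact (abs_real_inner_le_norm _ _).trans (by gcongr; exact hd.norm_left)
  have h4 : ‖(Z.trace / 3) • (1 : Mat3)‖ ≤ 7 * √(2 * twirlDefect R B) * ‖Z‖ := by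
    rw [norm_smul, norm_one_mat, Real.norm_eq_abs, abs_div, abs_of_pos (by norm_num : (0:ℝ) < 3)]
    have := mul_le_mul h3 sqrt_three_bounds.2 (Real.sqrt_nonneg _) ((abs_nonneg _).trans h3)
    nlinarith [(abs_nonneg _).trans h3]
  have h5 := norm_add_le (noisyTwirl R B Z - (Z.trace / 3) • (1 : Mat3)) ((Z.trace / 3) • 1)
  rw [sub_add_cancel] at h5
  linarith

theorem DominantPair.norm_noisyTwirl_pow_le [Nonempty ι] {p : ℝ} {X Y : Mat3}
    (hd : DominantPair R B p X Y)
    (h : IsNoisyDesign R B) {Z : Mat3} (hZ : inner ℝ Y Z = 0) (m : ℕ) :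
    inner ℝ Y ((noisyTwirl R B ^ m) Z) = 0 ∧
      ‖(noisyTwirl R B ^ m) Z‖ ≤ (8 * √(2 * twirlDefect R B)) ^ m * ‖Z‖ := by
  induction m with
  | zero => simpa using hZ
  | succ m ih =>
    rw [pow_succ', Module.End.mul_apply]
    refine ⟨?_, ?_⟩
    · rw [inner_noisyTwirl, hd.left, real_inner_smul_left, ih.1, mul_zero]
    · refine (hd.norm_noisyTwirl_le h ih.1).trans ?_
      rw [pow_succ', mul_assoc (8 * √(2 * twirlDefect R B))]
      exact mul_le_mul_of_nonneg_left ih.2 (by positivity)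

theorem pow_apply_eigenvector {p : ℝ} {X : Mat3} {L : Mat3 →ₗ[ℝ] Mat3} (hX : L X = p • X)
    (m : ℕ) : (L ^ m) X = p ^ m • X := by
  induction m with
  | zero => simp
  | succ m ih => rw [pow_succ', Module.End.mul_apply, ih, map_smul, hX, smul_smul, pow_succ]

end spectral

/-! ### Second order decay in the symmetric gauge -/

section decay

variable {ι : Type*} [Fintype ι] [Nonempty ι] {R B : ι → Mat3}

/-- If the fourth iterate of the twirl maps an orthogonal matrix near the identity to a symmetric
matrix, then the dominant eigenvector is symmetric up to second order in the defect. -/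
theorem DominantPair.norm_asymPart_right_le {p : ℝ} {X Y : Mat3} (hd : DominantPair R B p X Y)
    (h : IsNoisyDesign R B) (hκ : twirlDefect R B ≤ 1 / 10 ^ 7) {O : Mat3} (hO : Oᵀ * O = 1)
    (hO1 : ‖O - 1‖ ≤ 1 / 10)
    (hsym : ((noisyTwirl R B ^ 4) O)ᵀ = (noisyTwirl R B ^ 4) O) :
    ‖asymPart (X - 1)‖ ≤ 330000 * twirlDefect R B ^ 2 := by
  have hκ0 := h.defect_nonneg
  have hη : √(2 * twirlDefect R B) ≤ 1 / 2000 :=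
    Real.sqrt_le_iff.2 ⟨by norm_num, by norm_num at hκ ⊢; linarith⟩
  have hηsq : √(2 * twirlDefect R B) ^ 2 = 2 * twirlDefect R B := Real.sq_sqrt (by positivity)
  have hη0 := Real.sqrt_nonneg (2 * twirlDefect R B)
  have hη4 : √(2 * twirlDefect R B) ^ 4 = 4 * twirlDefect R B ^ 2 := by
    rw [show √(2 * twirlDefect R B) ^ 4 = (√(2 * twirlDefect R B) ^ 2) ^ 2 by ring, hηsq]; ring
  set κ := twirlDefect R B
  set η := √(2 * κ)
  have hXn : ‖X - 1‖ ≤ 11 / 2000 := hd.norm_right.trans (by linarith)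
  have hYn : ‖Y - 1‖ ≤ 11 / 2000 := hd.norm_left.trans (by linarith)
  have hOn : ‖O‖ = √3 := by rw [← norm_one_mat, ← norm_orth_mul hO 1, Matrix.mul_one]
  have h18 := sqrt_three_bounds.2
  have hYX : |inner ℝ Y X - 3| ≤ 1 / 10 := by
    rw [inner_eq_three_add hd.trace_right hd.trace_left, add_sub_cancel_left]
    refine (abs_real_inner_le_norm _ _).trans ?_
    nlinarith [norm_nonneg (X - 1), norm_nonneg (Y - 1)]
  have hYO : |inner ℝ Y O - 3| ≤ 1 / 5 := by
    have e : inner ℝ Y O - 3 = inner ℝ (Y - 1) O + (O - 1).trace := by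
      rw [inner_sub_left, inner_one_mat, Matrix.trace_sub, Matrix.trace_one]; simp
    rw [e]
    refine (abs_add_le _ _).trans ?_
    have e1 : |inner ℝ (Y - 1) O| ≤ 11 / 2000 * (9 / 5) := by
      refine (abs_real_inner_le_norm _ _).trans ?_
      rw [hOn]; gcongr
    have e2 := abs_trace_le (O - 1)
    linarith
  obtain ⟨hYX1, hYX2⟩ := abs_le.1 hYX
  obtain ⟨hYO1, hYO2⟩ := abs_le.1 hYO
  have hpos : 0 < inner ℝ Y X := by linarith
  set a := inner ℝ Y O / inner ℝ Y X with ha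
  have haX : a * inner ℝ Y X = inner ℝ Y O := div_mul_cancel₀ _ hpos.ne'
  have ha1 : 4 / 5 ≤ a := by rw [ha, le_div_iff₀ hpos]; linarith
  have ha2 : a ≤ 6 / 5 := by rw [ha, div_le_iff₀ hpos]; linarith
  set Z := O - a • X with hZ
  have hYZ : inner ℝ Y Z = 0 := by rw [hZ, inner_sub_right, inner_smul_right, haX, sub_self]
  have hXn2 : ‖X‖ ≤ 2 := by
    have := norm_add_le (X - 1) 1
    rw [sub_add_cancel, norm_one_mat] at this
    linarith
  have hZn : ‖Z‖ ≤ 5 := by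
    refine (norm_sub_le _ _).trans ?_
    rw [hOn, norm_smul, Real.norm_of_nonneg (by linarith)]
    nlinarith [norm_nonneg X]
  have hL : (noisyTwirl R B ^ 4) O = (a * p ^ 4) • X + (noisyTwirl R B ^ 4) Z := by
    have : O = a • X + Z := by rw [hZ]; abel
    nth_rewrite 1 [this]
    rw [map_add, map_smul, pow_apply_eigenvector hd.right, smul_smul]
  have hLZ := (hd.norm_noisyTwirl_pow_le h hYZ 4).2
  -- Four applications on the annihilator of `Y` gain `(8η)⁴ = 16384 κ²`, and `‖Z‖ ≤ 5`.
  have hLZ2 : ‖(noisyTwirl R B ^ 4) Z‖ ≤ 81920 * κ ^ 2 := by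
    refine hLZ.trans ?_
    have : (8 * η) ^ 4 = 16384 * κ ^ 2 := by rw [mul_pow, hη4]; ring
    change (8 * η) ^ 4 * ‖Z‖ ≤ _
    rw [this]
    nlinarith [sq_nonneg κ]
  have has1 : asymPart (1 : Mat3) = 0 := by rw [asymPart_apply]; simp
  have has : (a * p ^ 4) • asymPart (X - 1) = - asymPart ((noisyTwirl R B ^ 4) Z) := by
    have e1 : asymPart ((noisyTwirl R B ^ 4) O) = 0 := by rw [asymPart_apply, hsym]; simp
    rw [hL, map_add, map_smul] at e1
    rw [map_sub, has1, sub_zero]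
    exact eq_neg_of_add_eq_zero_left e1
  have hn : ‖(a * p ^ 4) • asymPart (X - 1)‖ ≤ 81920 * κ ^ 2 := by
    rw [has, norm_neg]
    exact (norm_asymPart_le _).trans hLZ2
  have hp : 99 / 100 ≤ p := by
    have := (abs_le.1 hd.eigenvalue).1
    norm_num at hκ
    change -(15 * κ) ≤ p - 1 at this
    linarith
  have hp4 : (99 / 100) ^ 4 ≤ p ^ 4 := by gcongr
  have hap : 1 / 4 ≤ a * p ^ 4 := by
    have : (4 / 5 : ℝ) * (99 / 100) ^ 4 ≤ a * p ^ 4 := by gcongr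
    norm_num at this ⊢
    linarith
  rw [norm_smul, Real.norm_of_nonneg (by linarith)] at hn
  nlinarith [norm_nonneg (asymPart (X - 1)), sq_nonneg κ]

set_option maxHeartbeats 1000000 in
/-- Exponential decay of the twirl in the gauge in which its fourth iterate is symmetric. -/
theorem DominantPair.decay {p : ℝ} {X Y : Mat3} (hd : DominantPair R B p X Y)
    (h : IsNoisyDesign R B) (hκ : twirlDefect R B ≤ 1 / 10 ^ 7) {O : Mat3} (hO : Oᵀ * O = 1)
    (hO1 : ‖O - 1‖ ≤ 1 / 10)
    (hsym : ((noisyTwirl R B ^ 4) O)ᵀ = (noisyTwirl R B ^ 4) O) (m : ℕ) :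
    |((noisyTwirl R B ^ m) 1).trace / 3 - p ^ m| ≤ 10 ^ 9 * (1 - p) ^ 2 := by
  have hasX := hd.norm_asymPart_right_le h hκ hO hO1 hsym
  have hκ0 := h.defect_nonneg
  have hη : √(2 * twirlDefect R B) ≤ 1 / 2000 :=
    Real.sqrt_le_iff.2 ⟨by norm_num, by norm_num at hκ ⊢; linarith⟩
  have hηsq : √(2 * twirlDefect R B) ^ 2 = 2 * twirlDefect R B := Real.sq_sqrt (by positivity)
  have hη0 := Real.sqrt_nonneg (2 * twirlDefect R B)
  have hsX := hd.sym_right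
  have hsY := hd.sym_left
  have hnX := hd.norm_right
  have hnY := hd.norm_left
  have hpe := hd.eigenvalue
  have hKn := h.transpose.norm_one_sub_noisyTwirl_one_le
  have hKs := h.transpose.norm_symPart_one_sub_noisyTwirl_one_le
  rw [twirlDefect_transpose] at hKn hKs
  have heq := eigenvalue_eq hd.right hd.trace_right
  have hpow := fun (Z : Mat3) (hZ : inner ℝ Y Z = 0) m => (hd.norm_noisyTwirl_pow_le h hZ m).2
  have htr1 := trace_noisyTwirl_one (R := R) (B := B)
  set κ := twirlDefect R B
  set η := √(2 * κ)
  norm_num at hκ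
  set K := 1 - noisyTwirl (fun i => (R i)ᵀ) (fun i => (B i)ᵀ) 1
  have hasK : ‖asymPart K‖ ≤ 2 * η := (norm_asymPart_le _).trans hKn
  have hasY : ‖asymPart (Y - 1)‖ ≤ 11 * η := (norm_asymPart_le _).trans hnY
  have hκ2 : 0 ≤ κ ^ 2 := sq_nonneg κ
  -- Both symmetric parts are `O(κ)`; in the antisymmetric term the factor `O(κ²)` from the gauge
  -- condition absorbs the factor `O(√κ)` from `K`.
  have hfirst : |3 * (1 - p) - κ| ≤ 10 ^ 6 * κ ^ 2 := by
    rw [heq, add_sub_cancel_left]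
    refine (abs_inner_le_sym_asym _ _).trans ?_
    calc _ ≤ κ * (100 * κ) + 2 * η * (330000 * κ ^ 2) := by gcongr
      _ ≤ _ := by nlinarith
  have hsmall : 10 ^ 6 * κ ^ 2 ≤ κ / 2 := by nlinarith
  have hκp : κ ≤ 6 * (1 - p) := by linarith [(abs_le.1 hfirst).1]
  have hp1 : p ≤ 1 := by linarith
  have hp0 : 0 ≤ p := by linarith [(abs_le.1 hpe).1]
  have hYX : |inner ℝ (Y - 1) (X - 1)| ≤ 10 ^ 5 * κ ^ 2 := by
    refine (abs_inner_le_sym_asym _ _).trans ?_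
    calc _ ≤ (100 * κ) * (100 * κ) + 11 * η * (330000 * κ ^ 2) := by gcongr
      _ ≤ _ := by nlinarith
  have hYXeq := inner_eq_three_add hd.trace_right hd.trace_left
  have hpos : 2 ≤ inner ℝ Y X := by
    rw [hYXeq]; nlinarith [(abs_le.1 hYX).1]
  set c : ℝ := 3 / inner ℝ Y X with hc
  have hcX : c * inner ℝ Y X = 3 := div_mul_cancel₀ _ (by linarith)
  have hc1 : |c - 1| ≤ 10 ^ 5 * κ ^ 2 := by
    have e : c - 1 = - inner ℝ (Y - 1) (X - 1) / inner ℝ Y X := by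
      rw [hc, eq_div_iff (by linarith), sub_mul, div_mul_cancel₀ _ (by linarith), hYXeq]; ring
    rw [e, abs_div, abs_neg, abs_of_pos (a := inner ℝ Y X) (by linarith)]
    exact (div_le_self (abs_nonneg _) (by linarith)).trans hYX
  have hpm : p ^ m ≤ 1 := pow_le_one₀ hp0 hp1
  have hpm0 : 0 ≤ p ^ m := pow_nonneg hp0 m
  have hsuff : |((noisyTwirl R B ^ m) 1).trace / 3 - p ^ m| ≤ 10 ^ 7 * κ ^ 2 := by
    -- For one gate the remainder estimate would give only `η · κ`, of order `κ^(3/2)`, so this case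
    -- uses the exact trace `3 - κ` and `hfirst`. From two gates on, the remainder is `(8η)² ·
    -- O(κ)`.
    match m, hpm, hpm0 with
    | 0, _, _ =>
      have e : (1 : Mat3).trace / 3 - 1 = 0 := by simp
      rw [pow_zero, pow_zero, Module.End.one_apply, e, abs_zero]
      positivity
    | 1, _, _ =>
      rw [pow_one, pow_one, htr1]
      have e : (3 - κ) / 3 - p = (3 * (1 - p) - κ) / 3 := by ring
      rw [e, abs_div, abs_of_pos (by norm_num : (0:ℝ) < 3)]
      linarith
    | m + 2, hpm, hpm0 =>
      set Z := 1 - c • X with hZ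
      have hYZ : inner ℝ Y Z = 0 := by
        rw [hZ, inner_sub_right, inner_smul_right, hcX, real_inner_comm, inner_one_mat,
          hd.trace_left, sub_self]
      have hZn : ‖Z‖ ≤ 300 * κ := by
        have e : Z = (1 - c) • (1 : Mat3) - c • (symPart (X - 1) + asymPart (X - 1)) := by
          rw [symPart_add_asymPart, hZ]; module
        rw [e]
        refine (norm_sub_le _ _).trans ?_
        rw [norm_smul, norm_smul, norm_one_mat, Real.norm_eq_abs, Real.norm_eq_abs, abs_sub_comm]
        have e1 := norm_add_le (symPart (X - 1)) (asymPart (X - 1))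
        have e2 : |c| ≤ 2 := by
          rw [hc, abs_of_nonneg (by positivity), div_le_iff₀ (by linarith)]; linarith
        have h18 := sqrt_three_bounds.2
        calc _ ≤ 10 ^ 5 * κ ^ 2 * (9 / 5) + 2 * (100 * κ + 330000 * κ ^ 2) := by
              gcongr
              exact e1.trans (add_le_add hsX hasX)
          _ ≤ _ := by nlinarith
      have hL : (noisyTwirl R B ^ (m + 2)) 1 =
          (c * p ^ (m + 2)) • X + (noisyTwirl R B ^ (m + 2)) Z := by
        have : (1 : Mat3) = c • X + Z := by rw [hZ]; abel
        nth_rewrite 1 [this]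
        rw [map_add, map_smul, pow_apply_eigenvector hd.right, smul_smul]
      have hLZ : ‖(noisyTwirl R B ^ (m + 2)) Z‖ ≤ 128 * κ * (300 * κ) := by
        refine (hpow Z hYZ (m + 2)).trans ?_
        have e1 : (8 * η) ^ (m + 2) ≤ 128 * κ := by
          have : (8 * η) ^ m ≤ 1 := pow_le_one₀ (by positivity) (by linarith)
          rw [pow_add, mul_pow 8 η 2, hηsq]
          nlinarith
        gcongr
      rw [hL, Matrix.trace_add, Matrix.trace_smul, hd.trace_right, smul_eq_mul]
      have e : (c * p ^ (m + 2) * 3 + ((noisyTwirl R B ^ (m + 2)) Z).trace) / 3 - p ^ (m + 2) =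
          (c - 1) * p ^ (m + 2) + ((noisyTwirl R B ^ (m + 2)) Z).trace / 3 := by ring
      rw [e]
      refine (abs_add_le _ _).trans ?_
      rw [abs_mul, abs_div, abs_of_nonneg hpm0, abs_of_pos (by norm_num : (0:ℝ) < 3)]
      have e1 := abs_trace_le ((noisyTwirl R B ^ (m + 2)) Z)
      have e2 : |c - 1| * p ^ (m + 2) ≤ 10 ^ 5 * κ ^ 2 * 1 := by gcongr
      nlinarith
  refine hsuff.trans ?_
  -- Here `36 · 10⁷` is absorbed into `10⁹`.
  have : κ ^ 2 ≤ (6 * (1 - p)) ^ 2 := by gcongr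
  nlinarith

end decay

end

noncomputable section

/-! ### Pauli expansions -/

/-- The combination of the identity and the Pauli matrices with coefficients `v`. -/
def pauliSum (v : Fin 4 → ℝ) : Matrix (Fin 2) (Fin 2) ℂ := ∑ k, (v k : ℂ) • pauli k

theorem pauliSum_eq (v : Fin 4 → ℝ) : pauliSum v =
    !![(v 0 + v 3 : ℂ), v 1 - v 2 * Complex.I; v 1 + v 2 * Complex.I, v 0 - v 3] := by
  ext i j
  fin_cases i <;> fin_cases j <;>
    simp [pauliSum, pauli, Fin.sum_univ_four, Matrix.smul_of] <;> ring

theorem trace_pauli_mul_pauli (j k : Fin 4) :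
    (pauli j * pauli k).trace = if j = k then 2 else 0 := by
  fin_cases j <;> fin_cases k <;> simp [pauli, Matrix.trace_fin_two] <;> norm_num

theorem trace_pauli_mul_pauliSum (j : Fin 4) (v : Fin 4 → ℝ) :
    (pauli j * pauliSum v).trace = 2 * v j := by
  rw [pauliSum, Matrix.mul_sum, Matrix.trace_sum]
  simp [trace_pauli_mul_pauli, mul_comm]

theorem pauliSum_isHermitian (v : Fin 4 → ℝ) : (pauliSum v).IsHermitian := by
  rw [pauliSum_eq]
  ext i j
  fin_cases i <;> fin_cases j <;> simp [Matrix.conjTranspose_apply]; ring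

theorem isHermitian_eq_pauliSum {A : Matrix (Fin 2) (Fin 2) ℂ} (hA : A.IsHermitian) :
    A = pauliSum fun j => (pauli j * A).trace.re / 2 := by
  have h00 := hA.apply 0 0
  have h11 := hA.apply 1 1
  have h01 := hA.apply 0 1
  rw [pauliSum_eq]
  rw [Complex.ext_iff] at h00 h11 h01
  simp at h00 h11 h01
  ext i j
  fin_cases i <;> fin_cases j <;>
    simp [pauli, Matrix.trace_fin_two, Complex.ext_iff, Matrix.vecMul, dotProduct,
      Fin.sum_univ_two] <;>
    constructor <;> linarith

theorem pauliSum_add (v w : Fin 4 → ℝ) : pauliSum (v + w) = pauliSum v + pauliSum w := by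
  simp [pauliSum, add_smul, Finset.sum_add_distrib]

theorem pauliSum_smul (c : ℝ) (v : Fin 4 → ℝ) : pauliSum (c • v) = (c : ℂ) • pauliSum v := by
  simp only [pauliSum, Pi.smul_apply, smul_eq_mul, Complex.ofReal_mul, Finset.smul_sum, smul_smul]

theorem pauliSum_single (k : Fin 4) : pauliSum (Pi.single k 1) = pauli k := by
  simp [pauliSum, Pi.single_apply]

/-- The Pauli matrices span. -/
theorem superop_ext {Λ Γ : Superop 2} (h : ∀ k, Λ (pauli k) = Γ (pauli k)) : Λ = Γ := by
  have key : ∀ A : Matrix (Fin 2) (Fin 2) ℂ,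
      A = ∑ k, ((pauli k * A).trace / 2) • pauli k := by
    intro A
    ext i j
    fin_cases i <;> fin_cases j <;>
      simp [pauli, Matrix.trace_fin_two, Matrix.mul_apply, Fin.sum_univ_two, Fin.sum_univ_four,
        Matrix.smul_of] <;> ring_nf <;> simp <;> ring
  refine LinearMap.ext fun A => ?_
  rw [key A]
  simp [h]

/-- The combination of the Pauli matrices with a unit Bloch vector is twice a projector. -/
theorem pauliSum_posSemidef {v : Fin 4 → ℝ} (h0 : v 0 = 1)
    (hv : v 1 ^ 2 + v 2 ^ 2 + v 3 ^ 2 = 1) : (pauliSum v).PosSemidef := by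
  have hsq : pauliSum v = (1 / 2 : ℂ) • ((pauliSum v)ᴴ * pauliSum v) := by
    rw [(pauliSum_isHermitian v).eq, pauliSum_eq, h0]
    have hv' : (v 1 : ℂ) ^ 2 + (v 2 : ℂ) ^ 2 + (v 3 : ℂ) ^ 2 = 1 := by exact_mod_cast hv
    have hI := Complex.I_sq
    ext i j
    fin_cases i <;> fin_cases j <;> simp
    · linear_combination (-1 / 2 : ℂ) * hv' + (v 2 : ℂ) ^ 2 / 2 * hI
    · ring
    · ring
    · linear_combination (-1 / 2 : ℂ) * hv' + (v 2 : ℂ) ^ 2 / 2 * hI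
  rw [hsq]
  exact (Matrix.posSemidef_conjTranspose_mul_self _).smul (by norm_num [Complex.le_def])

theorem sq_le_of_pauliSum_posSemidef {v : Fin 4 → ℝ} (h : (pauliSum v).PosSemidef) :
    v 1 ^ 2 + v 2 ^ 2 + v 3 ^ 2 ≤ v 0 ^ 2 := by
  have := h.det_nonneg
  rw [pauliSum_eq, Matrix.det_fin_two] at this
  simp [Complex.le_def] at this
  nlinarith

/-! ### Positive trace preserving maps -/

/-- Positive and trace preserving maps of a qubit. -/
structure IsPosTP (Λ : Superop 2) : Prop where
  pos : ∀ ρ : Matrix (Fin 2) (Fin 2) ℂ, ρ.PosSemidef → (Λ ρ).PosSemidef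
  tp : ∀ ρ : Matrix (Fin 2) (Fin 2) ℂ, (Λ ρ).trace = ρ.trace

/-- Positivity is the case `k = 1` of complete positivity, with `Fin 1 × Fin 2` identified with `Fin
2`. -/
theorem IsChannel.isPosTP {Λ : Superop 2} (h : IsChannel Λ) : IsPosTP Λ where
  pos ρ hρ := by
    have h1 := h.completelyPositive 1 (ρ.submatrix Prod.snd Prod.snd) (hρ.submatrix _)
    exact h1.submatrix fun a : Fin 2 => ((0 : Fin 1), a)
  tp := h.tracePreserving

theorem IsPosTP.one : IsPosTP 1 := ⟨fun _ h => h, fun _ => rfl⟩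

theorem IsPosTP.mul {Λ Γ : Superop 2} (h : IsPosTP Λ) (h' : IsPosTP Γ) : IsPosTP (Λ * Γ) :=
  ⟨fun ρ hρ => h.pos _ (h'.pos ρ hρ), fun ρ => (h.tp _).trans (h'.tp ρ)⟩

theorem unitaryChannel_apply {d : ℕ} (u : unitaryGroup (Fin d) ℂ)
    (ρ : Matrix (Fin d) (Fin d) ℂ) : unitaryChannel u ρ = u.1 * ρ * u.1ᴴ := rfl

theorem unitary_conjTranspose_mul {d : ℕ} (u : unitaryGroup (Fin d) ℂ) : u.1ᴴ * u.1 = 1 :=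
  Unitary.coe_star_mul_self u

theorem isPosTP_unitaryChannel (u : unitaryGroup (Fin 2) ℂ) : IsPosTP (unitaryChannel u) where
  pos ρ hρ := hρ.mul_mul_conjTranspose_same _
  tp ρ := by
    rw [unitaryChannel_apply, Matrix.trace_mul_comm, ← Matrix.mul_assoc,
      unitary_conjTranspose_mul, Matrix.one_mul]

theorem IsPosTP.expect {κ : Type*} [Fintype κ] [Nonempty κ] {f : κ → Superop 2}
    (h : ∀ i, IsPosTP (f i)) : IsPosTP (𝔼 i, f i) := by
  have happ : ∀ ρ, (𝔼 i, f i) ρ = (Fintype.card κ : ℝ)⁻¹ • ∑ i, f i ρ := fun ρ => by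
    rw [expect_eq_inv_smul_sum, LinearMap.smul_apply, LinearMap.sum_apply]
  refine ⟨fun ρ hρ => ?_, fun ρ => ?_⟩
  · rw [happ]
    exact (Matrix.posSemidef_sum _ fun i _ => (h i).pos ρ hρ).smul (by positivity)
  · rw [happ, Matrix.trace_smul, Matrix.trace_sum]
    simp [(h _).tp]

theorem pauli_zero : pauli 0 = 1 := by
  ext i j; fin_cases i <;> fin_cases j <;> simp [pauli]

theorem IsPosTP.isHermitian_pauli {Λ : Superop 2} (h : IsPosTP Λ) (k : Fin 4) :
    (Λ (pauli k)).IsHermitian := by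
  have h0 : (Λ (pauli 0)).IsHermitian := by
    rw [pauli_zero]; exact (h.pos _ Matrix.PosSemidef.one).isHermitian
  by_cases hk : k = 0
  · rw [hk]; exact h0
  -- `1 + σ_k` is positive, so positivity of `Λ` makes the images of `1 + σ_k` and of `1` hermitian,
  -- and hence their difference.
  · have h1 : (pauliSum (Pi.single 0 1 + Pi.single k 1)).PosSemidef := by
      refine pauliSum_posSemidef ?_ ?_ <;> fin_cases k <;> simp at hk ⊢
    rw [pauliSum_add, pauliSum_single, pauliSum_single] at h1
    have h2 := (h.pos _ h1).isHermitian.sub h0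
    rwa [map_add, add_sub_cancel_left] at h2

theorem IsPosTP.apply_pauli {Λ : Superop 2} (h : IsPosTP Λ) (k : Fin 4) :
    Λ (pauli k) = pauliSum fun j => liouville Λ j k :=
  isHermitian_eq_pauliSum (h.isHermitian_pauli k)

theorem IsPosTP.apply_pauliSum {Λ : Superop 2} (h : IsPosTP Λ) (v : Fin 4 → ℝ) :
    Λ (pauliSum v) = pauliSum (liouville Λ *ᵥ v) := by
  rw [pauliSum, map_sum]
  simp only [map_smul, h.apply_pauli]
  simp only [pauliSum, Finset.smul_sum, smul_smul]
  rw [Finset.sum_comm]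
  refine Finset.sum_congr rfl fun j _ => ?_
  rw [← Finset.sum_smul]
  simp [Matrix.mulVec, dotProduct, mul_comm]

theorem liouville_mul {Λ Γ : Superop 2} (h' : IsPosTP Γ) :
    liouville (Λ * Γ) = liouville Λ * liouville Γ := by
  ext i k
  rw [liouville, Matrix.of_apply, Module.End.mul_apply, h'.apply_pauli, pauliSum, map_sum,
    Matrix.mul_sum, Matrix.trace_sum, Complex.re_sum, Finset.sum_div, Matrix.mul_apply]
  refine Finset.sum_congr rfl fun j _ => ?_
  rw [map_smul, Matrix.mul_smul, Matrix.trace_smul, smul_eq_mul, Complex.re_ofReal_mul]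
  simp only [liouville, Matrix.of_apply]
  ring

theorem trace_pauli (k : Fin 4) : (pauli k).trace = if k = 0 then 2 else 0 := by
  have := trace_pauli_mul_pauli k 0
  rwa [pauli_zero, Matrix.mul_one] at this

theorem IsPosTP.liouville_zero {Λ : Superop 2} (h : IsPosTP Λ) (k : Fin 4) :
    liouville Λ 0 k = if k = 0 then 1 else 0 := by
  rw [liouville, Matrix.of_apply, pauli_zero, Matrix.one_mul, h.tp, trace_pauli]
  split_ifs <;> simp

/-- Trace preservation makes the top row of the Liouville matrix of `Γ` equal to `(1, 0, 0, 0)`, so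
the translation part of `Λ` does not enter the Bloch block of the product. -/
theorem IsPosTP.blochBlock_mul {Λ Γ : Superop 2} (h' : IsPosTP Γ) :
    blochBlock (Λ * Γ) = blochBlock Λ * blochBlock Γ := by
  ext i k
  rw [blochBlock, liouville_mul h', Matrix.submatrix_apply, Matrix.mul_apply, Fin.sum_univ_succ,
    h'.liouville_zero, if_neg (Fin.succ_ne_zero k), mul_zero, zero_add, Matrix.mul_apply]
  rfl

theorem liouville_expect {κ : Type*} [Fintype κ] (f : κ → Superop 2) :
    liouville (𝔼 i, f i) = 𝔼 i, liouville (f i) := by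
  have : ∀ j k, liouville (𝔼 i, f i) j k = (Fintype.card κ : ℝ)⁻¹ * ∑ i, liouville (f i) j k := by
    intro j k
    simp only [liouville, Matrix.of_apply]
    rw [expect_eq_inv_smul_sum, LinearMap.smul_apply, LinearMap.sum_apply, Matrix.mul_smul,
      Matrix.trace_smul, Matrix.mul_sum, Matrix.trace_sum, Complex.smul_re, Complex.re_sum,
      smul_eq_mul, mul_div_assoc, Finset.sum_div]
  ext j k
  rw [this, expect_eq_inv_smul_sum, Matrix.smul_apply, Matrix.sum_apply, smul_eq_mul]

theorem blochBlock_expect {κ : Type*} [Fintype κ] (f : κ → Superop 2) :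
    blochBlock (𝔼 i, f i) = 𝔼 i, blochBlock (f i) := by
  unfold blochBlock
  rw [liouville_expect, expect_eq_inv_smul_sum, expect_eq_inv_smul_sum]
  ext i j
  simp [Matrix.sum_apply]

/-! ### Unitary channels -/

theorem unitaryChannel_mul {d : ℕ} (u v : unitaryGroup (Fin d) ℂ) :
    unitaryChannel (u * v) = unitaryChannel u * unitaryChannel v := by
  refine LinearMap.ext fun ρ => ?_
  rw [Module.End.mul_apply]
  simp only [unitaryChannel_apply]
  simp [Matrix.conjTranspose_mul, Matrix.mul_assoc]

theorem unitaryChannel_one {d : ℕ} :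
    unitaryChannel (1 : unitaryGroup (Fin d) ℂ) = 1 := by
  refine LinearMap.ext fun ρ => ?_
  simp [unitaryChannel_apply]

theorem liouville_unitaryChannel_star (u : unitaryGroup (Fin 2) ℂ) :
    liouville (unitaryChannel (star u)) = (liouville (unitaryChannel u))ᵀ := by
  ext j k
  simp only [liouville, Matrix.of_apply, Matrix.transpose_apply, unitaryChannel_apply]
  have : ((star u : unitaryGroup (Fin 2) ℂ)).1 = u.1ᴴ := rfl
  rw [this, Matrix.conjTranspose_conjTranspose, Matrix.trace_mul_comm]
  congr 2
  rw [Matrix.mul_assoc, Matrix.mul_assoc, Matrix.trace_mul_comm]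
  simp only [Matrix.mul_assoc]

theorem blochBlock_unitaryChannel_star (u : unitaryGroup (Fin 2) ℂ) :
    blochBlock (unitaryChannel (star u)) = (blochBlock (unitaryChannel u))ᵀ := by
  rw [blochBlock, liouville_unitaryChannel_star]; rfl

theorem liouville_one : liouville 1 = 1 := by
  ext j k
  rw [liouville, Matrix.of_apply, Module.End.one_apply, trace_pauli_mul_pauli, Matrix.one_apply]
  split_ifs <;> simp

theorem blochBlock_one : blochBlock 1 = 1 := by
  rw [blochBlock, liouville_one, Matrix.submatrix_one _ (Fin.succ_injective _)]

theorem blochBlock_unitaryChannel_mul (u v : unitaryGroup (Fin 2) ℂ) :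
    blochBlock (unitaryChannel (u * v)) =
      blochBlock (unitaryChannel u) * blochBlock (unitaryChannel v) := by
  rw [unitaryChannel_mul, (isPosTP_unitaryChannel v).blochBlock_mul]

theorem blochBlock_unitaryChannel_orth (u : unitaryGroup (Fin 2) ℂ) :
    (blochBlock (unitaryChannel u))ᵀ * blochBlock (unitaryChannel u) = 1 := by
  rw [← blochBlock_unitaryChannel_star, ← blochBlock_unitaryChannel_mul, Unitary.star_mul_self,
    unitaryChannel_one, blochBlock_one]

theorem liouville_unitaryChannel_col_zero (u : unitaryGroup (Fin 2) ℂ) (j : Fin 4) :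
    liouville (unitaryChannel u) j 0 = if j = 0 then 1 else 0 := by
  have h := (isPosTP_unitaryChannel (star u)).liouville_zero j
  rwa [liouville_unitaryChannel_star, Matrix.transpose_apply] at h

/-- A unitary channel is determined by its action on Bloch vectors. -/
theorem unitaryChannel_eq_of_blochBlock_eq {u v : unitaryGroup (Fin 2) ℂ}
    (h : blochBlock (unitaryChannel u) = blochBlock (unitaryChannel v)) :
    unitaryChannel u = unitaryChannel v := by
  have hL : liouville (unitaryChannel u) = liouville (unitaryChannel v) := by
    ext j k
    refine Fin.cases ?_ (fun j => ?_) j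
    · rw [(isPosTP_unitaryChannel u).liouville_zero, (isPosTP_unitaryChannel v).liouville_zero]
    · refine Fin.cases ?_ (fun k => ?_) k
      · rw [liouville_unitaryChannel_col_zero, liouville_unitaryChannel_col_zero]
      · exact congrFun (congrFun h j) k
  refine superop_ext fun k => ?_
  rw [(isPosTP_unitaryChannel u).apply_pauli, (isPosTP_unitaryChannel v).apply_pauli, hL]

/-! ### The Bloch block is a contraction -/

attribute [local instance] Matrix.frobeniusNormedAddCommGroup Matrix.frobeniusNormedSpace
attribute [local instance] frobeniusInner

/-- A unit Bloch vector gives a positive matrix, and nonnegativity of the determinant of its image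
says that the image vector lies in the unit ball. -/
theorem IsPosTP.norm_affine_le {Λ : Superop 2} (h : IsPosTP Λ) {n : Fin 3 → ℝ} (hn : n ⬝ᵥ n = 1) :
    ((fun j => liouville Λ (Fin.succ j) 0) + blochBlock Λ *ᵥ n) ⬝ᵥ
      ((fun j => liouville Λ (Fin.succ j) 0) + blochBlock Λ *ᵥ n) ≤ 1 := by
  have h1 : (pauliSum (Fin.cons 1 n)).PosSemidef := by
    refine pauliSum_posSemidef (by simp) ?_
    rw [← hn]
    simp only [dotProduct, Fin.sum_univ_three]
    change n 0 ^ 2 + n 1 ^ 2 + n 2 ^ 2 = _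
    ring
  have h2 := h.pos _ h1
  rw [h.apply_pauliSum] at h2
  have h3 := sq_le_of_pauliSum_posSemidef h2
  have h0 : (liouville Λ *ᵥ (Fin.cons 1 n : Fin 4 → ℝ)) 0 = 1 := by
    simp [Matrix.mulVec, dotProduct, h.liouville_zero]
  have hj : ∀ j : Fin 3, (liouville Λ *ᵥ (Fin.cons 1 n : Fin 4 → ℝ)) j.succ =
      ((fun j => liouville Λ (Fin.succ j) 0) + blochBlock Λ *ᵥ n) j := fun j => by
    simp only [Matrix.mulVec, dotProduct, Pi.add_apply]
    rw [Fin.sum_univ_succ]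
    simp [blochBlock]
  have e1 := hj 0
  have e2 := hj 1
  have e3 := hj 2
  simp only [dotProduct, Fin.sum_univ_three, ← e1, ← e2, ← e3]
  rw [h0] at h3
  change (liouville Λ *ᵥ (Fin.cons 1 n : Fin 4 → ℝ)) 1 * (liouville Λ *ᵥ (Fin.cons 1 n : Fin 4 → ℝ)) 1
    + (liouville Λ *ᵥ (Fin.cons 1 n : Fin 4 → ℝ)) 2 * (liouville Λ *ᵥ (Fin.cons 1 n : Fin 4 → ℝ)) 2
    + (liouville Λ *ᵥ (Fin.cons 1 n : Fin 4 → ℝ)) 3 * (liouville Λ *ᵥ (Fin.cons 1 n : Fin 4 → ℝ)) 3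
    ≤ 1
  linarith

/-- With `t` the translation part, both `t + B n` and `t - B n` lie in the unit ball; the
parallelogram identity removes `t`, and scaling covers all vectors. -/
theorem IsPosTP.mulVec_dotProduct_le {Λ : Superop 2} (h : IsPosTP Λ) (x : Fin 3 → ℝ) :
    (blochBlock Λ *ᵥ x) ⬝ᵥ (blochBlock Λ *ᵥ x) ≤ x ⬝ᵥ x := by
  have unit : ∀ n : Fin 3 → ℝ, n ⬝ᵥ n = 1 →
      (blochBlock Λ *ᵥ n) ⬝ᵥ (blochBlock Λ *ᵥ n) ≤ 1 := by
    intro n hn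
    have h1 := h.norm_affine_le hn
    have h2 := h.norm_affine_le (n := -n) (by simpa using hn)
    rw [Matrix.mulVec_neg] at h2
    have h3 := dotProduct_self_star_nonneg (fun j => liouville Λ (Fin.succ j) 0)
    simp only [dotProduct_add, add_dotProduct, dotProduct_neg, neg_dotProduct, star_trivial,
      dotProduct_comm (blochBlock Λ *ᵥ n) (fun j => liouville Λ (Fin.succ j) 0)] at h1 h2 h3
    linarith
  by_cases hx : x = 0
  · simp [hx]
  · have hpos : 0 < x ⬝ᵥ x := by
      have h1 := dotProduct_self_star_nonneg x
      rw [star_trivial] at h1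
      exact lt_of_le_of_ne h1 fun h2 => hx (dotProduct_self_eq_zero.1 h2.symm)
    have hs := Real.mul_self_sqrt hpos.le
    have hs0 := Real.sqrt_pos.2 hpos
    have := unit ((√(x ⬝ᵥ x))⁻¹ • x) (by
      rw [smul_dotProduct, dotProduct_smul, smul_eq_mul, smul_eq_mul]
      field_simp
      rw [sq, hs])
    rw [Matrix.mulVec_smul, smul_dotProduct, dotProduct_smul, smul_eq_mul, smul_eq_mul,
      ← mul_assoc, ← mul_inv, hs, inv_mul_le_iff₀ hpos, mul_one] at this
    exact this

theorem frobenius_norm_sq_eq_sum_col (A : Mat3) : ‖A‖ ^ 2 = ∑ j, (A.col j) ⬝ᵥ (A.col j) := by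
  rw [frobenius_norm_sq]
  simp [Matrix.trace, Matrix.mul_apply, dotProduct]

theorem IsPosTP.norm_blochBlock_mul_le {Λ : Superop 2} (h : IsPosTP Λ) (X : Mat3) :
    ‖blochBlock Λ * X‖ ≤ ‖X‖ := by
  refine le_of_sq_le_sq ?_ (norm_nonneg _)
  rw [frobenius_norm_sq_eq_sum_col, frobenius_norm_sq_eq_sum_col]
  exact Finset.sum_le_sum fun j _ => h.mulVec_dotProduct_le (X.col j)

/-- By duality: `‖X Q‖²` is the pairing of `Xᵀ` with `Q (X Q)ᵀ`, hence at most `‖X‖ ‖X Q‖`. -/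
theorem norm_mul_le_of_norm_mul_le {Q : Mat3} (hQ : ∀ X, ‖Q * X‖ ≤ ‖X‖) (X : Mat3) :
    ‖X * Q‖ ≤ ‖X‖ := by
  have h1 : ‖X * Q‖ * ‖X * Q‖ ≤ ‖X‖ * ‖X * Q‖ := by
    have e : inner ℝ (X * Q) (X * Q) = inner ℝ Xᵀ (Q * (X * Q)ᵀ) := by
      rw [inner_mat_def, inner_mat_def, Matrix.transpose_transpose,
        ← Matrix.mul_assoc X, Matrix.trace_mul_comm (X * Q)]
    rw [← real_inner_self_eq_norm_mul_norm, e]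
    refine (real_inner_le_norm _ _).trans ?_
    rw [norm_transpose_mat]
    gcongr
    exact (hQ _).trans (norm_transpose_mat _).le
  by_cases h0 : ‖X * Q‖ = 0
  · rw [h0]; exact norm_nonneg _
  · exact le_of_mul_le_mul_right h1 (lt_of_le_of_ne (norm_nonneg _) (Ne.symm h0))

end

noncomputable section

/-! ### Rotations about the coordinate axes -/

/-- The unitary `x + i y σ_x`. -/
def unitaryX (x y : ℝ) (h : x ^ 2 + y ^ 2 = 1) : unitaryGroup (Fin 2) ℂ :=
  ⟨!![(x : ℂ), y * Complex.I; y * Complex.I, x], by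
    have h' : (x : ℂ) ^ 2 + (y : ℂ) ^ 2 = 1 := by exact_mod_cast h
    have hI := Complex.I_sq
    rw [Matrix.mem_unitaryGroup_iff, Matrix.star_eq_conjTranspose]
    ext i j
    fin_cases i <;> fin_cases j <;> simp [Matrix.vecMul, dotProduct, Fin.sum_univ_two]
    · linear_combination h' - (y : ℂ) ^ 2 * hI
    · ring
    · ring
    · linear_combination h' - (y : ℂ) ^ 2 * hI⟩

/-- The unitary `x + i y σ_y`. -/
def unitaryY (x y : ℝ) (h : x ^ 2 + y ^ 2 = 1) : unitaryGroup (Fin 2) ℂ :=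
  ⟨!![(x : ℂ), y; -y, x], by
    have h' : (x : ℂ) ^ 2 + (y : ℂ) ^ 2 = 1 := by exact_mod_cast h
    rw [Matrix.mem_unitaryGroup_iff, Matrix.star_eq_conjTranspose]
    ext i j
    fin_cases i <;> fin_cases j <;> simp [Matrix.vecMul, dotProduct, Fin.sum_univ_two]
    · linear_combination h'
    · ring
    · ring
    · linear_combination h'⟩

/-- The unitary `x + i y σ_z`. -/
def unitaryZ (x y : ℝ) (h : x ^ 2 + y ^ 2 = 1) : unitaryGroup (Fin 2) ℂ :=
  ⟨!![x + y * Complex.I, 0; 0, x - y * Complex.I], by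
    have h' : (x : ℂ) ^ 2 + (y : ℂ) ^ 2 = 1 := by exact_mod_cast h
    have hI := Complex.I_sq
    rw [Matrix.mem_unitaryGroup_iff, Matrix.star_eq_conjTranspose]
    ext i j
    fin_cases i <;> fin_cases j <;> simp [Matrix.vecMul, dotProduct, Fin.sum_univ_two]
    · linear_combination h' - (y : ℂ) ^ 2 * hI
    · linear_combination h' - (y : ℂ) ^ 2 * hI⟩

theorem blochBlock_unitaryX (x y : ℝ) (h : x ^ 2 + y ^ 2 = 1) :
    blochBlock (unitaryChannel (unitaryX x y h)) =
      !![1, 0, 0; 0, x ^ 2 - y ^ 2, 2 * x * y; 0, -(2 * x * y), x ^ 2 - y ^ 2] := by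
  ext i j
  fin_cases i <;> fin_cases j <;>
    simp [blochBlock, liouville, unitaryChannel_apply, unitaryX, pauli, Matrix.trace_fin_two,
      Matrix.vecMul, dotProduct, Fin.sum_univ_two] <;>
    first | linear_combination h | ring

theorem blochBlock_unitaryY (x y : ℝ) (h : x ^ 2 + y ^ 2 = 1) :
    blochBlock (unitaryChannel (unitaryY x y h)) =
      !![x ^ 2 - y ^ 2, 0, -(2 * x * y); 0, 1, 0; 2 * x * y, 0, x ^ 2 - y ^ 2] := by
  ext i j
  fin_cases i <;> fin_cases j <;>
    simp [blochBlock, liouville, unitaryChannel_apply, unitaryY, pauli, Matrix.trace_fin_two,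
      Matrix.vecMul, dotProduct, Fin.sum_univ_two] <;>
    first | linear_combination h | ring

theorem blochBlock_unitaryZ (x y : ℝ) (h : x ^ 2 + y ^ 2 = 1) :
    blochBlock (unitaryChannel (unitaryZ x y h)) =
      !![x ^ 2 - y ^ 2, 2 * x * y, 0; -(2 * x * y), x ^ 2 - y ^ 2, 0; 0, 0, 1] := by
  ext i j
  fin_cases i <;> fin_cases j <;>
    simp [blochBlock, liouville, unitaryChannel_apply, unitaryZ, pauli, Matrix.trace_fin_two,
      Matrix.vecMul, dotProduct, Fin.sum_univ_two] <;>
    first | linear_combination h | ring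

/-- The rotations have no nonzero invariant vector. -/
theorem eq_zero_of_rotation_invariant {v : Fin 3 → ℝ}
    (h : ∀ u, blochBlock (unitaryChannel u) *ᵥ v = v) : v = 0 := by
  have hx := h (unitaryX 0 1 (by norm_num))
  have hz := h (unitaryZ 0 1 (by norm_num))
  rw [blochBlock_unitaryX] at hx
  rw [blochBlock_unitaryZ] at hz
  have h0 := congrFun hz 0
  have h1 := congrFun hz 1
  have h2 := congrFun hx 2
  simp [Matrix.mulVec, dotProduct, Fin.sum_univ_three] at h0 h1 h2
  ext i
  fin_cases i <;> simp <;> linarith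

/-- The only matrices that commute with all rotations are the multiples of the identity. -/
theorem eq_smul_one_of_rotation_invariant {M : Mat3}
    (h : ∀ u, blochBlock (unitaryChannel u) * M * (blochBlock (unitaryChannel u))ᵀ = M) :
    M = (M.trace / 3) • (1 : Mat3) := by
  have hs : (√2 / 2) ^ 2 + (√2 / 2) ^ 2 = (1 : ℝ) := by
    rw [div_pow, Real.sq_sqrt (by norm_num)]; norm_num
  have hs2 : 2 * (√2 / 2) * (√2 / 2) = (1 : ℝ) := by linarith
  have hx := h (unitaryX 0 1 (by norm_num))
  have hz := h (unitaryZ 0 1 (by norm_num))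
  have hx' := h (unitaryX (√2 / 2) (√2 / 2) hs)
  have hz' := h (unitaryZ (√2 / 2) (√2 / 2) hs)
  rw [blochBlock_unitaryX] at hx hx'
  rw [blochBlock_unitaryZ] at hz hz'
  rw [hs2, sub_self] at hx' hz'
  have e01 := congrFun (congrFun hx 0) 1
  have e02 := congrFun (congrFun hx 0) 2
  have e10 := congrFun (congrFun hx 1) 0
  have e20 := congrFun (congrFun hx 2) 0
  have e12 := congrFun (congrFun hz 1) 2
  have e21 := congrFun (congrFun hz 2) 1
  have e11 := congrFun (congrFun hx' 1) 1
  have e00 := congrFun (congrFun hz' 0) 0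
  simp [Matrix.mul_apply, Matrix.vecMul, dotProduct, Fin.sum_univ_three] at e01 e02 e10 e20 e12 e21 e11 e00
  ext i j
  fin_cases i <;> fin_cases j <;> simp [Matrix.trace_fin_three] <;> linarith

/-! ### Averages over pure states -/

section sphere

variable {E : Type*} [NormedAddCommGroup E] [InnerProductSpace ℝ E] [FiniteDimensional ℝ E]
  [MeasurableSpace E] [BorelSpace E]

/-- The action of a linear isometry on the unit sphere. -/
def sphereMap (f : E ≃ₗᵢ[ℝ] E) : Metric.sphere (0 : E) 1 ≃ₜ Metric.sphere (0 : E) 1 where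
  toFun x := ⟨f x, by simp⟩
  invFun x := ⟨f.symm x, by simp⟩
  left_inv x := by simp
  right_inv x := by simp
  continuous_toFun := by fun_prop
  continuous_invFun := by fun_prop

-- The surface measure of a set is defined through the volume of the cone over it, and a linear
-- isometry carries cones to cones and preserves volume.
open scoped Pointwise in
theorem measurePreserving_sphereMap (f : E ≃ₗᵢ[ℝ] E) :
    MeasurePreserving (sphereMap f) (volume : Measure E).toSphere (volume : Measure E).toSphere := by
  refine ⟨(sphereMap f).measurable, Measure.ext fun s hs => ?_⟩
  rw [Measure.map_apply (sphereMap f).measurable hs, Measure.toSphere_apply' _ hs,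
    Measure.toSphere_apply' _ ((sphereMap f).measurable hs)]
  congr 1
  have hset : (Set.Ioo (0 : ℝ) 1 • ((↑) '' (sphereMap f ⁻¹' s) : Set E)) =
      f ⁻¹' (Set.Ioo (0 : ℝ) 1 • ((↑) '' s : Set E)) := by
    ext x
    simp only [Set.mem_smul, Set.mem_preimage, Set.mem_image]
    constructor
    · rintro ⟨r, hr, _, ⟨y, hy, rfl⟩, rfl⟩
      exact ⟨r, hr, _, ⟨_, hy, rfl⟩, by simp [sphereMap]⟩
    · rintro ⟨r, hr, _, ⟨y, hy, rfl⟩, hx⟩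
      refine ⟨r, hr, _, ⟨(sphereMap f).symm y, by simpa using hy, rfl⟩, ?_⟩
      apply f.injective
      rw [← hx, map_smul]
      simp [sphereMap]
  rw [hset]
  exact f.measurePreserving.measure_preimage_emb f.toHomeomorph.measurableEmbedding _

end sphere

/-! ### Bloch vectors of pure states -/

/-- A unitary matrix as a real linear isometry of the Hilbert space. -/
def unitaryIsometry (u : unitaryGroup (Fin 2) ℂ) :
    EuclideanSpace ℂ (Fin 2) ≃ₗᵢ[ℝ] EuclideanSpace ℂ (Fin 2) :=
  let f := Unitary.linearIsometryEquiv
    (⟨Matrix.toEuclideanCLM (𝕜 := ℂ) u.1, Unitary.map_mem _ u.2⟩ :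
      unitary (EuclideanSpace ℂ (Fin 2) →L[ℂ] EuclideanSpace ℂ (Fin 2)))
  { f.toLinearEquiv.restrictScalars ℝ with norm_map' := f.norm_map }

theorem unitaryIsometry_apply (u : unitaryGroup (Fin 2) ℂ) (ψ : EuclideanSpace ℂ (Fin 2))
    (i : Fin 2) : unitaryIsometry u ψ i = (u.1 *ᵥ fun j => ψ j) i := rfl

theorem pureState_unitaryIsometry (u : unitaryGroup (Fin 2) ℂ) (ψ : EuclideanSpace ℂ (Fin 2)) :
    pureState (unitaryIsometry u ψ) = unitaryChannel u (pureState ψ) := by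
  rw [unitaryChannel_apply, pureState, pureState, Matrix.mul_vecMulVec, Matrix.vecMulVec_mul]
  ext i j
  simp only [Matrix.vecMulVec_apply, unitaryIsometry_apply]
  congr 1
  simp [Matrix.mulVec, Matrix.vecMul, dotProduct, mul_comm]

/-- The Bloch vector of a pure state. -/
def blochVector (ψ : EuclideanSpace ℂ (Fin 2)) (j : Fin 3) : ℝ :=
  (pauli j.succ * pureState ψ).trace.re

theorem pureState_isHermitian (ψ : EuclideanSpace ℂ (Fin 2)) : (pureState ψ).IsHermitian := by
  ext i j
  simp [pureState, Matrix.vecMulVec_apply, mul_comm]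

theorem trace_pureState {ψ : EuclideanSpace ℂ (Fin 2)} (hψ : ‖ψ‖ = 1) :
    (pureState ψ).trace = 1 := by
  have h := EuclideanSpace.norm_sq_eq ψ
  rw [hψ, Fin.sum_univ_two] at h
  simp only [pureState, Matrix.trace_fin_two, Matrix.vecMulVec_apply, RCLike.star_def,
    Complex.mul_conj]
  rw [Complex.normSq_eq_norm_sq, Complex.normSq_eq_norm_sq]
  exact_mod_cast (by simpa using h.symm)

theorem pureState_eq_pauliSum {ψ : EuclideanSpace ℂ (Fin 2)} (hψ : ‖ψ‖ = 1) :
    pureState ψ = (1 / 2 : ℂ) • pauliSum (Fin.cons 1 (blochVector ψ)) := by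
  have h := isHermitian_eq_pauliSum (pureState_isHermitian ψ)
  have h2 := pauliSum_smul (1 / 2) (Fin.cons 1 (blochVector ψ))
  push_cast at h2
  rw [← h2]
  nth_rewrite 1 [h]
  congr 1
  ext k
  refine Fin.cases ?_ (fun j => ?_) k
  · simp [pauli_zero, trace_pureState hψ]
  · simp [blochVector]; ring

theorem blochVector_dotProduct_self {ψ : EuclideanSpace ℂ (Fin 2)} (hψ : ‖ψ‖ = 1) :
    blochVector ψ ⬝ᵥ blochVector ψ = 1 := by
  have h : (pureState ψ).det = 0 := by
    simp only [pureState, Matrix.det_fin_two, Matrix.vecMulVec_apply]; ring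
  rw [pureState_eq_pauliSum hψ, Matrix.det_smul, pauliSum_eq, Matrix.det_fin_two] at h
  have hI := Complex.I_sq
  simp only [dotProduct, Fin.sum_univ_three]
  have e1 : (Fin.cons 1 (blochVector ψ) : Fin 4 → ℝ) 1 = blochVector ψ 0 := rfl
  have e2 : (Fin.cons 1 (blochVector ψ) : Fin 4 → ℝ) 2 = blochVector ψ 1 := rfl
  have e3 : (Fin.cons 1 (blochVector ψ) : Fin 4 → ℝ) 3 = blochVector ψ 2 := rfl
  simp [e1, e2, e3] at h
  have h' : ((blochVector ψ 0 * blochVector ψ 0 + blochVector ψ 1 * blochVector ψ 1 +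
      blochVector ψ 2 * blochVector ψ 2 : ℝ) : ℂ) = ((1 : ℝ) : ℂ) := by
    push_cast
    linear_combination -h + (blochVector ψ 1 : ℂ) ^ 2 * hI
  exact_mod_cast h'

theorem IsPosTP.apply_pureState {Λ : Superop 2} (h : IsPosTP Λ) {ψ : EuclideanSpace ℂ (Fin 2)}
    (hψ : ‖ψ‖ = 1) : Λ (pureState ψ) = (1 / 2 : ℂ) • pauliSum (Fin.cons 1
      ((fun j => liouville Λ (Fin.succ j) 0) + blochBlock Λ *ᵥ blochVector ψ)) := by
  rw [pureState_eq_pauliSum hψ, map_smul, h.apply_pauliSum]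
  congr 2
  ext k
  refine Fin.cases ?_ (fun j => ?_) k
  · simp [Matrix.mulVec, dotProduct, h.liouville_zero]
  · simp only [Matrix.mulVec, dotProduct, Fin.cons_succ, Pi.add_apply]
    rw [Fin.sum_univ_succ]
    simp [blochBlock]

theorem blochVector_unitaryIsometry (u : unitaryGroup (Fin 2) ℂ)
    {ψ : EuclideanSpace ℂ (Fin 2)} (hψ : ‖ψ‖ = 1) :
    blochVector (unitaryIsometry u ψ) = blochBlock (unitaryChannel u) *ᵥ blochVector ψ := by
  ext j
  rw [blochVector, pureState_unitaryIsometry, (isPosTP_unitaryChannel u).apply_pureState hψ,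
    Matrix.mul_smul, Matrix.trace_smul, trace_pauli_mul_pauliSum]
  have : (fun j => liouville (unitaryChannel u) (Fin.succ j) 0) = 0 := by
    ext j; simp [liouville_unitaryChannel_col_zero]
  rw [this, zero_add, Fin.cons_succ]
  simp

theorem re_trace_pauliSum_mul (v w : Fin 4 → ℝ) :
    ((pauliSum v)ᴴ * pauliSum w).trace.re = 2 * (v ⬝ᵥ w) := by
  rw [(pauliSum_isHermitian v).eq, pauliSum, Finset.sum_mul, Matrix.trace_sum, Complex.re_sum]
  simp only [Matrix.smul_mul, Matrix.trace_smul, trace_pauli_mul_pauliSum, smul_eq_mul]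
  rw [dotProduct, Finset.mul_sum]
  refine Finset.sum_congr rfl fun k _ => ?_
  rw [Complex.re_ofReal_mul]
  simp
  ring

/-! ### The average fidelity of qubit maps -/

theorem continuous_blochVector (j : Fin 3) : Continuous fun ψ => blochVector ψ j := by
  unfold blochVector pureState
  simp only [Matrix.trace_fin_two, Matrix.mul_apply, Fin.sum_univ_two, Matrix.vecMulVec_apply]
  fun_prop

/-- The uniform probability measure on the unit sphere. -/
def sphereMeasure : Measure (Metric.sphere (0 : EuclideanSpace ℂ (Fin 2)) 1) :=
  ((volume : Measure (EuclideanSpace ℂ (Fin 2))).toSphere Set.univ)⁻¹ •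
    (volume : Measure (EuclideanSpace ℂ (Fin 2))).toSphere

instance : IsProbabilityMeasure sphereMeasure := by
  have : NeZero ((volume : Measure (EuclideanSpace ℂ (Fin 2))).toSphere) :=
    ⟨Measure.toSphere_ne_zero _⟩
  unfold sphereMeasure
  infer_instance

theorem integrable_sphereMeasure {f : Metric.sphere (0 : EuclideanSpace ℂ (Fin 2)) 1 → ℝ}
    (hf : Continuous f) : Integrable f sphereMeasure :=
  hf.integrable_of_hasCompactSupport (HasCompactSupport.of_compactSpace f)

theorem integral_sphereMeasure_comp (u : unitaryGroup (Fin 2) ℂ)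
    (g : Metric.sphere (0 : EuclideanSpace ℂ (Fin 2)) 1 → ℝ) :
    ∫ ψ, g (sphereMap (unitaryIsometry u) ψ) ∂sphereMeasure = ∫ ψ, g ψ ∂sphereMeasure :=
  ((measurePreserving_sphereMap (unitaryIsometry u)).smul_measure _).integral_comp
    (sphereMap (unitaryIsometry u)).measurableEmbedding g

theorem blochVector_sphereMap (u : unitaryGroup (Fin 2) ℂ)
    (ψ : Metric.sphere (0 : EuclideanSpace ℂ (Fin 2)) 1) :
    blochVector (sphereMap (unitaryIsometry u) ψ).1 =
      blochBlock (unitaryChannel u) *ᵥ blochVector ψ.1 :=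
  blochVector_unitaryIsometry u (by simp)

theorem continuous_blochVector_sphere (j : Fin 3) :
    Continuous fun ψ : Metric.sphere (0 : EuclideanSpace ℂ (Fin 2)) 1 => blochVector ψ.1 j :=
  (continuous_blochVector j).comp continuous_subtype_val

theorem integral_blochVector (j : Fin 3) : ∫ ψ, blochVector ψ.1 j ∂sphereMeasure = 0 := by
  have h : (fun j => ∫ ψ, blochVector ψ.1 j ∂sphereMeasure) = 0 := by
    refine eq_zero_of_rotation_invariant fun u => ?_
    ext i
    rw [← integral_sphereMeasure_comp u]
    simp only [blochVector_sphereMap, Matrix.mulVec, dotProduct]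
    rw [integral_finsetSum _ fun k _ =>
      (integrable_sphereMeasure (continuous_blochVector_sphere k)).const_mul _]
    exact Finset.sum_congr rfl fun k _ => (integral_const_mul _ _).symm
  exact congrFun h j

/-- Unitary invariance of the sphere makes the second moment matrix commute with every rotation, so
it is scalar; its trace is `1` because Bloch vectors of pure states have unit length. -/
theorem integral_blochVector_mul (j k : Fin 3) :
    ∫ ψ, blochVector ψ.1 j * blochVector ψ.1 k ∂sphereMeasure = if j = k then 1 / 3 else 0 := by
  set M : Mat3 := Matrix.of fun j k => ∫ ψ, blochVector ψ.1 j * blochVector ψ.1 k ∂sphereMeasure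
    with hM
  have hint : ∀ j k, Integrable (fun ψ : Metric.sphere (0 : EuclideanSpace ℂ (Fin 2)) 1 =>
      blochVector ψ.1 j * blochVector ψ.1 k) sphereMeasure := fun j k =>
    integrable_sphereMeasure
      ((continuous_blochVector_sphere j).mul (continuous_blochVector_sphere k))
  have h : M = (M.trace / 3) • (1 : Mat3) := by
    refine eq_smul_one_of_rotation_invariant fun u => ?_
    ext i l
    have e : M i l = ∫ ψ, blochVector ψ.1 i * blochVector ψ.1 l ∂sphereMeasure := rfl
    rw [e, ← integral_sphereMeasure_comp u]
    simp only [blochVector_sphereMap, Matrix.mulVec, dotProduct, Finset.sum_mul_sum]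
    rw [integral_finsetSum _ fun a _ => integrable_finsetSum _ fun b _ =>
      (((hint a b).const_mul (blochBlock (unitaryChannel u) i a)).const_mul
        (blochBlock (unitaryChannel u) l b)).congr (ae_of_all _ fun ψ => by ring)]
    rw [Matrix.mul_apply]
    simp only [Matrix.mul_apply, Finset.sum_mul, Matrix.transpose_apply]
    rw [Finset.sum_comm]
    refine Finset.sum_congr rfl fun a _ => ?_
    rw [integral_finsetSum _ fun b _ =>
      (((hint a b).const_mul (blochBlock (unitaryChannel u) i a)).const_mul
        (blochBlock (unitaryChannel u) l b)).congr (ae_of_all _ fun ψ => by ring)]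
    refine Finset.sum_congr rfl fun b _ => ?_
    rw [show M a b = ∫ ψ, blochVector ψ.1 a * blochVector ψ.1 b ∂sphereMeasure from rfl,
      ← integral_const_mul, ← integral_mul_const]
    refine integral_congr_ae (ae_of_all _ fun ψ => ?_)
    ring
  have htr : M.trace = 1 := by
    rw [Matrix.trace]
    simp only [Matrix.diag_apply, hM, Matrix.of_apply]
    rw [← integral_finsetSum _ fun j _ => hint j j]
    have : ∀ ψ : Metric.sphere (0 : EuclideanSpace ℂ (Fin 2)) 1,
        ∑ j, blochVector ψ.1 j * blochVector ψ.1 j = 1 := fun ψ =>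
      blochVector_dotProduct_self (by simp)
    simp [this]
  have := congrFun (congrFun h j) k
  rw [htr] at this
  rw [show M j k = ∫ ψ, blochVector ψ.1 j * blochVector ψ.1 k ∂sphereMeasure from rfl] at this
  rw [this, Matrix.smul_apply, Matrix.one_apply]
  split_ifs <;> simp

/-- The average fidelity of a positive trace preserving map to a unital one. -/
theorem avgFidelity_eq {Λ Γ : Superop 2} (hΛ : IsPosTP Λ) (hΓ : IsPosTP Γ)
    (hΓ1 : ∀ j : Fin 3, liouville Γ j.succ 0 = 0) :
    avgFidelity Λ Γ = 1 / 2 + 1 / 6 * ((blochBlock Γ)ᵀ * blochBlock Λ).trace := by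
  have hint : ∀ j k, Integrable (fun ψ : Metric.sphere (0 : EuclideanSpace ℂ (Fin 2)) 1 =>
      blochVector ψ.1 j * blochVector ψ.1 k) sphereMeasure := fun j k =>
    integrable_sphereMeasure
      ((continuous_blochVector_sphere j).mul (continuous_blochVector_sphere k))
  have hint1 : ∀ j, Integrable (fun ψ : Metric.sphere (0 : EuclideanSpace ℂ (Fin 2)) 1 =>
      blochVector ψ.1 j) sphereMeasure := fun j =>
    integrable_sphereMeasure (continuous_blochVector_sphere j)
  have hpt : ∀ ψ : Metric.sphere (0 : EuclideanSpace ℂ (Fin 2)) 1,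
      (((Λ (pureState ψ.1))ᴴ * Γ (pureState ψ.1)).trace).re = 1 / 2 +
        (∑ j, ∑ k, (1 / 2 * liouville Λ j.succ 0 * blochBlock Γ j k) * blochVector ψ.1 k +
        ∑ j, ∑ k, ∑ l, (1 / 2 * blochBlock Λ j l * blochBlock Γ j k) *
          (blochVector ψ.1 l * blochVector ψ.1 k)) := by
    intro ψ
    have hψ : ‖ψ.1‖ = 1 := by simp
    rw [hΛ.apply_pureState hψ, hΓ.apply_pureState hψ]
    have h0 : (fun j : Fin 3 => liouville Γ j.succ 0) = 0 := funext hΓ1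
    rw [h0, zero_add, Matrix.conjTranspose_smul, Matrix.smul_mul, Matrix.mul_smul,
      Matrix.trace_smul, Matrix.trace_smul, smul_smul, smul_eq_mul]
    have h4 : star (1 / 2 : ℂ) * (1 / 2 : ℂ) = ((1 / 4 : ℝ) : ℂ) := by
      simp; norm_num
    rw [h4, Complex.re_ofReal_mul, re_trace_pauliSum_mul, dotProduct, Fin.sum_univ_succ]
    simp only [Fin.cons_zero, Fin.cons_succ, Pi.add_apply, Matrix.mulVec, dotProduct]
    rw [← Finset.sum_add_distrib, mul_one, mul_add, mul_add, Finset.mul_sum, Finset.mul_sum]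
    congr 1
    · norm_num
    · refine Finset.sum_congr rfl fun j _ => ?_
      rw [add_mul, Finset.sum_mul_sum, Finset.mul_sum, mul_add, mul_add, Finset.mul_sum,
        Finset.mul_sum, Finset.mul_sum, Finset.mul_sum]
      rw [Finset.sum_comm]
      congr 1
      · refine Finset.sum_congr rfl fun k _ => ?_
        ring
      · refine Finset.sum_congr rfl fun k _ => ?_
        rw [Finset.mul_sum, Finset.mul_sum]
        refine Finset.sum_congr rfl fun l _ => ?_
        ring
  have hav : avgFidelity Λ Γ = ∫ ψ, (((Λ (pureState ψ.1))ᴴ * Γ (pureState ψ.1)).trace).re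
      ∂sphereMeasure := rfl
  rw [hav]
  simp only [hpt]
  have hi1 : Integrable (fun ψ : Metric.sphere (0 : EuclideanSpace ℂ (Fin 2)) 1 =>
      ∑ j, ∑ k, (1 / 2 * liouville Λ (Fin.succ j) 0 * blochBlock Γ j k) * blochVector ψ.1 k)
      sphereMeasure :=
    integrable_finsetSum _ fun j _ => integrable_finsetSum _ fun k _ => (hint1 k).const_mul _
  have hi2 : Integrable (fun ψ : Metric.sphere (0 : EuclideanSpace ℂ (Fin 2)) 1 =>
      ∑ j, ∑ k, ∑ l, (1 / 2 * blochBlock Λ j l * blochBlock Γ j k) *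
          (blochVector ψ.1 l * blochVector ψ.1 k)) sphereMeasure :=
    integrable_finsetSum _ fun j _ => integrable_finsetSum _ fun k _ =>
      integrable_finsetSum _ fun l _ => (hint l k).const_mul _
  have hi3 : Integrable (fun ψ : Metric.sphere (0 : EuclideanSpace ℂ (Fin 2)) 1 =>
      ∑ j, ∑ k, (1 / 2 * liouville Λ (Fin.succ j) 0 * blochBlock Γ j k) * blochVector ψ.1 k +
      ∑ j, ∑ k, ∑ l, (1 / 2 * blochBlock Λ j l * blochBlock Γ j k) *
          (blochVector ψ.1 l * blochVector ψ.1 k)) sphereMeasure := hi1.add hi2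
  rw [integral_add (integrable_const _) hi3, integral_add hi1 hi2]
  rw [integral_finsetSum _ fun j _ => integrable_finsetSum _ fun k _ => (hint1 k).const_mul _]
  rw [integral_finsetSum _ fun j _ => integrable_finsetSum _ fun k _ =>
      integrable_finsetSum _ fun l _ => (hint l k).const_mul _]
  have e1 : ∀ j : Fin 3, ∫ ψ : Metric.sphere (0 : EuclideanSpace ℂ (Fin 2)) 1,
      ∑ k, (1 / 2 * liouville Λ j.succ 0 * blochBlock Γ j k) * blochVector ψ.1 k ∂sphereMeasure
      = 0 := fun j => by
    rw [integral_finsetSum _ fun k _ => (hint1 k).const_mul _]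
    simp [integral_const_mul, integral_blochVector]
  have e2 : ∀ j : Fin 3, ∫ ψ : Metric.sphere (0 : EuclideanSpace ℂ (Fin 2)) 1,
      ∑ k, ∑ l, (1 / 2 * blochBlock Λ j l * blochBlock Γ j k) *
        (blochVector ψ.1 l * blochVector ψ.1 k) ∂sphereMeasure
      = ∑ k, 1 / 6 * (blochBlock Γ j k * blochBlock Λ j k) := fun j => by
    rw [integral_finsetSum _ fun k _ => integrable_finsetSum _ fun l _ => (hint l k).const_mul _]
    refine Finset.sum_congr rfl fun k _ => ?_
    rw [integral_finsetSum _ fun l _ => (hint l k).const_mul _]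
    simp only [integral_const_mul, integral_blochVector_mul]
    simp
    ring
  simp only [e1, e2]
  simp [Matrix.trace, Matrix.mul_apply, Finset.mul_sum]
  rw [Finset.sum_comm]

/-! ### The unitary group -/

/-- Compactness provides the maximizing unitary and the integrability of continuous functions on the
group. -/
instance compactSpace_unitaryGroup : CompactSpace (unitaryGroup (Fin 2) ℂ) := by
  have hK : IsCompact (Set.univ.pi fun _ : Fin 2 => Set.univ.pi fun _ : Fin 2 =>
      Metric.closedBall (0 : ℂ) 1) :=
    isCompact_univ_pi fun _ => isCompact_univ_pi fun _ => isCompact_closedBall 0 1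
  refine isCompact_iff_compactSpace.1 (IsCompact.of_isClosed_subset (t :=
    ((unitaryGroup (Fin 2) ℂ : Submonoid (Matrix (Fin 2) (Fin 2) ℂ)) :
        Set (Matrix (Fin 2) (Fin 2) ℂ))) hK ?_ ?_)
  · have : ((unitaryGroup (Fin 2) ℂ : Submonoid (Matrix (Fin 2) (Fin 2) ℂ)) :
        Set (Matrix (Fin 2) (Fin 2) ℂ)) = {A | A * Aᴴ = 1} := by
      ext A
      exact Matrix.mem_unitaryGroup_iff
    rw [this]
    exact isClosed_eq (continuous_id.matrix_mul continuous_id.matrix_conjTranspose)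
      continuous_const
  · intro A hA i _ j _
    rw [mem_closedBall_zero_iff]
    exact entry_norm_bound_of_unitary hA i j

theorem continuous_liouville_unitaryChannel (j k : Fin 4) :
    Continuous fun v : unitaryGroup (Fin 2) ℂ => liouville (unitaryChannel v) j k := by
  simp only [liouville, Matrix.of_apply, unitaryChannel_apply]
  have h : Continuous fun v : unitaryGroup (Fin 2) ℂ => v.1 := continuous_subtype_val
  have h2 := (Continuous.matrix_trace (continuous_const.matrix_mul
    ((h.matrix_mul (continuous_const (y := pauli k))).matrix_mul h.matrix_conjTranspose)) :
      Continuous fun v : unitaryGroup (Fin 2) ℂ => (pauli j * (v.1 * pauli k * v.1ᴴ)).trace)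
  exact (Complex.continuous_re.comp h2).div_const 2

theorem continuous_blochBlock_unitaryChannel (j k : Fin 3) :
    Continuous fun v : unitaryGroup (Fin 2) ℂ => blochBlock (unitaryChannel v) j k :=
  continuous_liouville_unitaryChannel j.succ k.succ

/-! ### Moments of a unitary 2-design -/

theorem liouville_ofReal {Λ : Superop 2} (h : IsPosTP Λ) (j k : Fin 4) :
    (liouville Λ j k : ℂ) = (pauli j * Λ (pauli k)).trace / 2 := by
  rw [h.apply_pauli, trace_pauli_mul_pauliSum]
  simp

/-- Products of entries of the Liouville matrix of a unitary channel are linear in the second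
tensor power of the channel. -/
theorem liouville_mul_liouville_eq_sum (v : unitaryGroup (Fin 2) ℂ) (j k j' k' : Fin 4) :
    ((liouville (unitaryChannel v) j k * liouville (unitaryChannel v) j' k' : ℝ) : ℂ) =
      ∑ x, ∑ y, ((pauli j ⊗ₖ pauli j') x y / 4) *
        ((v.1 ⊗ₖ v.1) * (pauli k ⊗ₖ pauli k') * (v.1 ⊗ₖ v.1)ᴴ) y x := by
  rw [Complex.ofReal_mul, liouville_ofReal (isPosTP_unitaryChannel v),
    liouville_ofReal (isPosTP_unitaryChannel v), Matrix.conjTranspose_kronecker,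
    ← Matrix.mul_kronecker_mul, ← Matrix.mul_kronecker_mul, div_mul_div_comm,
    ← Matrix.trace_kronecker, unitaryChannel_apply, unitaryChannel_apply,
    Matrix.mul_kronecker_mul]
  simp only [Matrix.trace, Matrix.diag_apply]
  rw [Finset.sum_div]
  refine Finset.sum_congr rfl fun x _ => ?_
  rw [Matrix.mul_apply, Finset.sum_div]
  refine Finset.sum_congr rfl fun y _ => ?_
  ring

/-! ### Haar moments of the Bloch block -/

section haar

variable [MeasurableSpace (unitaryGroup (Fin 2) ℂ)] [BorelSpace (unitaryGroup (Fin 2) ℂ)]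
  {μ : Measure (unitaryGroup (Fin 2) ℂ)}

theorem integrable_unitaryGroup [IsProbabilityMeasure μ] {F : Type*} [NormedAddCommGroup F] [SecondCountableTopology F]
    {f : unitaryGroup (Fin 2) ℂ → F} (hf : Continuous f) : Integrable f μ :=
  hf.integrable_of_hasCompactSupport (HasCompactSupport.of_compactSpace f)

theorem integral_unitaryGroup_mul_left
    (hμ : ∀ g : unitaryGroup (Fin 2) ℂ, Measure.map (fun v => g * v) μ = μ)
    {f : unitaryGroup (Fin 2) ℂ → ℝ} (hf : Continuous f) (g : unitaryGroup (Fin 2) ℂ) :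
    ∫ v, f (g * v) ∂μ = ∫ v, f v ∂μ := by
  have hg : Continuous fun v : unitaryGroup (Fin 2) ℂ => g * v := continuous_const_mul g
  nth_rewrite 2 [← hμ g]
  rw [integral_map hg.measurable.aemeasurable hf.aestronglyMeasurable]

theorem integral_blochBlock_unitary [IsProbabilityMeasure μ]
    (hμ : ∀ g : unitaryGroup (Fin 2) ℂ, Measure.map (fun v => g * v) μ = μ) (j k : Fin 3) :
    ∫ v, blochBlock (unitaryChannel v) j k ∂μ = 0 := by
  have hc := continuous_blochBlock_unitaryChannel
  have h : (fun j => ∫ v, blochBlock (unitaryChannel v) j k ∂μ) = 0 := by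
    refine eq_zero_of_rotation_invariant fun u => ?_
    ext i
    rw [← integral_unitaryGroup_mul_left hμ (hc i k) u]
    simp only [blochBlock_unitaryChannel_mul, Matrix.mul_apply, Matrix.mulVec, dotProduct]
    rw [integral_finsetSum _ fun a _ => (integrable_unitaryGroup (hc a k)).const_mul _]
    exact Finset.sum_congr rfl fun a _ => (integral_const_mul _ _).symm
  exact congrFun h j

/-- For fixed columns `k`, `k'`, left invariance makes the moment matrix in the row indices commute
with rotations, hence scalar. Orthogonality of the columns gives its trace. -/
theorem integral_blochBlock_mul_blochBlock_unitary [IsProbabilityMeasure μ]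
    (hμ : ∀ g : unitaryGroup (Fin 2) ℂ, Measure.map (fun v => g * v) μ = μ)
    (j k j' k' : Fin 3) :
    ∫ v, blochBlock (unitaryChannel v) j k * blochBlock (unitaryChannel v) j' k' ∂μ =
      if j = j' ∧ k = k' then 1 / 3 else 0 := by
  have hc : ∀ a b, Continuous fun v : unitaryGroup (Fin 2) ℂ =>
      blochBlock (unitaryChannel v) a k * blochBlock (unitaryChannel v) b k' := fun a b =>
    (continuous_blochBlock_unitaryChannel a k).mul (continuous_blochBlock_unitaryChannel b k')
  have hint : ∀ a b, Integrable (fun v : unitaryGroup (Fin 2) ℂ =>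
      blochBlock (unitaryChannel v) a k * blochBlock (unitaryChannel v) b k') μ := fun a b =>
    integrable_unitaryGroup (hc a b)
  set M : Mat3 := Matrix.of fun a b =>
    ∫ v, blochBlock (unitaryChannel v) a k * blochBlock (unitaryChannel v) b k' ∂μ with hM
  have h : M = (M.trace / 3) • (1 : Mat3) := by
    refine eq_smul_one_of_rotation_invariant fun u => ?_
    ext i l
    have hi : ∀ a b, Integrable (fun v : unitaryGroup (Fin 2) ℂ =>
        blochBlock (unitaryChannel u) i a * blochBlock (unitaryChannel v) a k *
        (blochBlock (unitaryChannel u) l b * blochBlock (unitaryChannel v) b k')) μ := fun a b =>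
      (((hint a b).const_mul (blochBlock (unitaryChannel u) i a)).const_mul
        (blochBlock (unitaryChannel u) l b)).congr (ae_of_all _ fun v => by ring)
    have e : M i l = ∫ v, blochBlock (unitaryChannel v) i k *
      blochBlock (unitaryChannel v) l k' ∂μ := rfl
    rw [e, ← integral_unitaryGroup_mul_left hμ (hc i l) u]
    simp only [blochBlock_unitaryChannel_mul]
    simp only [Matrix.mul_apply, Finset.sum_mul_sum]
    rw [integral_finsetSum _ fun a _ => integrable_finsetSum _ fun b _ => hi a b]
    simp only [Finset.sum_mul, Matrix.transpose_apply]
    rw [Finset.sum_comm]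
    refine Finset.sum_congr rfl fun a _ => ?_
    rw [integral_finsetSum _ fun b _ => hi a b]
    refine Finset.sum_congr rfl fun b _ => ?_
    rw [show M a b = ∫ v, blochBlock (unitaryChannel v) a k *
      blochBlock (unitaryChannel v) b k' ∂μ from rfl, ← integral_const_mul, ← integral_mul_const]
    refine integral_congr_ae (ae_of_all _ fun v => ?_)
    ring
  have htr : M.trace = if k = k' then 1 else 0 := by
    rw [Matrix.trace]
    simp only [Matrix.diag_apply, hM, Matrix.of_apply]
    rw [← integral_finsetSum _ fun a _ => hint a a]
    have : ∀ v : unitaryGroup (Fin 2) ℂ, ∑ a, blochBlock (unitaryChannel v) a k *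
        blochBlock (unitaryChannel v) a k' = if k = k' then 1 else 0 := fun v => by
      have := congrFun (congrFun (blochBlock_unitaryChannel_orth v) k) k'
      rwa [Matrix.mul_apply, Matrix.one_apply] at this
    simp only [this]
    simp
  have := congrFun (congrFun h j) j'
  rw [htr] at this
  rw [show M j j' = ∫ v, blochBlock (unitaryChannel v) j k *
    blochBlock (unitaryChannel v) j' k' ∂μ from rfl] at this
  rw [this, Matrix.smul_apply, Matrix.one_apply]
  by_cases h1 : j = j' <;> by_cases h2 : k = k' <;> simp [h1, h2]

end haar

variable {ι : Type*} [Fintype ι]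

theorem integral_liouville_mul_liouville [MeasurableSpace (unitaryGroup (Fin 2) ℂ)]
    [BorelSpace (unitaryGroup (Fin 2) ℂ)]
    {μ : Measure (unitaryGroup (Fin 2) ℂ)} [IsProbabilityMeasure μ]
    {U : ι → unitaryGroup (Fin 2) ℂ}
    (h : ∀ (A : Matrix (Fin 2 × Fin 2) (Fin 2 × Fin 2) ℂ) (x y : Fin 2 × Fin 2),
      (𝔼 i, (((U i).1 ⊗ₖ (U i).1) * A * ((U i).1 ⊗ₖ (U i).1)ᴴ) x y) =
        ∫ v : unitaryGroup (Fin 2) ℂ, ((v.1 ⊗ₖ v.1) * A * (v.1 ⊗ₖ v.1)ᴴ) x y ∂μ)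
    (j k j' k' : Fin 4) :
    𝔼 i, liouville (unitaryChannel (U i)) j k * liouville (unitaryChannel (U i)) j' k' =
      ∫ v, liouville (unitaryChannel v) j k * liouville (unitaryChannel v) j' k' ∂μ := by
  have hcast : ((𝔼 i, liouville (unitaryChannel (U i)) j k *
      liouville (unitaryChannel (U i)) j' k' : ℝ) : ℂ) =
      ((∫ v, liouville (unitaryChannel v) j k * liouville (unitaryChannel v) j' k' ∂μ : ℝ) : ℂ) := by
    have hent : ∀ x y, Continuous fun v : unitaryGroup (Fin 2) ℂ =>
        ((v.1 ⊗ₖ v.1) * (pauli k ⊗ₖ pauli k') * (v.1 ⊗ₖ v.1)ᴴ) x y := fun x y => by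
      have h1 : Continuous fun v : unitaryGroup (Fin 2) ℂ => v.1 ⊗ₖ v.1 :=
        continuous_matrix fun a b => by
          simp only [Matrix.kroneckerMap_apply]
          exact (continuous_subtype_val.matrix_elem _ _).mul
            (continuous_subtype_val.matrix_elem _ _)
      exact ((h1.matrix_mul continuous_const).matrix_mul h1.matrix_conjTranspose).matrix_elem x y
    rw [← integral_complex_ofReal, Complex.ofReal_expect]
    simp only [liouville_mul_liouville_eq_sum]
    rw [integral_finsetSum _ fun x _ => integrable_finsetSum _ fun y _ =>
      (integrable_unitaryGroup (hent y x)).const_mul _, Finset.expect_sum_comm]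
    refine Finset.sum_congr rfl fun x _ => ?_
    rw [integral_finsetSum _ fun y _ =>
      (integrable_unitaryGroup (hent y x)).const_mul _, Finset.expect_sum_comm]
    refine Finset.sum_congr rfl fun y _ => ?_
    rw [integral_const_mul, ← h, Finset.mul_expect]
  exact_mod_cast hcast

theorem IsUnitaryTwoDesign.expect_blochBlock {U : ι → unitaryGroup (Fin 2) ℂ}
    (hU : IsUnitaryTwoDesign U) (j k : Fin 3) :
    𝔼 i, blochBlock (unitaryChannel (U i)) j k = 0 := by
  obtain ⟨μ, hprob, hinv, h⟩ := hU
  let _ : MeasurableSpace (unitaryGroup (Fin 2) ℂ) := borel _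
  have : BorelSpace (unitaryGroup (Fin 2) ℂ) := ⟨rfl⟩
  -- First moments are second moments in disguise: the `(0, 0)` entry of the Liouville matrix is the
  -- constant `1`.
  have h1 := integral_liouville_mul_liouville h j.succ k.succ 0 0
  simp only [(isPosTP_unitaryChannel _).liouville_zero, if_true, mul_one] at h1
  exact h1.trans (integral_blochBlock_unitary hinv j k)

theorem IsUnitaryTwoDesign.expect_blochBlock_mul {U : ι → unitaryGroup (Fin 2) ℂ}
    (hU : IsUnitaryTwoDesign U) (j k j' k' : Fin 3) :
    𝔼 i, blochBlock (unitaryChannel (U i)) j k * blochBlock (unitaryChannel (U i)) j' k' =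
      if j = j' ∧ k = k' then 1 / 3 else 0 := by
  obtain ⟨μ, hprob, hinv, h⟩ := hU
  let _ : MeasurableSpace (unitaryGroup (Fin 2) ℂ) := borel _
  have : BorelSpace (unitaryGroup (Fin 2) ℂ) := ⟨rfl⟩
  exact (integral_liouville_mul_liouville h j.succ k.succ j'.succ k'.succ).trans
    (integral_blochBlock_mul_blochBlock_unitary hinv j k j' k')

theorem expect_matrix_apply {m n : Type*} (f : ι → Matrix m n ℝ) (a : m) (b : n) :
    (𝔼 i, f i) a b = 𝔼 i, f i a b := by
  rw [expect_eq_inv_smul_sum, expect_eq_inv_smul_sum, Matrix.smul_apply, Matrix.sum_apply]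

theorem IsUnitaryTwoDesign.expect_transpose_mul_mul {U : ι → unitaryGroup (Fin 2) ℂ}
    (hU : IsUnitaryTwoDesign U) (X : Mat3) :
    𝔼 i, (blochBlock (unitaryChannel (U i)))ᵀ * X * blochBlock (unitaryChannel (U i)) =
      (X.trace / 3) • (1 : Mat3) := by
  ext a b
  rw [expect_matrix_apply]
  have e : ∀ i, ((blochBlock (unitaryChannel (U i)))ᵀ * X *
      blochBlock (unitaryChannel (U i))) a b = ∑ j, ∑ j', X j' j *
      (blochBlock (unitaryChannel (U i)) j' a * blochBlock (unitaryChannel (U i)) j b) := by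
    intro i
    simp only [Matrix.mul_apply, Finset.sum_mul, Matrix.transpose_apply]
    exact Finset.sum_congr rfl fun j _ => Finset.sum_congr rfl fun j' _ => by ring
  simp only [e, Finset.expect_sum_comm, ← Finset.mul_expect, hU.expect_blochBlock_mul]
  rw [Matrix.smul_apply, Matrix.one_apply, Matrix.trace]
  by_cases hab : a = b
  · simp [hab, Finset.sum_mul, div_eq_mul_inv]
  · simp [hab]

theorem IsUnitaryTwoDesign.expect_mul_mul_transpose {U : ι → unitaryGroup (Fin 2) ℂ}
    (hU : IsUnitaryTwoDesign U) (X : Mat3) :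
    𝔼 i, blochBlock (unitaryChannel (U i)) * X * (blochBlock (unitaryChannel (U i)))ᵀ =
      (X.trace / 3) • (1 : Mat3) := by
  ext a b
  rw [expect_matrix_apply]
  have e : ∀ i, (blochBlock (unitaryChannel (U i)) * X *
      (blochBlock (unitaryChannel (U i)))ᵀ) a b = ∑ j, ∑ j', X j' j *
      (blochBlock (unitaryChannel (U i)) a j' * blochBlock (unitaryChannel (U i)) b j) := by
    intro i
    simp only [Matrix.mul_apply, Finset.sum_mul, Matrix.transpose_apply]
    exact Finset.sum_congr rfl fun j _ => Finset.sum_congr rfl fun j' _ => by ring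
  simp only [e, Finset.expect_sum_comm, ← Finset.mul_expect, hU.expect_blochBlock_mul]
  rw [Matrix.smul_apply, Matrix.one_apply, Matrix.trace]
  by_cases hab : a = b
  · simp [hab, Finset.sum_mul, div_eq_mul_inv]
  · simp [hab]

end

noncomputable section

attribute [local instance] Matrix.frobeniusNormedAddCommGroup Matrix.frobeniusNormedSpace
attribute [local instance] frobeniusInner

/-! ### Polar decompositions -/

/-- Pairing `D - 1` with `x xᵀ`, whose norm is `x ⬝ᵥ x`, shows that the quadratic form of `D`
differs from that of `1` by less than `x ⬝ᵥ x`. -/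
theorem posDef_of_norm_sub_one_lt {D : Mat3} (hD : Dᵀ = D) (h : ‖D - 1‖ < 1) : D.PosDef := by
  refine Matrix.PosDef.of_dotProduct_mulVec_pos ?_ fun x hx => ?_
  · rw [Matrix.IsHermitian, Matrix.conjTranspose_eq_transpose_of_trivial, hD]
  · have hpos : 0 < x ⬝ᵥ x := by
      have h1 := dotProduct_self_star_nonneg x
      rw [star_trivial] at h1
      exact lt_of_le_of_ne h1 fun h2 => hx (dotProduct_self_eq_zero.1 h2.symm)
    have hn : ‖Matrix.vecMulVec x x‖ = x ⬝ᵥ x := by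
      rw [← Real.sqrt_sq (norm_nonneg _), frobenius_norm_sq, Matrix.transpose_vecMulVec,
        Matrix.vecMulVec_mul_vecMulVec, Matrix.trace_vecMulVec, dotProduct_smul, smul_eq_mul,
        Real.sqrt_mul_self hpos.le]
    have hin : inner ℝ (Matrix.vecMulVec x x) (D - 1) = x ⬝ᵥ (D *ᵥ x) - x ⬝ᵥ x := by
      rw [inner_mat_def, Matrix.transpose_vecMulVec, Matrix.vecMulVec_mul, Matrix.trace_vecMulVec,
        Matrix.vecMul_sub, dotProduct_sub, Matrix.vecMul_one, dotProduct_comm x (x ᵥ* D),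
        ← Matrix.dotProduct_mulVec]
    have hle := (abs_le.1 (abs_real_inner_le_norm (Matrix.vecMulVec x x) (D - 1))).1
    rw [hin, hn] at hle
    rw [star_trivial]
    nlinarith

/-- For `D = Bᵀ B` this writes the trace deficit `tr D - tr (D Q)` as half a square; both the
extremality of `Q = 1` and its uniqueness for invertible `D` follow. -/
theorem norm_mul_one_sub_sq {B Q : Mat3} (hQ : Qᵀ * Q = 1) :
    ‖B * (1 - Q)‖ ^ 2 = 2 * (Bᵀ * B).trace - 2 * (Bᵀ * B * Q).trace := by
  rw [Matrix.mul_sub, Matrix.mul_one, @norm_sub_sq_real, norm_mul_orth hQ, frobenius_norm_sq,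
    inner_mat_def, ← Matrix.mul_assoc]
  ring

theorem trace_mul_orth_le {D Q : Mat3} (hD : D.PosSemidef) (hQ : Qᵀ * Q = 1) :
    (D * Q).trace ≤ D.trace := by
  obtain ⟨B, rfl⟩ := hD.exists_eq_transpose_mul
  nlinarith [norm_mul_one_sub_sq (B := B) hQ, sq_nonneg ‖B * (1 - Q)‖]

theorem eq_one_of_trace_le_trace_mul {D Q : Mat3} (hD : D.PosDef) (hQ : Qᵀ * Q = 1)
    (h : D.trace ≤ (D * Q).trace) : Q = 1 := by
  obtain ⟨B, hB⟩ := hD.posSemidef.exists_eq_transpose_mul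
  have h1 := norm_mul_one_sub_sq (B := B) hQ
  rw [← hB] at h1
  have h2 : B * (1 - Q) = 0 := by
    rw [← norm_eq_zero]
    nlinarith [norm_nonneg (B * (1 - Q)), sq_nonneg ‖B * (1 - Q)‖]
  have h3 : D * (1 - Q) = 0 := by rw [hB, Matrix.mul_assoc, h2, Matrix.mul_zero]
  have h4 : 1 - Q = 0 := by
    have := congrArg (D⁻¹ * ·) h3
    simpa [← Matrix.mul_assoc, Matrix.nonsing_inv_mul D ((Matrix.isUnit_iff_isUnit_det D).1 hD.isUnit)]
      using this
  exact (sub_eq_zero.1 h4).symm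

/-! ### Optimal corrections -/

theorem avgFidelity_mul_unitaryChannel_one {Λ : Superop 2} (h : IsPosTP Λ)
    (V : unitaryGroup (Fin 2) ℂ) : avgFidelity (Λ * unitaryChannel V) 1 =
      1 / 2 + 1 / 6 * (blochBlock Λ * blochBlock (unitaryChannel V)).trace := by
  rw [avgFidelity_eq (h.mul (isPosTP_unitaryChannel V)) IsPosTP.one, blochBlock_one,
    Matrix.transpose_one, Matrix.one_mul, (isPosTP_unitaryChannel V).blochBlock_mul]
  intro j
  rw [liouville_one, Matrix.one_apply_ne (Fin.succ_ne_zero j)]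

theorem isOptimalCorrection_iff {Λ : Superop 2} (h : IsPosTP Λ) {W : unitaryGroup (Fin 2) ℂ} :
    IsOptimalCorrection Λ W ↔ ∀ V, (blochBlock Λ * blochBlock (unitaryChannel V)).trace ≤
      (blochBlock Λ * blochBlock (unitaryChannel W)).trace := by
  refine forall_congr' fun V => ?_
  rw [avgFidelity_mul_unitaryChannel_one h, avgFidelity_mul_unitaryChannel_one h]
  constructor <;> intro h <;> linarith

theorem exists_isOptimalCorrection {Λ : Superop 2} (h : IsPosTP Λ) :
    ∃ W, IsOptimalCorrection Λ W := by
  have hc : Continuous fun V : unitaryGroup (Fin 2) ℂ =>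
      (blochBlock Λ * blochBlock (unitaryChannel V)).trace :=
    (continuous_const.matrix_mul (continuous_matrix fun j k =>
      continuous_blochBlock_unitaryChannel j k)).matrix_trace
  obtain ⟨W, -, hW⟩ := isCompact_univ.exists_isMaxOn Set.univ_nonempty hc.continuousOn
  exact ⟨W, (isOptimalCorrection_iff h).2 fun V => hW (Set.mem_univ V)⟩

/-- A first order variation cannot be dominated by a second order one: this is stationarity at the
identity along a one-parameter group of rotations. -/
theorem eq_zero_of_forall_mul_le {a S : ℝ}
    (h : ∀ x y : ℝ, x ^ 2 + y ^ 2 = 1 → x * y * a ≤ y ^ 2 * S) : a = 0 := by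
  by_contra ha
  have hb : S < |S| + 1 := (le_abs_self S).trans_lt (lt_add_one _)
  set b := |S| + 1
  have ha2 : 0 < a ^ 2 := by positivity
  have hn : 0 < b ^ 2 + a ^ 2 := by positivity
  have hs := Real.sq_sqrt hn.le
  have hs0 := Real.sqrt_pos.2 hn
  set n := √(b ^ 2 + a ^ 2)
  -- This choice yields `b a² ≤ S a²`, contradicting `S < b` when `a ≠ 0`.
  have h1 := h (b / n) (a / n) (by rw [div_pow, div_pow, ← add_div, hs, div_self hn.ne'])
  have e1 : b / n * (a / n) * a = b * a ^ 2 / n ^ 2 := by field_simp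
  have e2 : (a / n) ^ 2 * S = a ^ 2 * S / n ^ 2 := by field_simp
  rw [e1, e2, div_le_div_iff_of_pos_right (by positivity)] at h1
  nlinarith

/-- A matrix whose trace does not increase under rotations is symmetric. -/
theorem transpose_eq_of_trace_mul_rotation_le {D : Mat3}
    (h : ∀ V, (D * blochBlock (unitaryChannel V)).trace ≤ D.trace) : Dᵀ = D := by
  have hx : D 1 2 - D 2 1 = 0 := by
    refine neg_eq_zero.1 (eq_zero_of_forall_mul_le (S := D 1 1 + D 2 2) fun x y hxy => ?_)
    have := h (unitaryX x y hxy)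
    rw [blochBlock_unitaryX] at this
    simp [Matrix.trace_fin_three, Matrix.mul_apply, Fin.sum_univ_three] at this
    have e : x ^ 2 = 1 - y ^ 2 := by linarith
    rw [e] at this
    nlinarith
  have hy : D 0 2 - D 2 0 = 0 := by
    refine eq_zero_of_forall_mul_le (S := D 0 0 + D 2 2) fun x y hxy => ?_
    have := h (unitaryY x y hxy)
    rw [blochBlock_unitaryY] at this
    simp [Matrix.trace_fin_three, Matrix.mul_apply, Fin.sum_univ_three] at this
    have e : x ^ 2 = 1 - y ^ 2 := by linarith
    rw [e] at this
    nlinarith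
  have hz : D 0 1 - D 1 0 = 0 := by
    refine neg_eq_zero.1 (eq_zero_of_forall_mul_le (S := D 0 0 + D 1 1) fun x y hxy => ?_)
    have := h (unitaryZ x y hxy)
    rw [blochBlock_unitaryZ] at this
    simp [Matrix.trace_fin_three, Matrix.mul_apply, Fin.sum_univ_three] at this
    have e : x ^ 2 = 1 - y ^ 2 := by linarith
    rw [e] at this
    nlinarith
  ext i j
  fin_cases i <;> fin_cases j <;> simp <;> linarith

/-- Following `W` by a further unitary `V` gives the competitor `W * V`, so no rotation can increase
the trace of the corrected block. -/
theorem IsOptimalCorrection.transpose_eq {Λ : Superop 2} (h : IsPosTP Λ)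
    {W : unitaryGroup (Fin 2) ℂ} (hW : IsOptimalCorrection Λ W) :
    (blochBlock Λ * blochBlock (unitaryChannel W))ᵀ =
      blochBlock Λ * blochBlock (unitaryChannel W) := by
  refine transpose_eq_of_trace_mul_rotation_le fun V => ?_
  rw [Matrix.mul_assoc, ← blochBlock_unitaryChannel_mul]
  exact (isOptimalCorrection_iff h).1 hW (W * V)

theorem norm_orth_eq {O : Mat3} (hO : Oᵀ * O = 1) : ‖O‖ = √3 := by
  rw [← norm_one_mat, ← norm_orth_mul hO 1, Matrix.mul_one]

/-- Comparison with the trivial correction gives `tr (A O) ≥ tr A`. Replacing `A` by `1` costs a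
multiple of `‖A - 1‖` on each side, and `‖O - 1‖² = 6 - 2 tr O`. -/
theorem IsOptimalCorrection.norm_sub_one_sq_le {Λ : Superop 2} (h : IsPosTP Λ)
    {W : unitaryGroup (Fin 2) ℂ} (hW : IsOptimalCorrection Λ W) :
    ‖blochBlock (unitaryChannel W) - 1‖ ^ 2 ≤ 8 * ‖blochBlock Λ - 1‖ := by
  have h1 := (isOptimalCorrection_iff h).1 hW 1
  rw [unitaryChannel_one, blochBlock_one, Matrix.mul_one] at h1
  have hO := blochBlock_unitaryChannel_orth W
  set O := blochBlock (unitaryChannel W)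
  set A := blochBlock Λ
  have h18 := sqrt_three_bounds.2
  have h2 := abs_trace_le (A - 1)
  have h3 : |((A - 1) * O).trace| ≤ 9 / 5 * ‖A - 1‖ := by
    rw [← norm_mul_orth hO (A - 1)]
    exact abs_trace_le _
  have h4 : ‖O - 1‖ ^ 2 = 6 - 2 * O.trace := by
    rw [@norm_sub_sq_real, norm_orth_eq hO, norm_one_mat, real_inner_comm, inner_one_mat,
      Real.sq_sqrt (by norm_num)]
    ring
  rw [Matrix.sub_mul, Matrix.one_mul, Matrix.trace_sub] at h3
  rw [Matrix.trace_sub, Matrix.trace_one] at h2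
  simp only [Fintype.card_fin, Nat.cast_ofNat] at h2
  rw [h4]
  linarith [(abs_le.1 h2).1, (abs_le.1 h3).2, norm_nonneg (A - 1)]

theorem IsOptimalCorrection.norm_sub_one_le {Λ : Superop 2} (h : IsPosTP Λ)
    {W : unitaryGroup (Fin 2) ℂ} (hW : IsOptimalCorrection Λ W)
    (hΛ : ‖blochBlock Λ - 1‖ ≤ 1 / 1000) : ‖blochBlock (unitaryChannel W) - 1‖ ≤ 1 / 10 := by
  have h1 := hW.norm_sub_one_sq_le h
  refine le_of_sq_le_sq (h1.trans ?_) (by norm_num)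
  linarith

theorem IsOptimalCorrection.posDef {Λ : Superop 2} (h : IsPosTP Λ)
    {W : unitaryGroup (Fin 2) ℂ} (hW : IsOptimalCorrection Λ W)
    (hΛ : ‖blochBlock Λ - 1‖ ≤ 1 / 1000) :
    (blochBlock Λ * blochBlock (unitaryChannel W)).PosDef := by
  refine posDef_of_norm_sub_one_lt (hW.transpose_eq h) ?_
  have h1 := hW.norm_sub_one_le h hΛ
  have hO := blochBlock_unitaryChannel_orth W
  have h2 := norm_mul_orth hO (blochBlock Λ - 1)
  have h3 := norm_add_le ((blochBlock Λ - 1) * blochBlock (unitaryChannel W))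
    (blochBlock (unitaryChannel W) - 1)
  have e : (blochBlock Λ - 1) * blochBlock (unitaryChannel W) +
      (blochBlock (unitaryChannel W) - 1) = blochBlock Λ * blochBlock (unitaryChannel W) - 1 := by
    rw [Matrix.sub_mul, Matrix.one_mul]; abel
  rw [e] at h3
  linarith

theorem IsOptimalCorrection.unique {Λ : Superop 2} (h : IsPosTP Λ)
    {W W' : unitaryGroup (Fin 2) ℂ} (hW : IsOptimalCorrection Λ W)
    (hW' : IsOptimalCorrection Λ W') (hΛ : ‖blochBlock Λ - 1‖ ≤ 1 / 1000) :
    unitaryChannel W = unitaryChannel W' := by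
  have hO := blochBlock_unitaryChannel_orth W
  have hO' := blochBlock_unitaryChannel_orth W'
  have h1 := (isOptimalCorrection_iff h).1 hW' W
  refine unitaryChannel_eq_of_blochBlock_eq ?_
  set O := blochBlock (unitaryChannel W)
  set O' := blochBlock (unitaryChannel W')
  have hOt : O * Oᵀ = 1 := mul_eq_one_comm.1 hO
  have h2 : Oᵀ * O' = 1 := by
    refine eq_one_of_trace_le_trace_mul (hW.posDef h hΛ) ?_ ?_
    · rw [Matrix.transpose_mul, Matrix.transpose_transpose, Matrix.mul_assoc,
        ← Matrix.mul_assoc O, hOt, Matrix.one_mul, hO']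
    · rwa [Matrix.mul_assoc, ← Matrix.mul_assoc O, hOt, Matrix.one_mul]
  calc O = O * (Oᵀ * O') := by rw [h2, Matrix.mul_one]
    _ = O' := by rw [← Matrix.mul_assoc, hOt, Matrix.one_mul]

/-- Put `P = D V O`, which is positive definite. Then `tr P ≤ tr D = tr (P (V O)ᵀ)` because `D` is
positive semidefinite, and the equality case for `P` forces `V O = 1`. In particular `V` is a
rotation, although only orthogonality was assumed. -/
theorem IsOptimalCorrection.eq_transpose_of_polar {Λ : Superop 2} (h : IsPosTP Λ)
    {W : unitaryGroup (Fin 2) ℂ} (hW : IsOptimalCorrection Λ W)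
    (hΛ : ‖blochBlock Λ - 1‖ ≤ 1 / 1000) {D V : Mat3} (hD : D.PosSemidef) (hV : V * Vᵀ = 1)
    (hDV : blochBlock Λ = D * V) : blochBlock (unitaryChannel W) = Vᵀ := by
  have hO := blochBlock_unitaryChannel_orth W
  have hpd := hW.posDef h hΛ
  rw [hDV] at hpd
  set O := blochBlock (unitaryChannel W)
  have hOt : O * Oᵀ = 1 := mul_eq_one_comm.1 hO
  have hVt : Vᵀ * V = 1 := mul_eq_one_comm.1 hV
  have hQ : (V * O)ᵀ * (V * O) = 1 := by
    rw [Matrix.transpose_mul, Matrix.mul_assoc, ← Matrix.mul_assoc Vᵀ, hVt, Matrix.one_mul, hO]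
  have hQ' : (V * O)ᵀᵀ * (V * O)ᵀ = 1 := by
    rw [Matrix.transpose_transpose]; exact mul_eq_one_comm.1 hQ
  have h1 : (V * O)ᵀ = 1 := by
    refine eq_one_of_trace_le_trace_mul hpd hQ' ?_
    rw [Matrix.mul_assoc D, Matrix.mul_assoc D, mul_eq_one_comm.1 hQ, Matrix.mul_one]
    exact trace_mul_orth_le hD hQ
  have h2 : V * O = 1 := by rw [← Matrix.transpose_transpose (V * O), h1, Matrix.transpose_one]
  calc O = Vᵀ * (V * O) := by rw [← Matrix.mul_assoc, hVt, Matrix.one_mul]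
    _ = Vᵀ := by rw [h2, Matrix.mul_one]

/-! ### Coherence -/

theorem tracelessProj_pauli (k : Fin 4) :
    tracelessProj (pauli k) = if k = 0 then 0 else pauli k := by
  change pauli k - ((pauli k).trace / 2) • (1 : Matrix (Fin 2) (Fin 2) ℂ) = _
  rw [trace_pauli]
  split_ifs with hk
  · rw [hk, pauli_zero]; simp
  · simp

theorem liouville_tracelessProj :
    liouville tracelessProj = Matrix.diagonal (fun k => if k = 0 then (0 : ℝ) else 1) := by
  ext j k
  rw [liouville, Matrix.of_apply, tracelessProj_pauli, Matrix.diagonal_apply]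
  by_cases hk : k = 0
  · simp [hk]
  · rw [if_neg hk, trace_pauli_mul_pauli]
    by_cases hj : j = k
    · simp [hj, hk]
    · simp [hj]

theorem coherenceDefect_eq {Λ : Superop 2} (h : IsPosTP Λ) :
    coherenceDefect Λ = |(blochBlock Λ).trace / 3 - ‖blochBlock Λ‖ / √3| := by
  have h1 : hsInner (liouville tracelessProj) (liouville Λ) = (blochBlock Λ).trace := by
    rw [hsInner, liouville_tracelessProj, Matrix.diagonal_transpose, Matrix.trace]
    simp only [Matrix.diag_apply, Matrix.diagonal_mul]
    rw [Fin.sum_univ_succ]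
    simp [Matrix.trace, blochBlock]
  have h2 : frobNorm (liouville tracelessProj) = √3 := by
    rw [frobNorm, hsInner, liouville_tracelessProj, Matrix.diagonal_transpose,
      Matrix.diagonal_mul_diagonal, Matrix.trace_diagonal]
    congr 1
    simp [Fin.sum_univ_four]
    norm_num
  have h3 : frobNorm (liouville Λ * liouville tracelessProj) = ‖blochBlock Λ‖ := by
    have hM : ∀ j k, (liouville Λ * liouville tracelessProj) j k =
        if k = 0 then 0 else liouville Λ j k := fun j k => by
      rw [liouville_tracelessProj, Matrix.mul_diagonal]
      split_ifs <;> simp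
    rw [← Real.sqrt_sq (norm_nonneg (blochBlock Λ)), frobenius_norm_sq, frobNorm, hsInner]
    congr 1
    simp only [Matrix.trace, Matrix.diag_apply, Matrix.mul_apply (M := (_)ᵀ),
      Matrix.transpose_apply, hM]
    rw [Fin.sum_univ_succ]
    simp only [if_true, Fin.succ_ne_zero, if_false, mul_zero, Finset.sum_const_zero, zero_add]
    refine Finset.sum_congr rfl fun k _ => ?_
    rw [Fin.sum_univ_succ, h.liouville_zero, if_neg (Fin.succ_ne_zero k), mul_zero, zero_add]
    rfl
  rw [coherenceDefect, h1, h2, h3, Real.sq_sqrt (by norm_num)]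

theorem coherenceDefect_le {Λ : Superop 2} (h : IsPosTP Λ)
    (hsym : (blochBlock Λ)ᵀ = blochBlock Λ) (htr : 3 / 2 ≤ (blochBlock Λ).trace) :
    coherenceDefect Λ ≤ 12 * (1 - avgFidelity Λ 1) ^ 2 := by
  have hF : avgFidelity Λ 1 = 1 / 2 + 1 / 6 * (blochBlock Λ).trace := by
    have := avgFidelity_mul_unitaryChannel_one h 1
    rwa [unitaryChannel_one, mul_one, blochBlock_one, Matrix.mul_one] at this
  rw [coherenceDefect_eq h, hF]
  have h1 := norm_symPart_one_sub_le h.norm_blochBlock_mul_le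
  set D := blochBlock Λ
  have hs : symPart (1 - D) = 1 - D := by
    rw [symPart_apply, Matrix.transpose_sub, hsym, Matrix.transpose_one]; module
  rw [hs, Matrix.trace_sub, Matrix.trace_one] at h1
  simp only [Fintype.card_fin, Nat.cast_ofNat] at h1
  have h2 : ‖1 - D‖ ^ 2 = 3 - 2 * D.trace + ‖D‖ ^ 2 := by
    rw [@norm_sub_sq_real, norm_one_mat, inner_one_mat, Real.sq_sqrt (by norm_num)]
  have h3 : ‖1 - D‖ ^ 2 ≤ (3 - D.trace) ^ 2 := by gcongr
  have h4 : |D.trace| ≤ √3 * ‖D‖ := by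
    rw [← inner_one_mat, ← norm_one_mat]
    exact abs_real_inner_le_norm _ _
  have hpos : 0 < √(3 : ℝ) := by positivity
  have hsq : √3 * √3 = (3 : ℝ) := Real.mul_self_sqrt (by norm_num)
  set s := ‖D‖ / √3 with hsdef
  have hDs : ‖D‖ = √3 * s := by rw [hsdef]; field_simp
  have hD2 : ‖D‖ ^ 2 = 3 * s ^ 2 := by rw [hDs, mul_pow, sq √3, hsq]
  rw [hDs, ← mul_assoc, hsq] at h4
  have h5 := (abs_le.1 h4).2
  rw [abs_sub_comm, abs_of_nonneg (by linarith)]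
  set t := D.trace / 3 with ht
  have hDt : D.trace = 3 * t := by rw [ht]; ring
  rw [hDt] at h2 h3 h5 htr ⊢
  rw [h2, hD2] at h3
  -- The bound on `‖1 - D‖²` reads `s² - t² ≤ 2 (1 - t)²`. Since `s ≥ t ≥ 1/2`, dividing by `s + t ≥
  -- 1` gives `s - t ≤ 2 (1 - t)²`, and `1 - t` is twice the infidelity.
  nlinarith

/-! ### Circuits -/

section circuits

variable {ι : Type*} {U : ι → unitaryGroup (Fin 2) ℂ} {N : ι → Superop 2}

theorem isPosTP_circuit (hN : ∀ i, IsPosTP (N i)) (m : ℕ) (s : Fin m → ι) :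
    IsPosTP (circuit N m s) := by
  induction m with
  | zero => exact IsPosTP.one
  | succ m ih => exact (hN _).mul (ih _)

theorem circuit_unitaryChannel (m : ℕ) (s : Fin m → ι) :
    circuit (fun i => unitaryChannel (U i)) m s = unitaryChannel (circuit U m s) := by
  induction m with
  | zero => exact unitaryChannel_one.symm
  | succ m ih => rw [circuit, circuit, ih, unitaryChannel_mul]

variable [Fintype ι]

theorem expect_snoc {M : Type*} [AddCommGroup M] [Module ℚ≥0 M] (m : ℕ)
    (f : ι → (Fin m → ι) → M) :
    𝔼 s : Fin (m + 1) → ι, f (s (Fin.last m)) (Fin.init s) = 𝔼 s, 𝔼 i, f i s := by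
  rw [Finset.expect_comm, ← Finset.expect_product']
  refine Finset.expect_equiv (Fin.snocEquiv fun _ => ι).symm (by simp) fun s _ => rfl

/-- The last gates of the two circuits stand next to `X`. Averaging over their common label replaces
`X` by its twirl and leaves shorter circuits, so the induction needs arbitrary `X`. -/
theorem expect_circuit (hN : ∀ i, IsPosTP (N i)) (m : ℕ) (X : Mat3) :
    𝔼 s : Fin m → ι, (blochBlock (unitaryChannel (circuit U m s)))ᵀ * X *
      blochBlock (circuit N m s) =
    (noisyTwirl (fun i => blochBlock (unitaryChannel (U i))) (fun i => blochBlock (N i)) ^ m)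
      X := by
  induction m generalizing X with
  | zero =>
    simp only [circuit, unitaryChannel_one, blochBlock_one, Matrix.transpose_one, Matrix.one_mul,
      Matrix.mul_one, pow_zero, Module.End.one_apply]
    exact Fintype.expect_const X
  | succ m ih =>
    rw [pow_succ, Module.End.mul_apply, ← ih]
    simp only [circuit]
    rw [expect_snoc m fun i s => (blochBlock (unitaryChannel (U i * circuit U m s)))ᵀ * X *
      blochBlock (N i * circuit N m s)]
    refine Finset.expect_congr rfl fun s _ => ?_
    rw [noisyTwirl_apply, Finset.mul_expect, Finset.expect_mul]
    refine Finset.expect_congr rfl fun i _ => ?_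
    rw [blochBlock_unitaryChannel_mul, (isPosTP_circuit hN m s).blochBlock_mul,
      Matrix.transpose_mul]
    simp only [Matrix.mul_assoc]

theorem isPosTP_rightError [Nonempty ι] (hN : ∀ i, IsPosTP (N i)) (m : ℕ) :
    IsPosTP (rightError U N m) :=
  IsPosTP.expect fun s => (isPosTP_unitaryChannel _).mul (isPosTP_circuit hN m s)

theorem blochBlock_rightError (hN : ∀ i, IsPosTP (N i)) (m : ℕ) :
    blochBlock (rightError U N m) =
    (noisyTwirl (fun i => blochBlock (unitaryChannel (U i))) (fun i => blochBlock (N i)) ^ m)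
      1 := by
  rw [rightError, blochBlock_expect, ← expect_circuit hN]
  refine Finset.expect_congr rfl fun s _ => ?_
  rw [(isPosTP_circuit hN m s).blochBlock_mul, blochBlock_unitaryChannel_star, Matrix.mul_one]

theorem gateSetFidelity_eq [Nonempty ι] (hN : ∀ i, IsPosTP (N i)) (m : ℕ) :
    gateSetFidelity N (fun i => unitaryChannel (U i)) m = 1 / 2 + 1 / 6 *
    ((noisyTwirl (fun i => blochBlock (unitaryChannel (U i))) (fun i => blochBlock (N i)) ^ m)
      1).trace := by
  rw [gateSetFidelity, ← expect_circuit hN, trace_expect, Finset.mul_expect]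
  nth_rewrite 1 [← Fintype.expect_const (ι := Fin m → ι) (1 / 2 : ℝ)]
  rw [← Finset.expect_add_distrib]
  refine Finset.expect_congr rfl fun s _ => ?_
  rw [circuit_unitaryChannel, avgFidelity_eq (isPosTP_circuit hN m s) (isPosTP_unitaryChannel _),
    Matrix.mul_one]
  intro j
  rw [liouville_unitaryChannel_col_zero, if_neg (Fin.succ_ne_zero j)]

end circuits

/-! ### Change of gauge -/

section gauge

variable {ι : Type*} [Fintype ι] {R B : ι → Mat3} {O : Mat3}

theorem isNoisyDesign_blochBlock {U : ι → unitaryGroup (Fin 2) ℂ} {N : ι → Superop 2}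
    (hU : IsUnitaryTwoDesign U) (hN : ∀ i, IsPosTP (N i)) :
    IsNoisyDesign (fun i => blochBlock (unitaryChannel (U i))) (fun i => blochBlock (N i)) where
  orth i := blochBlock_unitaryChannel_orth (U i)
  contract_left i X := (hN i).norm_blochBlock_mul_le X
  contract_right i X := norm_mul_le_of_norm_mul_le (hN i).norm_blochBlock_mul_le X
  design := hU.expect_transpose_mul_mul
  design_transpose := hU.expect_mul_mul_transpose

theorem noisyTwirl_conj (X : Mat3) :
    noisyTwirl (fun i => O * R i * Oᵀ) B X = O * noisyTwirl R B (Oᵀ * X) := by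
  rw [noisyTwirl_apply, noisyTwirl_apply, Finset.mul_expect]
  refine Finset.expect_congr rfl fun i _ => ?_
  rw [Matrix.transpose_mul, Matrix.transpose_mul, Matrix.transpose_transpose]
  simp only [Matrix.mul_assoc]

theorem noisyTwirl_conj_pow (hO : Oᵀ * O = 1) (m : ℕ) (X : Mat3) :
    (noisyTwirl (fun i => O * R i * Oᵀ) B ^ m) X = O * (noisyTwirl R B ^ m) (Oᵀ * X) := by
  induction m with
  | zero => simp [← Matrix.mul_assoc, mul_eq_one_comm.1 hO]
  | succ m ih =>
    rw [pow_succ', pow_succ', Module.End.mul_apply, Module.End.mul_apply, ih, noisyTwirl_conj,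
      ← Matrix.mul_assoc, hO, Matrix.one_mul]

theorem IsNoisyDesign.conj (h : IsNoisyDesign R B) (hO : Oᵀ * O = 1) :
    IsNoisyDesign (fun i => O * R i * Oᵀ) B where
  orth i := by
    have hO' := mul_eq_one_comm.1 hO
    calc (O * R i * Oᵀ)ᵀ * (O * R i * Oᵀ) = O * ((R i)ᵀ * ((Oᵀ * O) * R i)) * Oᵀ := by
          simp only [Matrix.transpose_mul, Matrix.transpose_transpose, Matrix.mul_assoc]
      _ = 1 := by rw [hO, Matrix.one_mul, h.orth, Matrix.mul_one, hO']
  contract_left := h.contract_left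
  contract_right := h.contract_right
  design X := by
    have hO' := mul_eq_one_comm.1 hO
    have e : ∀ i, (O * R i * Oᵀ)ᵀ * X * (O * R i * Oᵀ) =
        O * ((R i)ᵀ * (Oᵀ * X * O) * R i) * Oᵀ := fun i => by
      simp only [Matrix.transpose_mul, Matrix.transpose_transpose, Matrix.mul_assoc]
    simp only [e]
    rw [← Finset.expect_mul, ← Finset.mul_expect, h.design, Matrix.trace_mul_comm,
      ← Matrix.mul_assoc, hO', Matrix.one_mul, Matrix.mul_smul, Matrix.smul_mul, Matrix.mul_one,
      hO']
  design_transpose X := by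
    have hO' := mul_eq_one_comm.1 hO
    have e : ∀ i, (O * R i * Oᵀ) * X * (O * R i * Oᵀ)ᵀ =
        O * (R i * (Oᵀ * X * O) * (R i)ᵀ) * Oᵀ := fun i => by
      simp only [Matrix.transpose_mul, Matrix.transpose_transpose, Matrix.mul_assoc]
    simp only [e]
    rw [← Finset.expect_mul, ← Finset.mul_expect, h.design_transpose, Matrix.trace_mul_comm,
      ← Matrix.mul_assoc, hO', Matrix.one_mul, Matrix.mul_smul, Matrix.smul_mul, Matrix.mul_one,
      hO']

/-- The defect is `3 - tr (L 1)`, and in the new gauge `L 1` becomes `O L(Oᵀ)`. As `L` is norm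
nonincreasing, the difference is of order `‖O - 1‖`. -/
theorem IsNoisyDesign.twirlDefect_conj_le [Nonempty ι] (h : IsNoisyDesign R B)
    (hO : Oᵀ * O = 1) :
    twirlDefect (fun i => O * R i * Oᵀ) B ≤ twirlDefect R B + 6 * ‖O - 1‖ := by
  have h1 := trace_noisyTwirl_one (R := R) (B := B)
  have h2 := trace_noisyTwirl_one (R := fun i => O * R i * Oᵀ) (B := B)
  rw [noisyTwirl_conj, Matrix.mul_one] at h2
  have h3 : noisyTwirl R B 1 - O * noisyTwirl R B Oᵀ =
      - ((O - 1) * noisyTwirl R B Oᵀ + noisyTwirl R B (Oᵀ - 1)) := by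
    rw [map_sub, Matrix.sub_mul, Matrix.one_mul]; abel
  have h4 := abs_trace_le (noisyTwirl R B 1 - O * noisyTwirl R B Oᵀ)
  have h5 : ‖Oᵀ - 1‖ = ‖O - 1‖ := by
    rw [← norm_transpose_mat, Matrix.transpose_sub, Matrix.transpose_transpose,
      Matrix.transpose_one]
  have h6 : ‖noisyTwirl R B Oᵀ‖ ≤ √3 := by
    refine (h.norm_noisyTwirl_le _).trans ?_
    rw [norm_transpose_mat, norm_orth_eq hO]
  have h7 := frobenius_norm_mul (O - 1) (noisyTwirl R B Oᵀ)
  have h8 := h.norm_noisyTwirl_le (Oᵀ - 1)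
  have h9 := norm_add_le ((O - 1) * noisyTwirl R B Oᵀ) (noisyTwirl R B (Oᵀ - 1))
  have h10 := mul_le_mul_of_nonneg_left (h6.trans sqrt_three_bounds.2) (norm_nonneg (O - 1))
  rw [Matrix.trace_sub, h3, norm_neg] at h4
  have h11 := (le_abs_self _).trans h4
  have h12 := norm_nonneg (O - 1)
  rw [h5] at h8
  linarith

theorem IsNoisyDesign.norm_one_sub_noisyTwirl_pow_one_le [Nonempty ι] (h : IsNoisyDesign R B)
    (m : ℕ) : ‖1 - (noisyTwirl R B ^ m) 1‖ ≤ m * (2 * √(2 * twirlDefect R B)) := by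
  induction m with
  | zero => simp
  | succ m ih =>
    have e : 1 - (noisyTwirl R B ^ (m + 1)) 1 =
        (1 - noisyTwirl R B 1) + noisyTwirl R B (1 - (noisyTwirl R B ^ m) 1) := by
      rw [pow_succ', Module.End.mul_apply, map_sub]; abel
    rw [e]
    refine (norm_add_le _ _).trans ?_
    have h1 := h.norm_one_sub_noisyTwirl_one_le
    have h2 := (h.norm_noisyTwirl_le (1 - (noisyTwirl R B ^ m) 1)).trans ih
    push_cast
    linarith

end gauge

/-! ### The spectrum of the twirl -/

section spectrum

variable {ι : Type*} [Fintype ι] {R B : ι → Mat3}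

/-- Away from the dominant eigenvector, eigenvalues are small. The complex eigenvector
`Z + i Z'` with eigenvalue `r + i s` is written out in real and imaginary parts. -/
theorem DominantPair.normSq_eigenvalue_le [Nonempty ι] {p : ℝ} {X Y : Mat3}
    (hd : DominantPair R B p X Y) (h : IsNoisyDesign R B)
    (hp : 8 * √(2 * twirlDefect R B) ≤ p) {r s : ℝ} {Z Z' : Mat3} (hZ : Z ≠ 0 ∨ Z' ≠ 0)
    (h1 : noisyTwirl R B Z = r • Z - s • Z') (h2 : noisyTwirl R B Z' = s • Z + r • Z') :
    r ^ 2 + s ^ 2 ≤ p ^ 2 := by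
  have e1 := inner_noisyTwirl (R := R) (B := B) Z Y
  have e2 := inner_noisyTwirl (R := R) (B := B) Z' Y
  rw [hd.left, real_inner_smul_left, h1, inner_sub_right, real_inner_smul_right,
    real_inner_smul_right] at e1
  rw [hd.left, real_inner_smul_left, h2, inner_add_right, real_inner_smul_right,
    real_inner_smul_right] at e2
  by_cases h0 : inner ℝ Y Z = 0 ∧ inner ℝ Y Z' = 0
  · have n1 := hd.norm_noisyTwirl_le h h0.1
    have n2 := hd.norm_noisyTwirl_le h h0.2
    have n1' := pow_le_pow_left₀ (norm_nonneg _)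
      (n1.trans (mul_le_mul_of_nonneg_right hp (norm_nonneg _))) 2
    have n2' := pow_le_pow_left₀ (norm_nonneg _)
      (n2.trans (mul_le_mul_of_nonneg_right hp (norm_nonneg _))) 2
    have e : ‖noisyTwirl R B Z‖ ^ 2 + ‖noisyTwirl R B Z'‖ ^ 2 =
        (r ^ 2 + s ^ 2) * (‖Z‖ ^ 2 + ‖Z'‖ ^ 2) := by
      rw [h1, h2, @norm_sub_sq_real, @norm_add_sq_real, norm_smul, norm_smul, norm_smul,
        norm_smul, real_inner_smul_left, real_inner_smul_right, real_inner_smul_left,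
        real_inner_smul_right]
      simp only [mul_pow, Real.norm_eq_abs, sq_abs]
      ring
    have hpos : 0 < ‖Z‖ ^ 2 + ‖Z'‖ ^ 2 := by
      rcases hZ with hZ | hZ
      · have := norm_pos_iff.2 hZ
        positivity
      · have := norm_pos_iff.2 hZ
        positivity
    refine le_of_mul_le_mul_right ?_ hpos
    rw [← e]
    nlinarith
  · set a := inner ℝ Y Z
    set b := inner ℝ Y Z'
    have hpos : 0 < a ^ 2 + b ^ 2 := by
      -- If `Y` does not annihilate the complex eigenvector, pairing the eigenvalue equation with
      -- `Y` forces `r + i s = p`.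
      rcases not_and_or.1 h0 with h0 | h0
      · positivity
      · positivity
    have e3 : ((p - r) ^ 2 + s ^ 2) * (a ^ 2 + b ^ 2) = 0 := by
      have f1 : (p - r) * a + s * b = 0 := by linarith
      have f2 : (p - r) * b - s * a = 0 := by linarith
      have : ((p - r) ^ 2 + s ^ 2) * (a ^ 2 + b ^ 2) =
        ((p - r) * a + s * b) ^ 2 + ((p - r) * b - s * a) ^ 2 := by ring
      rw [this, f1, f2]; ring
    have e4 := (mul_eq_zero.1 e3).resolve_right hpos.ne'
    have hs : s = 0 := by nlinarith [sq_nonneg (p - r), sq_nonneg s]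
    have hr : p - r = 0 := by nlinarith [sq_nonneg (p - r), sq_nonneg s]
    rw [hs, ← sub_eq_zero.1 hr]
    simp

/-- The dominant eigenvalue does not depend on the gauge. -/
theorem DominantPair.eq_of_conj [Nonempty ι] {p p' : ℝ} {X Y X' Y' O : Mat3}
    (hd : DominantPair R B p X Y) (h : IsNoisyDesign R B) (hO : Oᵀ * O = 1)
    (hd' : DominantPair (fun i => O * R i * Oᵀ) B p' X' Y')
    (hp : 8 * √(2 * twirlDefect R B) < p') : p' = p := by
  have e : noisyTwirl R B (Oᵀ * X') = p' • (Oᵀ * X') := by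
    have := congrArg (Oᵀ * ·) hd'.right
    simp only [noisyTwirl_conj, Matrix.mul_smul] at this
    rwa [← Matrix.mul_assoc, hO, Matrix.one_mul] at this
  have hX : Oᵀ * X' ≠ 0 := fun h0 => by
    have := congrArg (O * ·) h0
    simp only [← Matrix.mul_assoc, mul_eq_one_comm.1 hO, Matrix.one_mul, Matrix.mul_zero] at this
    have ht := hd'.trace_right
    simp [this] at ht
  have e1 := inner_noisyTwirl (R := R) (B := B) (Oᵀ * X') Y
  rw [hd.left, real_inner_smul_left, e, real_inner_smul_right] at e1
  by_contra hne
  have h0 : inner ℝ Y (Oᵀ * X') = 0 := by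
    have : (p' - p) * inner ℝ Y (Oᵀ * X') = 0 := by linarith
    exact (mul_eq_zero.1 this).resolve_left (sub_ne_zero.2 hne)
  have h1 := hd.norm_noisyTwirl_le h h0
  rw [e, norm_smul] at h1
  have h2 := le_of_mul_le_mul_right h1 (norm_pos_iff.2 hX)
  exact absurd ((Real.le_norm_self p').trans h2) (not_le.2 hp)

variable {U : ι → unitaryGroup (Fin 2) ℂ} {N : ι → Superop 2}

theorem liouville_unitaryChannel_mul_tracelessProj (u : unitaryGroup (Fin 2) ℂ) (j k : Fin 4) :
    liouville (unitaryChannel u * tracelessProj) j k =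
      if k = 0 then 0 else liouville (unitaryChannel u) j k := by
  rw [liouville, Matrix.of_apply, Module.End.mul_apply, tracelessProj_pauli]
  split_ifs <;> simp [liouville]

theorem twirl_apply (a b : Fin 4 × Fin 4) : twirl U N a b =
    𝔼 i, (if b.1 = 0 then 0 else liouville (unitaryChannel (U i)) a.1 b.1) *
      liouville (N i) a.2 b.2 := by
  rw [twirl, expect_matrix_apply]
  refine Finset.expect_congr rfl fun i _ => ?_
  rw [← liouville_unitaryChannel_mul_tracelessProj]
  rfl

theorem twirl_zero_apply (j : Fin 4) (b : Fin 4 × Fin 4) : twirl U N (0, j) b = 0 := by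
  rw [twirl_apply]
  refine Finset.expect_eq_zero fun i _ => ?_
  rw [(isPosTP_unitaryChannel (U i)).liouville_zero]
  split_ifs <;> simp

/-- Trace preservation makes the noisy factor in this row independent of the gate, so only the mean
of the ideal Bloch block remains, and it vanishes for a 2-design. -/
theorem twirl_succ_zero_apply (hU : IsUnitaryTwoDesign U) (hN : ∀ i, IsPosTP (N i)) (j : Fin 3)
    (b : Fin 4 × Fin 4) : twirl U N (j.succ, 0) b = 0 := by
  rw [twirl_apply]
  simp only [(hN _).liouville_zero]
  rw [← Finset.expect_mul]
  obtain ⟨b, b'⟩ := b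
  refine Fin.cases ?_ (fun k => ?_) b
  · simp
  · simp only [Fin.succ_ne_zero, if_false]
    rw [show 𝔼 i, liouville (unitaryChannel (U i)) j.succ k.succ = 0 from
      hU.expect_blochBlock j k, zero_mul]

theorem twirl_mulVec_succ {x : Fin 4 × Fin 4 → ℝ} (hx : ∀ k : Fin 3, x (k.succ, 0) = 0)
    (j j' : Fin 3) : (twirl U N *ᵥ x) (j.succ, j'.succ) =
      noisyTwirl (fun i => (blochBlock (unitaryChannel (U i)))ᵀ) (fun i => (blochBlock (N i))ᵀ)
        (Matrix.of fun k k' => x (k.succ, k'.succ)) j j' := by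
  rw [noisyTwirl_apply, expect_matrix_apply, Matrix.mulVec, dotProduct, Fintype.sum_prod_type,
    Fin.sum_univ_succ]
  simp only [twirl_apply, if_true, zero_mul, Finset.expect_const_zero, Finset.sum_const_zero,
    zero_add, Fin.succ_ne_zero, if_false]
  simp only [Fin.sum_univ_succ (n := 3), hx, mul_zero, zero_add]
  simp only [Finset.expect_mul, ← Finset.expect_sum_comm]
  refine Finset.expect_congr rfl fun i _ => ?_
  rw [Matrix.transpose_transpose, Matrix.mul_apply]
  simp only [Matrix.mul_apply, Finset.sum_mul]
  rw [Finset.sum_comm]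
  refine Finset.sum_congr rfl fun k _ => Finset.sum_congr rfl fun k' _ => ?_
  simp only [blochBlock, Matrix.submatrix_apply, Matrix.of_apply, Matrix.transpose_apply]
  ring

theorem mem_spectrum_iff_exists_mulVec {n : Type*} [Fintype n] [DecidableEq n]
    (A : Matrix n n ℂ) (μ : ℂ) : μ ∈ spectrum ℂ A ↔ ∃ v : n → ℂ, v ≠ 0 ∧ A *ᵥ v = μ • v := by
  rw [← Matrix.spectrum_toLin', ← Module.End.hasEigenvalue_iff_mem_spectrum]
  constructor
  · intro h
    obtain ⟨v, hv⟩ := h.exists_hasEigenvector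
    exact ⟨v, hv.2, by simpa using hv.apply_eq_smul⟩
  · rintro ⟨v, hv, h⟩
    exact Module.End.hasEigenvalue_of_hasEigenvector
      (Module.End.hasEigenvector_iff.2 ⟨Module.End.mem_eigenspace_iff.2 (by simpa using h), hv⟩)

theorem map_ofReal_mulVec_re {n : Type*} [Fintype n] (A : Matrix n n ℝ) (v : n → ℂ) (a : n) :
    ((A.map (fun x : ℝ => (x : ℂ)) *ᵥ v) a).re = (A *ᵥ fun b => (v b).re) a := by
  simp [Matrix.mulVec, dotProduct]

theorem map_ofReal_mulVec_im {n : Type*} [Fintype n] (A : Matrix n n ℝ) (v : n → ℂ) (a : n) :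
    ((A.map (fun x : ℝ => (x : ℂ)) *ᵥ v) a).im = (A *ᵥ fun b => (v b).im) a := by
  simp [Matrix.mulVec, dotProduct]

/-- The rows with a zero index vanish, so eigenvectors with nonzero eigenvalue live on the `3 × 3`
block of indices. There the superchannel is the transposed noisy twirl, so the eigenvector for `p`
is the left eigenvector `Y`. -/
theorem isHighestEigenvalue_twirl [Nonempty ι] (hU : IsUnitaryTwoDesign U)
    (hN : ∀ i, IsPosTP (N i)) {p : ℝ} {X Y : Mat3}
    (hd : DominantPair (fun i => blochBlock (unitaryChannel (U i))) (fun i => blochBlock (N i))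
      p X Y)
    (hp : 8 * √(2 * twirlDefect (fun i => blochBlock (unitaryChannel (U i)))
      (fun i => blochBlock (N i))) ≤ p) :
    IsHighestEigenvalue (twirl U N) p := by
  have hp0 : 0 ≤ p := le_trans (by positivity) hp
  constructor
  · rw [mem_spectrum_iff_exists_mulVec]
    let y : Fin 4 × Fin 4 → ℝ := fun a =>
      Fin.cases 0 (fun j => Fin.cases 0 (fun k => Y j k) a.2) a.1
    have hy : twirl U N *ᵥ y = p • y := by
      ext ⟨a, b⟩
      refine Fin.cases ?_ (fun j => ?_) a
      · simp [Matrix.mulVec, dotProduct, twirl_zero_apply, y]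
      · refine Fin.cases ?_ (fun k => ?_) b
        · simp [Matrix.mulVec, dotProduct, twirl_succ_zero_apply hU hN, y]
        · rw [twirl_mulVec_succ (fun _ => rfl)]
          exact congrFun (congrFun hd.left j) k
    refine ⟨fun a => (y a : ℂ), fun h0 => ?_, ?_⟩
    · have : Y = 0 := by
        ext j k
        exact Complex.ofReal_eq_zero.1 (congrFun h0 (j.succ, k.succ))
      have ht := hd.trace_left
      simp [this] at ht
    · ext a
      have := congrFun hy a
      apply Complex.ext
      · rw [map_ofReal_mulVec_re]
        simpa using this
      · rw [map_ofReal_mulVec_im]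
        simp [Matrix.mulVec, dotProduct]
  · intro μ hμ
    obtain ⟨v, hv, h⟩ := (mem_spectrum_iff_exists_mulVec _ _).1 hμ
    by_cases hμ0 : μ = 0
    · simpa [hμ0] using hp0
    have hre : ∀ a, (twirl U N *ᵥ fun b => (v b).re) a = μ.re * (v a).re - μ.im * (v a).im :=
      fun a => by rw [← map_ofReal_mulVec_re, h]; simp
    have him : ∀ a, (twirl U N *ᵥ fun b => (v b).im) a = μ.im * (v a).re + μ.re * (v a).im :=
      fun a => by rw [← map_ofReal_mulVec_im, h]; simp; ring
    have hzero : ∀ a, (∀ b, twirl U N a b = 0) → v a = 0 := fun a ha => by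
      have := congrFun h a
      simp only [Matrix.mulVec, dotProduct, Matrix.map_apply, ha, Complex.ofReal_zero, zero_mul,
        Finset.sum_const_zero, Pi.smul_apply, smul_eq_mul] at this
      exact (mul_eq_zero.1 this.symm).resolve_left hμ0
    have hv0 : ∀ j, v (0, j) = 0 := fun j => hzero _ (twirl_zero_apply j)
    have hv1 : ∀ j : Fin 3, v (j.succ, 0) = 0 :=
      fun j => hzero _ (twirl_succ_zero_apply hU hN j)
    have hL1 : noisyTwirl (fun i => (blochBlock (unitaryChannel (U i)))ᵀ)
        (fun i => (blochBlock (N i))ᵀ) (Matrix.of fun k k' => (v (k.succ, k'.succ)).re) =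
        μ.re • (Matrix.of fun k k' => (v (k.succ, k'.succ)).re) -
          μ.im • (Matrix.of fun k k' => (v (k.succ, k'.succ)).im) := by
      ext j k
      rw [← twirl_mulVec_succ (x := fun b => (v b).re) (fun k => by simp [hv1]), hre]
      rfl
    have hL2 : noisyTwirl (fun i => (blochBlock (unitaryChannel (U i)))ᵀ)
        (fun i => (blochBlock (N i))ᵀ) (Matrix.of fun k k' => (v (k.succ, k'.succ)).im) =
        μ.im • (Matrix.of fun k k' => (v (k.succ, k'.succ)).re) +
          μ.re • (Matrix.of fun k k' => (v (k.succ, k'.succ)).im) := by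
      ext j k
      rw [← twirl_mulVec_succ (x := fun b => (v b).im) (fun k => by simp [hv1]), him]
      rfl
    have hne : (Matrix.of fun k k' : Fin 3 => (v (k.succ, k'.succ)).re) ≠ 0 ∨
        (Matrix.of fun k k' : Fin 3 => (v (k.succ, k'.succ)).im) ≠ 0 := by
      by_contra! hcon
      refine hv (funext fun ⟨a, b⟩ => ?_)
      refine Fin.cases (hv0 b) (fun j => ?_) a
      refine Fin.cases (hv1 j) (fun k => ?_) b
      exact Complex.ext (congrFun (congrFun hcon.1 j) k) (congrFun (congrFun hcon.2 j) k)
    have := hd.transpose.normSq_eigenvalue_le (isNoisyDesign_blochBlock hU hN).transpose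
      (by rwa [twirlDefect_transpose]) hne hL1 hL2
    refine le_of_sq_le_sq ?_ hp0
    rw [← Complex.normSq_eq_norm_sq, Complex.normSq_apply]
    nlinarith

end spectrum

/-! ### The decay of the circuit fidelity -/

section main

variable {ι : Type*} [Fintype ι] [Nonempty ι] {U : ι → unitaryGroup (Fin 2) ℂ}
  {N : ι → Superop 2}

theorem twirlDefect_eq (hN : ∀ i, IsPosTP (N i)) :
    twirlDefect (fun i => blochBlock (unitaryChannel (U i))) (fun i => blochBlock (N i)) =
      6 * (1 - gateSetFidelity N (fun i => unitaryChannel (U i)) 1) := by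
  rw [gateSetFidelity_eq hN, pow_one, trace_noisyTwirl_one]
  ring

theorem sqrt_two_mul_twirlDefect_le (hN : ∀ i, IsPosTP (N i))
    (hF : 1 - 1 / 10 ^ 40 ≤ gateSetFidelity N (fun i => unitaryChannel (U i)) 1) :
    √(2 * twirlDefect (fun i => blochBlock (unitaryChannel (U i))) (fun i => blochBlock (N i))) ≤
      1 / 10 ^ 19 := by
  rw [twirlDefect_eq hN]
  refine Real.sqrt_le_iff.2 ⟨by norm_num, ?_⟩
  norm_num at hF ⊢
  linarith

theorem norm_blochBlock_rightError_sub_one_le (hU : IsUnitaryTwoDesign U)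
    (hN : ∀ i, IsPosTP (N i))
    (hF : 1 - 1 / 10 ^ 40 ≤ gateSetFidelity N (fun i => unitaryChannel (U i)) 1) :
    ‖blochBlock (rightError U N 4) - 1‖ ≤ 8 / 10 ^ 19 := by
  have h1 := (isNoisyDesign_blochBlock hU hN).norm_one_sub_noisyTwirl_pow_one_le 4
  have h2 := sqrt_two_mul_twirlDefect_le hN hF
  rw [blochBlock_rightError hN, norm_sub_rev]
  refine h1.trans ?_
  push_cast
  linarith

theorem abs_gateSetFidelity_sub_le (hU : IsUnitaryTwoDesign U) (hN : ∀ i, IsPosTP (N i))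
    (hF : 1 - 1 / 10 ^ 40 ≤ gateSetFidelity N (fun i => unitaryChannel (U i)) 1)
    {p : ℝ} {X Y : Mat3}
    (hd : DominantPair (fun i => blochBlock (unitaryChannel (U i))) (fun i => blochBlock (N i))
      p X Y) {W : unitaryGroup (Fin 2) ℂ} (hW : IsOptimalCorrection (rightError U N 4) W)
    (m : ℕ) :
    |gateSetFidelity N (fun i => unitaryChannel (W * U i * star W)) m -
      (1 / 2 + 1 / 2 * p ^ m)| ≤ 10 ^ 9 * (1 - p) ^ 2 := by
  have h := isNoisyDesign_blochBlock hU hN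
  have hA := norm_blochBlock_rightError_sub_one_le hU hN hF
  have hE : IsPosTP (rightError U N 4) := isPosTP_rightError hN 4
  have hO := blochBlock_unitaryChannel_orth W
  have hη := sqrt_two_mul_twirlDefect_le hN hF
  -- The rotation is controlled only through the square root of `‖A - 1‖`, itself `O(√κ)`, so `‖O -
  -- 1‖` is of order `κ^(1/4)`. The threshold `1 / 10 ^ 40` is small enough to keep the new defect
  -- below `1 / 10 ^ 7`.
  have hO1 : ‖blochBlock (unitaryChannel W) - 1‖ ≤ 3 / 10 ^ 9 := by
    refine le_of_sq_le_sq ((hW.norm_sub_one_sq_le hE).trans ?_) (by norm_num)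
    norm_num at hA ⊢
    linarith
  have hsymA := hW.transpose_eq hE
  have hgauge : (fun i => blochBlock (unitaryChannel (W * U i * star W))) = fun i =>
      blochBlock (unitaryChannel W) * blochBlock (unitaryChannel (U i)) *
        (blochBlock (unitaryChannel W))ᵀ := by
    funext i
    rw [blochBlock_unitaryChannel_mul, blochBlock_unitaryChannel_mul,
      blochBlock_unitaryChannel_star]
  have hAeq := blochBlock_rightError (U := U) hN 4
  rw [gateSetFidelity_eq (U := fun i => W * U i * star W) hN, hgauge]
  set O := blochBlock (unitaryChannel W)
  have hO' := mul_eq_one_comm.1 hO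
  have h' := h.conj hO
  have hκ : twirlDefect (fun i => O * blochBlock (unitaryChannel (U i)) * Oᵀ)
      (fun i => blochBlock (N i)) ≤ 1 / 10 ^ 7 := by
    refine (h.twirlDefect_conj_le hO).trans ?_
    rw [twirlDefect_eq hN]
    norm_num at hF hO1 ⊢
    linarith
  obtain ⟨p', X', Y', hd'⟩ := h'.exists_dominantPair
    (Real.sqrt_le_iff.2 ⟨by norm_num, by norm_num at hκ ⊢; linarith⟩)
  have hp' := (abs_le.1 hd'.eigenvalue).1
  obtain rfl : p' = p := hd.eq_of_conj h hO hd' (by norm_num at hη hκ ⊢; linarith)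
  have hsym : ((noisyTwirl (fun i => O * blochBlock (unitaryChannel (U i)) * Oᵀ)
      (fun i => blochBlock (N i)) ^ 4) O)ᵀ =
      (noisyTwirl (fun i => O * blochBlock (unitaryChannel (U i)) * Oᵀ)
      (fun i => blochBlock (N i)) ^ 4) O := by
    rw [noisyTwirl_conj_pow hO, hO, ← hAeq]
    -- In the new gauge the fourth iterate at `O` is the conjugate by `O` of the corrected block,
    -- whose symmetry is the optimality of `W`.
    have e : O * blochBlock (rightError U N 4) = O * (blochBlock (rightError U N 4) * O) * Oᵀ := by
      rw [Matrix.mul_assoc, Matrix.mul_assoc, hO', Matrix.mul_one]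
    rw [e, Matrix.transpose_mul, Matrix.transpose_mul, hsymA, Matrix.transpose_transpose]
    simp only [Matrix.mul_assoc]
  have hdecay := hd'.decay h' hκ hO (hO1.trans (by norm_num)) hsym m
  rw [show ∀ t : ℝ, 1 / 2 + 1 / 6 * t - (1 / 2 + 1 / 2 * p' ^ m) = 1 / 2 * (t / 3 - p' ^ m) from
    fun t => by ring, abs_mul, abs_of_pos (by norm_num : (0 : ℝ) < 1 / 2)]
  linarith [abs_nonneg (((noisyTwirl (fun i => O * blochBlock (unitaryChannel (U i)) * Oᵀ)
      (fun i => blochBlock (N i)) ^ m) 1).trace / 3 - p' ^ m)]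

theorem exists_isHighestEigenvalue_twirl (hU : IsUnitaryTwoDesign U) (hN : ∀ i, IsPosTP (N i))
    (hF : 1 - 1 / 10 ^ 40 ≤ gateSetFidelity N (fun i => unitaryChannel (U i)) 1) :
    ∃ p : ℝ, IsHighestEigenvalue (twirl U N) p ∧
      ∀ W, IsOptimalCorrection (rightError U N 4) W → ∀ m : ℕ,
        |gateSetFidelity N (fun i => unitaryChannel (W * U i * star W)) m
          - (1 / 2 + 1 / 2 * p ^ m)| ≤ 10 ^ 9 * (1 - p) ^ 2 := by
  have hη := sqrt_two_mul_twirlDefect_le hN hF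
  obtain ⟨p, X, Y, hd⟩ :=
    (isNoisyDesign_blochBlock hU hN).exists_dominantPair (hη.trans (by norm_num))
  refine ⟨p, isHighestEigenvalue_twirl hU hN hd ?_,
    fun W hW m => abs_gateSetFidelity_sub_le hU hN hF hd hW m⟩
  have hp := (abs_le.1 hd.eigenvalue).1
  have hκ : twirlDefect (fun i => blochBlock (unitaryChannel (U i)))
      (fun i => blochBlock (N i)) ≤ 1 / 10 ^ 7 := by
    rw [twirlDefect_eq hN]
    norm_num at hF ⊢
    linarith
  norm_num at hη hκ ⊢
  linarith

theorem IsOptimalCorrection.coherenceDefect_le {Λ : Superop 2} (h : IsPosTP Λ)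
    {W : unitaryGroup (Fin 2) ℂ} (hW : IsOptimalCorrection Λ W)
    (hΛ : ‖blochBlock Λ - 1‖ ≤ 1 / 1000) :
    coherenceDefect (Λ * unitaryChannel W) ≤
      12 * (1 - avgFidelity (Λ * unitaryChannel W) 1) ^ 2 := by
  have hmul := (isPosTP_unitaryChannel W).blochBlock_mul (Λ := Λ)
  refine _root_.coherenceDefect_le (h.mul (isPosTP_unitaryChannel W)) ?_ ?_
  · rw [hmul, hW.transpose_eq h]
  · have h1 := (isOptimalCorrection_iff h).1 hW 1
    rw [unitaryChannel_one, blochBlock_one, Matrix.mul_one] at h1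
    have h2 := abs_trace_le (blochBlock Λ - 1)
    rw [Matrix.trace_sub, Matrix.trace_one, Fintype.card_fin] at h2
    have h3 := (abs_le.1 h2).1
    rw [hmul]
    push_cast at h3
    linarith

theorem blochBlock_eq_mul_transpose {Λ : Superop 2} (W : unitaryGroup (Fin 2) ℂ) :
    blochBlock Λ = blochBlock (Λ * unitaryChannel W) * (blochBlock (unitaryChannel W))ᵀ := by
  rw [(isPosTP_unitaryChannel W).blochBlock_mul, Matrix.mul_assoc,
    mul_eq_one_comm.1 (blochBlock_unitaryChannel_orth W), Matrix.mul_one]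

theorem optimalCorrection_properties {Λ : Superop 2} (h : IsPosTP Λ)
    (hΛ : ‖blochBlock Λ - 1‖ ≤ 1 / 1000) :
    (∃ W, IsOptimalCorrection Λ W) ∧
    (∀ W W', IsOptimalCorrection Λ W → IsOptimalCorrection Λ W' →
      unitaryChannel W = unitaryChannel W') ∧
    (∀ W, IsOptimalCorrection Λ W →
      (blochBlock (Λ * unitaryChannel W)).PosDef ∧
      blochBlock Λ = blochBlock (Λ * unitaryChannel W) * (blochBlock (unitaryChannel W))ᵀ ∧
      coherenceDefect (Λ * unitaryChannel W) ≤
        12 * (1 - avgFidelity (Λ * unitaryChannel W) 1) ^ 2) ∧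
    (∀ D V : Matrix (Fin 3) (Fin 3) ℝ, D.PosSemidef → V ∈ orthogonalGroup (Fin 3) ℝ →
      blochBlock Λ = D * V →
      ∃ W, blochBlock (unitaryChannel W) = Vᵀ ∧ IsOptimalCorrection Λ W) := by
  refine ⟨exists_isOptimalCorrection h, fun W W' hW hW' => hW.unique h hW' hΛ, fun W hW =>
    ⟨?_, blochBlock_eq_mul_transpose W, hW.coherenceDefect_le h hΛ⟩,
    fun D V hD hV hDV => ?_⟩
  · rw [(isPosTP_unitaryChannel W).blochBlock_mul]
    exact hW.posDef h hΛ
  · obtain ⟨W, hW⟩ := exists_isOptimalCorrection h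
    exact ⟨W, hW.eq_transpose_of_polar h hΛ hD ((mem_orthogonalGroup_iff _ _).1 hV) hDV, hW⟩

theorem norm_blochBlock_rightError_sub_one_le_inv_thousand (hU : IsUnitaryTwoDesign U)
    (hN : ∀ i, IsPosTP (N i))
    (hF : 1 - 1 / 10 ^ 40 ≤ gateSetFidelity N (fun i => unitaryChannel (U i)) 1) :
    ‖blochBlock (rightError U N 4) - 1‖ ≤ 1 / 1000 :=
  (norm_blochBlock_rightError_sub_one_le hU hN hF).trans (by norm_num)

end main

end

/-! ### The theorem -/

theorem proposition2 :
    ∃ C : ℝ, 0 < C ∧ ∃ ε : ℝ, 0 < ε ∧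
      ∀ (ι : Type*) [Fintype ι] [Nonempty ι]
        (U : ι → unitaryGroup (Fin 2) ℂ) (N : ι → Superop 2),
        IsUnitaryTwoDesign U →
        (∀ i, IsChannel (N i)) →
        1 - ε ≤ gateSetFidelity N (fun i => unitaryChannel (U i)) 1 →
        -- the maximizer exists and is unique as a channel
        (∃ W, IsOptimalCorrection (rightError U N 4) W) ∧
        (∀ W W', IsOptimalCorrection (rightError U N 4) W →
          IsOptimalCorrection (rightError U N 4) W' → unitaryChannel W = unitaryChannel W') ∧
        -- the main estimate holds for it, with `p` the highest eigenvalue of the twirl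
        (∃ p : ℝ, IsHighestEigenvalue (twirl U N) p ∧
          ∀ W, IsOptimalCorrection (rightError U N 4) W → ∀ m : ℕ,
            |gateSetFidelity N (fun i => unitaryChannel (W * U i * star W)) m
              - (1 / 2 + 1 / 2 * p ^ m)| ≤ C * (1 - p) ^ 2) ∧
        -- it cancels the unitary part of the right error: what is left is positive and incoherent
        (∀ W, IsOptimalCorrection (rightError U N 4) W →
          (blochBlock (rightError U N 4 * unitaryChannel W)).PosDef ∧
          blochBlock (rightError U N 4) =
            blochBlock (rightError U N 4 * unitaryChannel W) * (blochBlock (unitaryChannel W))ᵀ ∧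
          coherenceDefect (rightError U N 4 * unitaryChannel W) ≤
            C * (1 - avgFidelity (rightError U N 4 * unitaryChannel W) 1) ^ 2) ∧
        -- it is read off from any polar decomposition of the Bloch block of the right error
        (∀ D V : Matrix (Fin 3) (Fin 3) ℝ, D.PosSemidef → V ∈ orthogonalGroup (Fin 3) ℝ →
          blochBlock (rightError U N 4) = D * V →
          ∃ W, blochBlock (unitaryChannel W) = Vᵀ ∧
            IsOptimalCorrection (rightError U N 4) W) := by
  refine ⟨10 ^ 9, by norm_num, 1 / 10 ^ 40, by norm_num, fun ι _ _ U N hU hN hF => ?_⟩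
  have hN' : ∀ i, IsPosTP (N i) := fun i => (hN i).isPosTP
  obtain ⟨h1, h2, h3, h4⟩ := optimalCorrection_properties (isPosTP_rightError hN' 4)
    (norm_blochBlock_rightError_sub_one_le_inv_thousand hU hN' hF)
  refine ⟨h1, h2, exists_isHighestEigenvalue_twirl hU hN' hF, fun W hW => ?_, h4⟩
  obtain ⟨h5, h6, h7⟩ := h3 W hW
  refine ⟨h5, h6, h7.trans ?_⟩
  gcongr
  norm_num
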